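/- Graphs may have multiple edges and loops. A block of a connected graph is a maximal connected subgraph without a cut vertex (loops being disregarded); a cactus is a connected graph with a cut vertex all of whose blocks are cycles (of length at least $2$) or single edges. Let $\Gamma$ be an infinite, locally finite, one-ended cactus with a root $v$. Let $\mathcal C_1\mathcal C_2\cdots$ be the unique infinite block-path of $\Gamma$ starting at $v$: the $\mathcal C_i$ are distinct blocks, $\mathcal C_i\cap\mathcal C_{i+1}=\{p_i\}$ with $p_1,p_2,\dots$ distinct, $v\in\mathcal C_1$ and $v\notin\mathcal C_2$. Let $|\mathcal C_i|$ be the number of vertices of $\mathcal C_i$, let $D(p_i)$ be the subgraph spanned by $p_i$ and all the finite components of $\Gamma\setminus\{p_i\}$, and let $d_i$ be the number of its vertices. Let $H_1\subset H_2\subset\cdots$ be an exhaustion of $\Gamma$ by finite connected subgraphs containing $v$ such that, for every $n$, exactly one vertex $p^{(n)}$ of $H_n$ has a neighbour in $\Gamma$ outside $H_n$. Consider the abelian sandpile model on $H_n$ with $p^{(n)}$ as its only dissipative vertex; let $\mu_n$ be the uniform distribution on its recurrent configurations, and let $\mathrm{Mav}_{H_n}(c,v)$ be the mass (the number of distinct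 vertices fired) of the avalanche triggered by adding a chip on $v$ to the recurrent configuration $c$. Say that $M$ occurs as the mass of an avalanche if, for infinitely many $n$, $\mathrm{Mav}_{H_n}(c,v)=M$ for some recurrent $c$. Suppose that $\sum_{j\ge 1,\ |\mathcal C_j|>2}\frac1{|\mathcal C_j|}$ converges, that there is a constant $c>0$ with $\mathrm{Diam}(D(p_i))\le c\,|\mathcal C_i|$ for all sufficiently large $i$, and that $\lim_{i\to\infty}\frac{\log d_{i-1}}{\log d_i}=1$. Put $$\beta:=\limsup_{i\to\infty}\frac{\log d_i}{\log \mathrm{Diam}(D(p_i))},\qquad \beta':=\liminf_{i\to\infty}\frac{\log d_i}{\log \mathrm{Diam}(D(p_i))}.$$ Then $L(M):=\lim_{n\to\infty}\mathbb P_{\mu_n}(\mathrm{Mav}_{H_n}(\cdot,v)=M)$ exists for every $M$, and: 1. There are constants $C_1,C_2>0$ such that for every $\varepsilon$ with $0<\varepsilon<\beta'$ there is $M_0$ such that, for every $M>M_0$ that occurs as the mass of an avalanche, $$C_1\,M^{-\frac{2}{\beta'-\varepsilon}}\le L(M)\le C_2\,M^{-\frac{2}{\beta+\varepsilon}},$$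 where the lower bound is asserted if $\beta'$ is finite and the upper bound if $\beta$ is finite (the upper bound then for every $\varepsilon>0$). 2. If $\beta=\beta'<\infty$, then the model on $\{H_n\}$ is critical with critical exponent $\delta=2/\beta$, that is, $\delta>0$ and there are constants $C_1,C_2>0$ such that for every $\varepsilon>0$ there is $M_\varepsilon\ge1$ with $C_1M^{-\delta-\varepsilon}\le L(M)\le C_2M^{-\delta+\varepsilon}$ for every $M>M_\varepsilon$ that occurs as the mass of an avalanche. 3. If $\Gamma$ has polynomial growth of degree $\alpha:=\limsup_{r\to\infty}\frac{\log|B_\Gamma(v,r)|}{\log r}<\infty$ and $\alpha=\lim_{i\to\infty}\frac{\log d_i}{\log\mathrm{Diam}(D(p_i))}$, then the model on $\{H_n\}$ is critical with critical exponent $\delta=2/\alpha$. -/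

import Mathlib

open Filter Topology
open scoped Graph

namespace CactusSandpile

/-! ### Multigraphs

Graphs are Mathlib's `Graph V E`: multiple edges and loops are allowed. -/

section Multigraph

variable {V E : Type*}

/-- The number of edges joining `u` and `w` (the number of loops at `u` when `w = u`). -/
noncomputable def mult (G : Graph V E) (u w : V) : ℕ := {e | G.IsLink e u w}.ncard

/-- The number of edges incident to `u`, each loop contributing two. -/
noncomputable def deg (G : Graph V E) (u : V) : ℕ :=
  {e | G.Inc e u}.ncard + {e | G.IsLoopAt e u}.ncard

def IsLocallyFinite (G : Graph V E) : Prop := ∀ u, {e | G.Inc e u}.Finite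

/-- The simple graph obtained by forgetting loops and multiplicities, on the ambient type `V`. -/
def underlying (G : Graph V E) : SimpleGraph V where
  Adj u w := u ≠ w ∧ G.Adj u w
  symm := ⟨fun _ _ h => ⟨h.1.symm, h.2.symm⟩⟩
  loopless := ⟨fun _ h => h.1 rfl⟩

def IsConnected (G : Graph V E) : Prop := ((underlying G).induce V(G)).Connected

/-- `q` is a cut vertex of `G`: removing it disconnects `G`. -/
def IsCutVertex (G : Graph V E) (q : V) : Prop :=
  q ∈ V(G) ∧ ¬ ((underlying G).induce (V(G) \ {q})).Preconnected

/-- The subgraph of `G` spanned by `B` is connected and has no cut vertex. -/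
def IsNonseparable (G : Graph V E) (B : Set V) : Prop :=
  B ⊆ V(G) ∧ ((underlying G).induce B).Connected ∧
    ∀ q ∈ B, ((underlying G).induce (B \ {q})).Preconnected

/-- `B` is the vertex set of a block: a maximal connected subgraph without a cut vertex.
A block contains all the non-loop edges between its vertices, so it is given by its vertex set;
loops do not matter for separability and are disregarded. -/
def IsBlock (G : Graph V E) (B : Set V) : Prop := Maximal (IsNonseparable G) B

/-- Up to loops, the subgraph of `G` spanned by `B` is a cycle of length `k ≥ 2`
(for `k = 2`: two vertices joined by exactly two edges). -/
def IsCycle (G : Graph V E) (B : Set V) : Prop :=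
  ∃ k : ℕ, 2 ≤ k ∧ ∃ f : ZMod k → V, Function.Injective f ∧ Set.range f = B ∧
    ∀ i j, i ≠ j →
      mult G (f i) (f j) = (if j = i + 1 then 1 else 0) + (if i = j + 1 then 1 else 0)

/-- Up to loops, the subgraph of `G` spanned by `B` is a single edge. -/
def IsSingleEdge (G : Graph V E) (B : Set V) : Prop :=
  ∃ u w, u ≠ w ∧ B = {u, w} ∧ mult G u w = 1

/-- A cactus: a separable graph all of whose blocks are cycles or single edges. -/
structure IsCactus (G : Graph V E) : Prop where
  connected : IsConnected G
  separable : ∃ q, IsCutVertex G q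
  blocks : ∀ B, IsBlock G B → IsCycle G B ∨ IsSingleEdge G B

/-- `G` has exactly one end. -/
def IsOneEnded (G : Graph V E) : Prop := ∃! e, e ∈ (underlying G).end

/-- `C 0, C 1, …` is an infinite block-path starting at `v`, with cut vertex `p i` between `C i`
and `C (i + 1)`. The path does not turn around a vertex, i.e. it is a shortest block-path
between any two of its blocks: its cut vertices are distinct. -/
structure IsInfiniteBlockPath (G : Graph V E) (v : V) (C : ℕ → Set V) (p : ℕ → V) : Prop where
  block : ∀ i, IsBlock G (C i)
  injective_block : Function.Injective C
  inter : ∀ i, C i ∩ C (i + 1) = {p i}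
  injective_cut : Function.Injective p
  root_mem : v ∈ C 0
  root_notMem : v ∉ C 1

/-- The vertex set of `D(q)`: the vertex `q` together with all the finite connected components
that remain when `q` is removed. -/
def finitePart (G : Graph V E) (q : V) : Set V :=
  insert q {w | ∃ K : (underlying G).ComponentCompl {q}, (K : Set V).Finite ∧ w ∈ K}

/-- The diameter of the subgraph spanned by `B`. -/
noncomputable def spanDiam (G : Graph V E) (B : Set V) : ℕ := ((underlying G).induce B).diam

/-- `log d_i / log Diam(D(p_i))`. -/
noncomputable def logRatio (G : Graph V E) (p : ℕ → V) (i : ℕ) : ℝ :=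
  Real.log (finitePart G (p i)).ncard / Real.log (spanDiam G (finitePart G (p i)))

/-- `G` has polynomial growth of (finite) degree `a`, measured by balls around `v`. -/
def HasPolynomialGrowth (G : Graph V E) (v : V) (a : ℝ) : Prop :=
  limsup (fun r : ℕ =>
    ((Real.log {w | (underlying G).dist v w ≤ r}.ncard / Real.log r : ℝ) : EReal)) atTop
      = (a : EReal)

end Multigraph

/-! ### The abelian sandpile model -/

section Sandpile

variable {V E : Type*}

/-- Chip configurations on `H` with set of dissipative vertices `P`. -/
abbrev Config (H : Graph V E) (P : Set V) := ↥(V(H) \ P) → ℕ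

variable {H : Graph V E} {P : Set V}

def IsStable (c : Config H P) : Prop := ∀ u, c u < deg H u

open Classical in
/-- Firing `u`: one chip is sent along each edge end at `u` (so the two chips sent along a loop
come back); chips that reach a dissipative vertex are lost. -/
noncomputable def fire (c : Config H P) (u : ↥(V(H) \ P)) : Config H P := fun w =>
  if w = u then c u - deg H u + 2 * mult H u u else c w + mult H u w

/-- `IsAvalanche c l d`: firing successively the vertices of `l`, each of them unstable at the
moment it is fired, leads from `c` to the stable configuration `d`. -/
inductive IsAvalanche : Config H P → List ↥(V(H) \ P) → Config H P → Prop
  | nil (c : Config H P) : IsStable c → IsAvalanche c [] c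
  | cons (c d : Config H P) (u : ↥(V(H) \ P)) (l : List ↥(V(H) \ P)) :
      deg H u ≤ c u → IsAvalanche (fire c u) l d → IsAvalanche c (u :: l) d

open Classical in
/-- Add one chip on `v` (the chip is lost if `v` is dissipative). -/
noncomputable def addChip (c : Config H P) (v : V) : Config H P := fun w =>
  c w + if (w : V) = v then 1 else 0

/-- The transitions of positive probability of the sandpile Markov chain: add a chip on some
non-dissipative vertex and stabilize. -/
def Transition (c d : Config H P) : Prop :=
  ∃ u : ↥(V(H) \ P), ∃ l, IsAvalanche (addChip c u) l d

/-- Recurrent states of the Markov chain on the finite set of stable configurations: `c` can be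
reached again from every state that can be reached from `c`. -/
def IsRecurrent (c : Config H P) : Prop :=
  IsStable c ∧ ∀ d, Relation.ReflTransGen Transition c d → Relation.ReflTransGen Transition d c

/-- The avalanche triggered by adding a chip on `v` to `c` has mass `M`: `M` distinct vertices
are fired in it. -/
def HasMass (c : Config H P) (v : V) (M : ℕ) : Prop :=
  ∃ l d, IsAvalanche (addChip c v) l d ∧ {u | u ∈ l}.ncard = M

variable (H P)

/-- The probability, for the uniform distribution on recurrent configurations, that the avalanche
triggered by adding a chip on `v` has mass `M`. -/
noncomputable def massProb (v : V) (M : ℕ) : ℝ :=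
  ({c : Config H P | IsRecurrent c ∧ HasMass c v M}.ncard : ℝ) /
    ({c : Config H P | IsRecurrent c}.ncard : ℝ)

end Sandpile

/-! ### Exhaustions and criticality -/

section Exhaustion

variable {V E : Type*}

/-- The internal boundary of `H` in `G`: vertices of `H` with a neighbour in `G` outside `H`. -/
def innerBoundary (G H : Graph V E) : Set V := {u | u ∈ V(H) ∧ ∃ w, w ∉ V(H) ∧ G.Adj u w}

/-- An exhaustion of `(G, v)` by finite connected subgraphs that contain the root and whose
internal boundary is a single vertex. -/
structure IsExhaustion (G : Graph V E) (v : V) (H : ℕ → Graph V E) : Prop where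
  mono : Monotone H
  le : ∀ n, H n ≤ G
  finite : ∀ n, V(H n).Finite
  connected : ∀ n, IsConnected (H n)
  root_mem : ∀ n, v ∈ V(H n)
  boundary : ∀ n, ∃ q, innerBoundary G (H n) = {q}
  exhausts_vertices : ∀ u ∈ V(G), ∃ n, u ∈ V(H n)
  exhausts_edges : ∀ e ∈ E(G), ∃ n, e ∈ E(H n)

/-- The law of the mass of the avalanche triggered at `v` in `H n`, the internal boundary of
`H n` being dissipative. -/
noncomputable def avalancheLaw (G : Graph V E) (v : V) (H : ℕ → Graph V E) (n M : ℕ) : ℝ :=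
  massProb (H n) (innerBoundary G (H n)) v M

/-- `M` occurs as the mass of an avalanche, in `H n` for arbitrarily large `n`. -/
def OccursAsMass (G : Graph V E) (v : V) (H : ℕ → Graph V E) (M : ℕ) : Prop :=
  ∃ᶠ n in atTop, ∃ c : Config (H n) (innerBoundary G (H n)), IsRecurrent c ∧ HasMass c v M

/-- The sandpile model on the sequence `H` approximating `(G, v)` is critical, with critical
exponent `δ`, with respect to the mass of avalanches. -/
def IsCritical (G : Graph V E) (v : V) (H : ℕ → Graph V E) (δ : ℝ) : Prop :=
  0 < δ ∧ ∃ L : ℕ → ℝ, (∀ M, Tendsto (fun n => avalancheLaw G v H n M) atTop (𝓝 (L M))) ∧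
    ∃ C₁ > (0 : ℝ), ∃ C₂ > (0 : ℝ), ∀ ε > (0 : ℝ), ∃ M₀ : ℕ, 1 ≤ M₀ ∧ ∀ M : ℕ, M₀ < M →
      OccursAsMass G v H M →
        C₁ * (M : ℝ) ^ (-δ - ε) ≤ L M ∧ L M ≤ C₂ * (M : ℝ) ^ (-δ + ε)

end Exhaustion

end CactusSandpile

open CactusSandpile

/-!
# Avalanche exponents of sandpiles on one-ended cacti

Everything is expressed through a `Network` (weights and degrees) on the vertices of the graph and a
finite set `B` of non-dissipative vertices. Recurrent states of the Markov chain are the stable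
configurations without forbidden subconfiguration (`isRecurrent_iff`), and the mass of an avalanche
is the size of the support of its odometer, the unique function whose Laplacian carries the
configuration with the added chip to a recurrent one (`hasMass_iff`).

**Geometry.** Every vertex `u` has a gate in each block `C i` of the infinite block-path, the vertex
of `C i` at which `u` hangs. The vertices whose gate in `C i` is not `p i` form `inner i`, those
whose gate in `C (i + 1)` is `p i` form `outer i`, which is the vertex set of `D(p i)`; so
`inner i ⊆ outer i ⊆ inner (i + 1)`, and `inner i` is attached to the rest of the graph at `p i`
only. In an exhaustion with one-vertex boundaries the boundary is eventually some `p m` with `m`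
large. An avalanche that fires `p i` fires all of `D(p i)`. Hence an avalanche of mass `M < d_i`
does not fire `p i` and its law is that of the finite network `inner (i + 1)`, whatever happens
outside (`IsFinitary.eventually_avalancheLaw`). This gives the limit law `L`.

**One cycle.** Since `diam D(p i) ≤ c |C i|`, the block `C i` is a long cycle for large `i`. In a
recurrent configuration at most one vertex of the cycle other than its exit is vacant (lacks a
chip). The index of this vertex, or `0` if there is none, is the state of the cycle. It can be
changed freely, so it is uniform on `|C i|` values and independent of the rest
(`recurrent_setState`). A chip that enters the cycle moves the state as in the sandpile model on a
path, and `τ` incoming chips leave as `τ` chips unless the state is one of at most two exceptional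
values (`exists_pathFiring_outflow`).

**The law of the mass.** For `d_i ≤ M < d_(i+1)`, an avalanche of mass `M` enters the cycle
`C (i + 1)` and is stopped at `p (i + 1)`. The mass then determines the state of `C (i + 1)` up to
two values, and the state of `C (i + 2)` completely, so `L M ≤ 2 / (|C (i+1)| |C (i+2)|)`.
Conversely, if `M` occurs at all, then it occurs for one pair of states whenever the chip on `v`
sends a certain number `τ ≤ 2` of chips to `p i`. The probability `θ_i(τ)` of the latter satisfies
`θ_(i+1) ≥ θ_i (1 - 2 / |C (i+1)|)`, and `∑ 1 / |C j|` converges, so `θ_i(τ)` is either eventually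
zero or bounded below. Thus `L M` is of the order of `1 / (|C (i+1)| |C (i+2)|)`
(`IsFinitary.exists_limit`).

**Exponents.** Up to constants `|C i|` is the diameter of `D(p i)`, which lies between
`d_i ^ (1 / (β + ε))` and `d_i ^ (1 / (β' - ε))`; and `log d_i ∼ log d_(i+2)`, so that all the
scales involved may be compared with `M` (`Scales.lower_bound`, `Scales.upper_bound`).
-/

namespace CactusSandpile

open scoped Classical

/-! ### Networks, recurrence and odometers -/

/-- Toppling data on a vertex set: symmetric weights (the diagonal carries twice the number of
loops) and a degree that dominates every partial row sum. A vertex `u` of degree larger than the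
row sum over `B` loses chips to the outside of `B` when it is fired. -/
structure Network (V : Type*) where
  weight : V → V → ℕ
  deg : V → ℕ
  symm : ∀ u w, weight u w = weight w u
  sum_le : ∀ u (F : Finset V), ∑ w ∈ F, weight u w ≤ deg u

namespace Network

variable {V : Type*} (N : Network V) (B : Finset V)

/-- The reduced Laplacian of the network with non-dissipative set `B`: if every `u ∈ B` is fired
`n u` times, then `u` loses `lap B n u` chips. -/
noncomputable def lap (n : V → ℤ) (u : V) : ℤ :=
  n u * N.deg u - ∑ w ∈ B, (N.weight u w : ℤ) * n w

/-- No nonempty subset of `B` is a forbidden subconfiguration (Dhar's criterion). -/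
def NoForbidden (x : V → ℤ) : Prop :=
  ∀ F ⊆ B, F.Nonempty → ∃ u ∈ F, ∑ w ∈ F, (N.weight u w : ℤ) ≤ x u

/-- Stable configurations on `B` without forbidden subconfiguration. Only the values on `B`
matter. -/
structure Recurrent (x : V → ℤ) : Prop where
  stable : ∀ u ∈ B, x u < N.deg u
  noForbidden : N.NoForbidden B x

variable {N B}

lemma sum_le' (u : V) (F : Finset V) : ∑ w ∈ F, (N.weight u w : ℤ) ≤ N.deg u := by
  exact_mod_cast N.sum_le u F

lemma lap_sub (n n' : V → ℤ) (u : V) :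
    N.lap B (fun w => n w - n' w) u = N.lap B n u - N.lap B n' u := by
  simp only [lap, mul_sub, Finset.sum_sub_distrib]; ring

lemma lap_add (n n' : V → ℤ) (u : V) :
    N.lap B (fun w => n w + n' w) u = N.lap B n u + N.lap B n' u := by
  simp only [lap, mul_add, Finset.sum_add_distrib]; ring

lemma lap_mul (a : ℤ) (n : V → ℤ) (u : V) :
    N.lap B (fun w => a * n w) u = a * N.lap B n u := by
  simp only [lap, mul_sub, Finset.mul_sum]; congr 1
  · ring
  · exact Finset.sum_congr rfl fun w _ => by ring

lemma lap_congr {n n' : V → ℤ} (h : ∀ w ∈ B, n w = n' w) {u : V} (hu : u ∈ B) :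
    N.lap B n u = N.lap B n' u := by
  simp only [lap, h u hu]; congr 1
  exact Finset.sum_congr rfl fun w hw => by rw [h w hw]

lemma lap_eq_of_support {B' : Finset V} (hB : B' ⊆ B) {n : V → ℤ} (h : ∀ w ∈ B, w ∉ B' → n w = 0)
    (u : V) : N.lap B n u = N.lap B' n u := by
  simp only [lap]; congr 1
  refine (Finset.sum_subset hB fun w hw hw' => ?_).symm
  rw [h w hw hw', mul_zero]

lemma NoForbidden.mono {x y : V → ℤ} (h : N.NoForbidden B x) (hxy : ∀ u ∈ B, x u ≤ y u) :
    N.NoForbidden B y := fun F hF hne => by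
  obtain ⟨u, hu, h1⟩ := h F hF hne
  exact ⟨u, hu, h1.trans (hxy u (hF hu))⟩

lemma NoForbidden.subset {B' : Finset V} {x : V → ℤ} (h : N.NoForbidden B x) (hB : B' ⊆ B) :
    N.NoForbidden B' x := fun F hF => h F (hF.trans hB)

lemma NoForbidden.nonneg {x : V → ℤ} (h : N.NoForbidden B x) {u : V} (hu : u ∈ B) : 0 ≤ x u := by
  obtain ⟨w, hw, h1⟩ := h {u} (by simpa using hu) (by simp)
  rw [Finset.mem_singleton] at hw
  subst hw
  simp only [Finset.sum_singleton] at h1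
  exact le_trans (by positivity) h1

lemma Recurrent.congr {x y : V → ℤ} (h : N.Recurrent B x) (hxy : ∀ u ∈ B, x u = y u) :
    N.Recurrent B y :=
  ⟨fun u hu => hxy u hu ▸ h.stable u hu, h.noForbidden.mono fun u hu => (hxy u hu).le⟩

lemma Recurrent.subset {B' : Finset V} {x : V → ℤ} (h : N.Recurrent B x) (hB : B' ⊆ B) :
    N.Recurrent B' x :=
  ⟨fun u hu => h.stable u (hB hu), h.noForbidden.subset hB⟩

/-- The comparison principle behind uniqueness: starting from a configuration without forbidden
subconfiguration, a stable configuration can only be reached by nonnegative firings. On the set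
where a negative `n` is minimal, the vertex that is not forbidden would be unstable in `d`. -/
lemma NoForbidden.nonneg_of_stable {x d n : V → ℤ} (hx : N.NoForbidden B x)
    (hd : ∀ u ∈ B, d u < N.deg u) (h : ∀ u ∈ B, d u = x u - N.lap B n u) :
    ∀ u ∈ B, 0 ≤ n u := by
  by_contra! hcon
  obtain ⟨u₀, hu₀, hneg⟩ := hcon
  obtain ⟨a, ha, hmin⟩ := B.exists_min_image n ⟨u₀, hu₀⟩
  have hμ : n a < 0 := (hmin u₀ hu₀).trans_lt hneg
  obtain ⟨u, hu, h1⟩ := hx (B.filter fun w => n w = n a) (Finset.filter_subset _ _)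
    ⟨a, by simp [ha]⟩
  rw [Finset.mem_filter] at hu
  have h2 := hd u hu.1
  rw [h u hu.1, lap, hu.2] at h2
  have h3 : (n a + 1) * ∑ w ∈ B, (N.weight u w : ℤ)
      - ∑ w ∈ B.filter (fun w => n w = n a), (N.weight u w : ℤ)
      ≤ ∑ w ∈ B, (N.weight u w : ℤ) * n w := by
    rw [Finset.sum_filter, Finset.mul_sum, ← Finset.sum_sub_distrib]
    refine Finset.sum_le_sum fun w hw => ?_
    have h0 : (0 : ℤ) ≤ N.weight u w := by positivity
    split_ifs with hwa
    · rw [hwa]; linarith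
    · have : n a + 1 ≤ n w := lt_of_le_of_ne (hmin w hw) (Ne.symm hwa)
      nlinarith
  have h4 := N.sum_le' u B
  nlinarith

/-- A class of configurations modulo the Laplacian contains at most one recurrent one, and the
firings leading to it are determined. -/
lemma Recurrent.eq_of_sub_lap {x n n' : V → ℤ} (h : N.Recurrent B fun u => x u - N.lap B n u)
    (h' : N.Recurrent B fun u => x u - N.lap B n' u) : ∀ u ∈ B, n u = n' u := by
  have h1 := h.noForbidden.nonneg_of_stable (n := fun u => n' u - n u) h'.stable
    fun u _ => by rw [lap_sub]; ring
  have h2 := h'.noForbidden.nonneg_of_stable (n := fun u => n u - n' u) h.stable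
    fun u _ => by rw [lap_sub]; ring
  intro u hu
  have := h1 u hu
  have := h2 u hu
  omega

lemma Recurrent.eq_zero_of_sub_lap {x n : V → ℤ} (h : N.Recurrent B x)
    (h' : N.Recurrent B fun u => x u - N.lap B n u) : ∀ u ∈ B, n u = 0 := by
  refine Recurrent.eq_of_sub_lap h' (n' := fun _ => 0) (h.congr fun u _ => ?_)
  simp [lap]

/-- If all the edges leaving `S` start at `x`, then firing `x` in an avalanche entails firing all
of `S`. -/
lemma NoForbidden.pos_of_pos {y n : V → ℤ} (hy : N.NoForbidden B y)
    (hst : ∀ u ∈ B, y u - N.lap B n u < N.deg u) {S : Finset V} (hS : S ⊆ B) {x : V}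
    (hdeg : ∀ u ∈ S, u ≠ x → N.deg u = ∑ w ∈ S, N.weight u w)
    (hx : 0 < n x) : ∀ u ∈ S, 0 < n u := by
  have hn := hy.nonneg_of_stable hst fun u _ => rfl
  by_contra! hcon
  obtain ⟨u₀, hu₀, h0⟩ := hcon
  obtain ⟨u, hu, h1⟩ := hy (S.filter fun w => n w = 0) ((Finset.filter_subset _ _).trans hS)
    ⟨u₀, by simp [hu₀, le_antisymm h0 (hn u₀ (hS hu₀))]⟩
  rw [Finset.mem_filter] at hu
  have h2 := hst u (hS hu.1)
  rw [lap, hu.2, hdeg u hu.1 (by rintro rfl; omega)] at h2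
  have h3 : ∑ w ∈ S, (N.weight u w : ℤ) * n w ≤ ∑ w ∈ B, (N.weight u w : ℤ) * n w :=
    Finset.sum_le_sum_of_subset_of_nonneg hS fun w hw _ =>
      mul_nonneg (by positivity) (hn w hw)
  have h4 : ∑ w ∈ S, (N.weight u w : ℤ)
      - ∑ w ∈ S.filter (fun w => n w = 0), (N.weight u w : ℤ)
      ≤ ∑ w ∈ S, (N.weight u w : ℤ) * n w := by
    rw [Finset.sum_filter, ← Finset.sum_sub_distrib]
    refine Finset.sum_le_sum fun w hw => ?_
    have h0 : (0 : ℤ) ≤ N.weight u w := by positivity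
    split_ifs with hwa
    · rw [hwa]; linarith
    · have : 1 ≤ n w := by have := hn w (hS hw); omega
      nlinarith
  push_cast at h2
  linarith

/-- `n` is the odometer of the avalanche triggered in `c` by a chip on `v`. -/
structure IsOdometer (N : Network V) (B : Finset V) (v : V) (c n : V → ℤ) : Prop where
  support : ∀ u, u ∉ B → n u = 0
  recurrent : N.Recurrent B fun u => c u + (if u = v then 1 else 0) - N.lap B n u

/-- The avalanche triggered in `c` by a chip on `v` fires `M` distinct vertices. -/
def MassIs (N : Network V) (B : Finset V) (v : V) (c : V → ℤ) (M : ℕ) : Prop :=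
  ∃ n, N.IsOdometer B v c n ∧ (B.filter fun u => 0 < n u).card = M

lemma Recurrent.noForbidden_add {v : V} {c : V → ℤ} (hc : N.Recurrent B c) :
    N.NoForbidden B fun u => c u + if u = v then 1 else 0 :=
  hc.noForbidden.mono fun u _ => by split_ifs <;> omega

lemma IsOdometer.nonneg {v : V} {c n : V → ℤ} (h : N.IsOdometer B v c n) (hc : N.Recurrent B c)
    (u : V) : 0 ≤ n u := by
  by_cases hu : u ∈ B
  · exact (hc.noForbidden_add (v := v)).nonneg_of_stable h.recurrent.stable (fun u _ => rfl) u hu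
  · rw [h.support u hu]

lemma IsOdometer.unique {v : V} {c n n' : V → ℤ} (h : N.IsOdometer B v c n)
    (h' : N.IsOdometer B v c n') : n = n' := by
  funext u
  by_cases hu : u ∈ B
  · exact h.recurrent.eq_of_sub_lap h'.recurrent u hu
  · rw [h.support u hu, h'.support u hu]

lemma IsOdometer.pos_of_pos {v : V} {c n : V → ℤ} (h : N.IsOdometer B v c n)
    (hc : N.Recurrent B c) {S : Finset V} (hS : S ⊆ B) {x : V}
    (hdeg : ∀ u ∈ S, u ≠ x → N.deg u = ∑ w ∈ S, N.weight u w) (hx : 0 < n x) :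
    ∀ u ∈ S, 0 < n u :=
  (hc.noForbidden_add (v := v)).pos_of_pos h.recurrent.stable hS hdeg hx

/-- An avalanche can enter a set that does not contain the root only along an edge whose outer
end is fired. -/
lemma IsOdometer.eq_zero_of_unfired {v : V} {c n : V → ℤ} (h : N.IsOdometer B v c n)
    (hc : N.Recurrent B c) {S : Finset V} (hS : S ⊆ B) (hv : v ∉ S)
    (hb : ∀ s ∈ S, ∀ w ∈ B, w ∉ S → n w ≠ 0 → N.weight s w = 0) : ∀ s ∈ S, n s = 0 := by
  have hn := h.nonneg hc
  -- The firings outside `S` alone already stabilize the configuration.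
  set n' : V → ℤ := fun u => if u ∈ S then 0 else n u with hn'
  have key := h.recurrent.noForbidden.nonneg_of_stable (n := fun u => n' u - n u)
    (d := fun u => c u + (if u = v then 1 else 0) - N.lap B n' u) ?_ fun u _ => by
      rw [lap_sub]; ring
  · intro s hs
    have h1 := key s (hS hs)
    simp only [hn', hs, if_true] at h1
    have := hn s
    omega
  · intro u hu
    simp only [lap]
    by_cases hus : u ∈ S
    · have h1 : ∑ w ∈ B, (N.weight u w : ℤ) * n' w = 0 := by
        refine Finset.sum_eq_zero fun w hw => ?_
        by_cases hws : w ∈ S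
        · simp [hn', hws]
        · by_cases hw0 : n w = 0
          · simp [hn', hw0]
          · simp [hb u hus w hw hws hw0]
      have huv : u ≠ v := by rintro rfl; exact hv hus
      rw [h1]
      simpa [hn', hus, huv] using hc.stable u hu
    · have h1 := h.recurrent.stable u hu
      simp only [lap] at h1
      have h2 : ∑ w ∈ B, (N.weight u w : ℤ) * n' w ≤ ∑ w ∈ B, (N.weight u w : ℤ) * n w := by
        refine Finset.sum_le_sum fun w _ => mul_le_mul_of_nonneg_left ?_ (by positivity)
        simp only [hn']; split_ifs
        · exact hn w
        · exact le_rfl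
      have h3 : n' u = n u := by simp [hn', hus]
      rw [h3]
      linarith

/-- `A` is joined to the rest of the network only through `p`. -/
structure IsPendant (N : Network V) (A : Finset V) (p : V) : Prop where
  notMem : p ∉ A
  deg_eq : ∀ u ∈ A, N.deg u = ∑ w ∈ insert p A, N.weight u w

lemma weight_eq_zero_of_deg_eq {A : Finset V} {u w : V} (h : N.deg u = ∑ w ∈ A, N.weight u w)
    (hw : w ∉ A) : N.weight u w = 0 := by
  have := N.sum_le u (insert w A)
  rw [Finset.sum_insert hw, ← h] at this
  omega

lemma IsPendant.weight_eq_zero {A : Finset V} {p u w : V} (h : N.IsPendant A p) (hu : u ∈ A)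
    (hw : w ∉ A) (hwp : w ≠ p) : N.weight u w = 0 :=
  weight_eq_zero_of_deg_eq (h.deg_eq u hu) (by simp [hw, hwp])

/-- Recurrent configurations factor over a pendant part. -/
lemma Recurrent.glue {A : Finset V} {p : V} (hA : N.IsPendant A p) {c e : V → ℤ}
    (hc : N.Recurrent B c) (he : N.Recurrent A e) (hAB : A ⊆ B) :
    N.Recurrent B fun u => if u ∈ A then e u else c u := by
  refine ⟨fun u hu => ?_, fun F hF hne => ?_⟩
  · split_ifs with h
    · exact he.stable u h
    · exact hc.stable u hu
  by_cases hp : p ∈ F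
  · -- All of `A` burns once `p` has burnt, so `A` may be added to `F`.
    obtain ⟨u, hu, h1⟩ := hc.noForbidden (F ∪ A) (Finset.union_subset hF hAB)
      (hne.mono Finset.subset_union_left)
    have huA : u ∉ A := fun huA => by
      have h2 := hc.stable u (hAB huA)
      have h3 : ∑ w ∈ insert p A, N.weight u w ≤ ∑ w ∈ F ∪ A, N.weight u w :=
        Finset.sum_le_sum_of_subset (Finset.insert_subset (by simp [hp])
          Finset.subset_union_right)
      rw [hA.deg_eq u huA] at h2
      have h4 : ((∑ w ∈ insert p A, N.weight u w : ℕ) : ℤ)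
        ≤ ((∑ w ∈ F ∪ A, N.weight u w : ℕ) : ℤ) := by exact_mod_cast h3
      push_cast at h2 h4
      linarith
    have huF : u ∈ F := by simpa [huA] using hu
    refine ⟨u, huF, ?_⟩
    simp only [huA, if_false]
    exact le_trans (Finset.sum_le_sum_of_subset_of_nonneg Finset.subset_union_left
      fun _ _ _ => by positivity) h1
  · by_cases hFA : (F ∩ A).Nonempty
    · obtain ⟨u, hu, h1⟩ := he.noForbidden (F ∩ A) Finset.inter_subset_right hFA
      rw [Finset.mem_inter] at hu
      refine ⟨u, hu.1, ?_⟩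
      simp only [hu.2, if_true]
      rwa [Finset.sum_subset (Finset.inter_subset_left : F ∩ A ⊆ F)] at h1
      intro w hw hw'
      rw [hA.weight_eq_zero hu.2 (fun h => hw' (Finset.mem_inter.2 ⟨hw, h⟩))
        (by rintro rfl; exact hp hw)]
      rfl
    · obtain ⟨u, hu, h1⟩ := hc.noForbidden F hF hne
      refine ⟨u, hu, ?_⟩
      have : u ∉ A := fun h => hFA ⟨u, by simp [hu, h]⟩
      simpa only [this, if_false] using h1

/-- The recurrent configurations on `B`, extended by zero. -/
def recurrents (N : Network V) (B : Finset V) : Set (V → ℤ) :=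
  {c | (∀ u, u ∉ B → c u = 0) ∧ N.Recurrent B c}

lemma finite_recurrents : (N.recurrents B).Finite := by
  have : (Set.pi Set.univ fun u : B => Set.Ico (0 : ℤ) (N.deg u)).Finite :=
    Set.Finite.pi fun u => Set.finite_Ico _ _
  refine Set.Finite.of_injOn (f := fun c (u : B) => c u) (t := _) ?_ ?_ this
  · intro c hc u _
    exact ⟨hc.2.noForbidden.nonneg u.2, hc.2.stable u u.2⟩
  · intro c hc c' hc' h
    funext u
    by_cases hu : u ∈ B
    · exact congrFun h ⟨u, hu⟩
    · rw [hc.1 u hu, hc'.1 u hu]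

/-- The maximal stable configuration is recurrent as soon as some superharmonic function is strict
everywhere on `B`. -/
lemma recurrent_max {h : V → ℤ} (h0 : ∀ u ∈ B, 0 ≤ h u) (h1 : ∀ u ∈ B, 1 ≤ N.lap B h u) :
    N.Recurrent B fun u => N.deg u - 1 := by
  refine ⟨fun u _ => by omega, fun F hF hne => ?_⟩
  obtain ⟨u, hu, hmin⟩ := F.exists_min_image h hne
  refine ⟨u, hu, ?_⟩
  have h2 := h1 u (hF hu)
  rw [lap] at h2
  have h3 : ∑ w ∈ F, (N.weight u w : ℤ) * h u ≤ ∑ w ∈ B, (N.weight u w : ℤ) * h w :=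
    (Finset.sum_le_sum fun w hw => mul_le_mul_of_nonneg_left (hmin w hw) (by positivity)).trans
      (Finset.sum_le_sum_of_subset_of_nonneg hF fun w hw _ =>
        mul_nonneg (by positivity) (h0 w hw))
  rw [← Finset.sum_mul] at h3
  have h4 := h0 u (hF hu)
  by_contra! hcon
  nlinarith

end Network

/-- Resampling: if one coordinate `r c` of the elements of a finite set can be changed freely, then
it is uniformly distributed. -/
lemma ncard_mul_ncard_resample {α β : Type*} {R : Set α} {R' E : Set β} (r : α → β)
    (glue : α → β → α) (hE : E ⊆ R') (hr : ∀ c ∈ R, r c ∈ R')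
    (hglue : ∀ c ∈ R, ∀ e ∈ R', glue c e ∈ R) (hrg : ∀ c ∈ R, ∀ e ∈ R', r (glue c e) = e)
    (hgg : ∀ c ∈ R, ∀ e ∈ R', glue (glue c e) (r c) = c) :
    {c ∈ R | r c ∈ E}.ncard * R'.ncard = E.ncard * R.ncard := by
  rw [← Set.ncard_prod, ← Set.ncard_prod]
  refine Set.ncard_congr (fun x _ => (r x.1, glue x.1 x.2)) ?_ ?_ ?_
  · rintro ⟨c, e⟩ ⟨⟨hc, hcE⟩, he⟩
    exact ⟨hcE, hglue c hc e he⟩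
  · rintro ⟨c, e⟩ ⟨c', e'⟩ ⟨⟨hc, hcE⟩, he⟩ ⟨⟨hc', hcE'⟩, he'⟩ h
    simp only [Prod.mk.injEq] at h ⊢
    refine ⟨?_, ?_⟩
    · rw [← hgg c hc e he, h.1, h.2, hgg c' hc' e' he']
    · rw [← hrg c hc e he, h.2, hrg c' hc' e' he']
  · rintro ⟨e, c⟩ ⟨he, hc⟩
    refine ⟨(glue c e, r c), ⟨⟨hglue c hc e (hE he), ?_⟩, hr c hc⟩, ?_⟩
    · change r (glue c e) ∈ E
      rwa [hrg c hc e (hE he)]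
    · simp only [Prod.mk.injEq]
      exact ⟨hrg c hc e (hE he), hgg c hc e (hE he)⟩

section

variable {V E : Type*}

/-! ### The network of a graph -/

lemma sum_mult_eq {G : Graph V E} (hfin : IsLocallyFinite G) (u : V) (F : Finset V) :
    ∑ w ∈ F, mult G u w
      = (F.biUnion fun w => (hfin u).toFinset.filter fun e => G.IsLink e u w).card := by
  rw [Finset.card_biUnion]
  · refine Finset.sum_congr rfl fun w _ => ?_
    rw [mult, ← Set.ncard_coe_finset]
    congr 1
    ext e
    simp only [Set.mem_ofPred_eq, Finset.coe_filter, Set.Finite.mem_toFinset]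
    exact ⟨fun h => ⟨h.inc_left, h⟩, fun h => h.2⟩
  · intro w _ w' _ hww'
    rw [Function.onFun, Finset.disjoint_left]
    intro e he he'
    exact hww' ((Finset.mem_filter.1 he).2.right_unique (Finset.mem_filter.1 he').2)

lemma sum_weight_eq (G : Graph V E) (u : V) (F : Finset V) :
    ∑ w ∈ F, (if u = w then 2 * mult G u u else mult G u w)
      = ∑ w ∈ F, mult G u w + if u ∈ F then mult G u u else 0 := by
  rw [← Finset.sum_ite_eq F u fun w => mult G u w, ← Finset.sum_add_distrib]
  refine Finset.sum_congr rfl fun w _ => ?_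
  split_ifs with h
  · subst h; ring
  · rfl

lemma mult_comm (G : Graph V E) (u w : V) : mult G u w = mult G w u := by
  simp only [mult, Graph.isLink_comm]

/-- The toppling data of a locally finite graph. -/
noncomputable def network (G : Graph V E) (hfin : IsLocallyFinite G) : Network V where
  weight u w := if u = w then 2 * mult G u u else mult G u w
  deg := deg G
  symm u w := by
    rcases eq_or_ne u w with rfl | h
    · rfl
    · simp [h, h.symm, mult_comm G u w]
  sum_le u F := by
    rw [sum_weight_eq, sum_mult_eq hfin, deg, ← Set.ncard_eq_toFinset_card _ (hfin u) |>.symm]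
    refine Nat.add_le_add (Finset.card_le_card fun e he => ?_) ?_
    · simp only [Finset.mem_biUnion, Finset.mem_filter] at he
      exact he.choose_spec.2.1
    · split_ifs
      · exact le_rfl
      · exact Nat.zero_le _

lemma network_deg_eq {G : Graph V E} (hfin : IsLocallyFinite G) {u : V} {F : Finset V}
    (hu : u ∈ F) (hF : ∀ w, G.Adj u w → w ∈ F) :
    (network G hfin).deg u = ∑ w ∈ F, (network G hfin).weight u w := by
  change deg G u = ∑ w ∈ F, (if u = w then 2 * mult G u u else mult G u w)
  rw [sum_weight_eq, sum_mult_eq hfin, deg, Set.ncard_eq_toFinset_card _ (hfin u), if_pos hu]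
  congr 2
  ext e
  simp only [Finset.mem_biUnion, Finset.mem_filter]
  refine ⟨fun he => ?_, fun ⟨_, _, h, _⟩ => h⟩
  obtain ⟨w, hw⟩ := (Set.Finite.mem_toFinset _).1 he
  exact ⟨w, hF w hw.adj, he, hw⟩

lemma one_le_network_weight {G : Graph V E} (hfin : IsLocallyFinite G) {u w : V} (huw : u ≠ w)
    (h : G.Adj u w) : 1 ≤ (network G hfin).weight u w := by
  obtain ⟨e, he⟩ := h
  simp only [network, huw, if_false, mult]
  exact Nat.one_le_iff_ne_zero.2 (Set.ncard_ne_zero_of_mem (a := e) he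
    ((hfin u).subset fun e he => Graph.IsLink.inc_left he))

lemma network_weight_eq_zero {G : Graph V E} (hfin : IsLocallyFinite G) {u w : V} (huw : u ≠ w)
    (h : ¬ G.Adj u w) : (network G hfin).weight u w = 0 := by
  simp only [network, huw, if_false, mult]
  have : {e | G.IsLink e u w} = ∅ := Set.eq_empty_of_forall_notMem fun e he => h ⟨e, he⟩
  rw [this, Set.ncard_empty]

/-! ### Avalanches and odometers -/

section Avalanche

variable {H : Graph V E} {P : Set V}

/-- A configuration extended by zero. -/
noncomputable def Config.ext (c : Config H P) (u : V) : ℤ :=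
  if h : u ∈ V(H) \ P then (c ⟨u, h⟩ : ℤ) else 0

lemma Config.ext_coe (c : Config H P) (u : ↥(V(H) \ P)) : c.ext u = c u := by
  simp [Config.ext]

lemma Config.ext_injective : Function.Injective (Config.ext : Config H P → V → ℤ) := by
  intro c d h
  funext u
  have := congrFun h u
  rw [Config.ext_coe, Config.ext_coe] at this
  exact_mod_cast this

lemma Config.ext_of_notMem (c : Config H P) {u : V} (h : u ∉ V(H) \ P) : c.ext u = 0 := by
  simp only [Config.ext, h, dif_neg, not_false_iff]

/-- The number of firings of each vertex in a list of firings. -/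
noncomputable def firings (l : List ↥(V(H) \ P)) (u : V) : ℕ :=
  (l.map Subtype.val).count u

variable {U : Finset V} (hfin : IsLocallyFinite H)

lemma Config.exists_ext_eq {x : V → ℤ} (hU : (U : Set V) = V(H) \ P) (h0 : ∀ u ∈ U, 0 ≤ x u)
    (h1 : ∀ u, u ∉ U → x u = 0) : ∃ c : Config H P, c.ext = x := by
  refine ⟨fun u => (x u).toNat, ?_⟩
  funext u
  by_cases hu : u ∈ V(H) \ P
  · rw [Config.ext_coe _ ⟨u, hu⟩]
    exact Int.toNat_of_nonneg (h0 u (by rw [← Finset.mem_coe, hU]; exact hu))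
  · rw [Config.ext_of_notMem _ hu, h1 u (by rw [← Finset.mem_coe, hU]; exact hu)]

lemma mem_of_coe (hU : (U : Set V) = V(H) \ P) (u : ↥(V(H) \ P)) : (u : V) ∈ U := by
  rw [← Finset.mem_coe, hU]; exact u.2

lemma isStable_iff (hU : (U : Set V) = V(H) \ P) (c : Config H P) :
    IsStable c ↔ ∀ u ∈ U, c.ext u < (network H hfin).deg u := by
  constructor
  · intro h u hu
    rw [← Finset.mem_coe, hU] at hu
    have := h ⟨u, hu⟩
    rw [c.ext_coe ⟨u, hu⟩]
    exact_mod_cast this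
  · intro h u
    have := h u (mem_of_coe hU u)
    rw [c.ext_coe u] at this
    exact_mod_cast this

lemma ext_addChip (hU : (U : Set V) = V(H) \ P) (c : Config H P) (v : V) {u : V} (hu : u ∈ U) :
    (addChip c v).ext u = c.ext u + if u = v then 1 else 0 := by
  rw [← Finset.mem_coe, hU] at hu
  rw [Config.ext_coe _ ⟨u, hu⟩, Config.ext_coe _ ⟨u, hu⟩, addChip]
  push_cast
  rfl

lemma lap_single (u w : V) (hu : u ∈ U) (N : Network V) :
    N.lap U (fun z => if z = u then 1 else 0) w
      = (if w = u then (N.deg u : ℤ) else 0) - N.weight w u := by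
  simp only [Network.lap, mul_ite, mul_one, mul_zero, Finset.sum_ite_eq', hu, if_true, ite_mul,
    one_mul, zero_mul]
  split_ifs with h
  · rw [h]
  · rfl

lemma ext_fire (hU : (U : Set V) = V(H) \ P) {c : Config H P} {u : ↥(V(H) \ P)}
    (hu : deg H u ≤ c u) {w : V} (hw : w ∈ U) :
    (fire c u).ext w
      = c.ext w - (network H hfin).lap U (fun z => if z = u then 1 else 0) w := by
  rw [lap_single _ _ (mem_of_coe hU u)]
  rw [← Finset.mem_coe, hU] at hw
  rw [Config.ext_coe _ ⟨w, hw⟩, Config.ext_coe _ ⟨w, hw⟩, fire]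
  by_cases hwu : (⟨w, hw⟩ : ↥(V(H) \ P)) = u
  · subst hwu
    simp only [if_true, network]
    push_cast [Nat.cast_sub hu]
    ring
  · have hwu' : w ≠ u := fun h => hwu (Subtype.ext h)
    simp only [hwu, hwu', if_false, network, mult_comm H w u]
    push_cast
    ring

lemma noForbidden_fire {N : Network V} {x : V → ℤ} (hx : N.NoForbidden U x) {u : V} (hu : u ∈ U)
    (hdeg : N.deg u ≤ x u) :
    N.NoForbidden U fun w => x w - N.lap U (fun z => if z = u then 1 else 0) w := by
  intro F hF hne
  simp only [lap_single _ _ hu]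
  by_cases huF : u ∈ F
  · by_cases hne' : (F.erase u).Nonempty
    · obtain ⟨w, hw, h⟩ := hx (F.erase u) ((Finset.erase_subset _ _).trans hF) hne'
      refine ⟨w, Finset.mem_of_mem_erase hw, ?_⟩
      rw [← Finset.add_sum_erase F _ huF, if_neg (Finset.ne_of_mem_erase hw)]
      linarith
    · refine ⟨u, huF, ?_⟩
      rw [← Finset.add_sum_erase F _ huF, Finset.not_nonempty_iff_eq_empty.1 hne', if_pos rfl,
        Finset.sum_empty]
      linarith
  · obtain ⟨w, hw, h⟩ := hx F hF hne
    refine ⟨w, hw, h.trans ?_⟩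
    rw [if_neg (by rintro rfl; exact huF hw)]
    have : (0 : ℤ) ≤ N.weight w u := by positivity
    linarith

/-- An avalanche subtracts the Laplacian of its firing numbers and creates no forbidden
subconfiguration. -/
lemma IsAvalanche.spec (hU : (U : Set V) = V(H) \ P) {c d : Config H P} {l : List ↥(V(H) \ P)} (h : IsAvalanche c l d)
    (hc : (network H hfin).NoForbidden U c.ext) :
    (network H hfin).Recurrent U d.ext ∧
      ∀ u ∈ U, d.ext u = c.ext u - (network H hfin).lap U (fun w => firings l w) u := by
  induction h with
  | nil c hst =>
    refine ⟨⟨(isStable_iff hfin hU c).1 hst, hc⟩, fun u _ => ?_⟩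
    simp [firings, Network.lap]
  | cons c d u l hu _ ih =>
    have hu' := mem_of_coe hU u
    have h1 := noForbidden_fire hc hu' (by rw [c.ext_coe]; exact_mod_cast hu)
    obtain ⟨h2, h3⟩ := ih (h1.mono fun w hw => (ext_fire hfin hU hu hw).ge)
    refine ⟨h2, fun w hw => ?_⟩
    rw [h3 w hw, ext_fire hfin hU hu hw, sub_sub, ← Network.lap_add]
    congr 2
    funext z
    simp only [firings, List.map_cons, List.count_cons, beq_iff_eq]
    push_cast
    rw [add_comm]
    congr 1
    by_cases hz : z = u
    · simp [hz]
    · simp [hz, Ne.symm hz]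

lemma sum_sub_single {n : V → ℕ} {u : V} (hu : u ∈ U) (hpos : 0 < n u) :
    ∑ w ∈ U, (n w - if w = u then 1 else 0) + 1 = ∑ w ∈ U, n w := by
  rw [← Finset.add_sum_erase U _ hu, ← Finset.add_sum_erase U n hu,
    Finset.sum_congr (s₁ := U.erase u) (g := fun w => n w) rfl
      fun w hw => by simp [Finset.ne_of_mem_erase hw], if_pos rfl]
  omega

/-- If some firing numbers stabilize a configuration, then a legal sequence of firings does. -/
lemma exists_isAvalanche (hU : (U : Set V) = V(H) \ P) (k : ℕ) (c : Config H P) (n : V → ℕ)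
    (hk : ∑ u ∈ U, n u = k)
    (h : ∀ u ∈ U, c.ext u - (network H hfin).lap U (fun w => n w) u < (network H hfin).deg u) :
    ∃ l d, IsAvalanche c l d := by
  induction k generalizing c n with
  | zero =>
    refine ⟨[], c, .nil c ((isStable_iff hfin hU c).2 fun u hu => ?_)⟩
    have h0 : ∀ w ∈ U, n w = 0 := by simpa using hk
    have h1 := h u hu
    rw [Network.lap_congr (n' := fun _ => 0) (fun w hw => by simp [h0 w hw]) hu] at h1
    simpa [Network.lap] using h1
  | succ k ih =>
    by_cases hst : IsStable c
    · exact ⟨[], c, .nil c hst⟩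
    simp only [IsStable, not_forall, not_lt] at hst
    obtain ⟨u, hu⟩ := hst
    have huU := mem_of_coe hU u
    have hpos : n u ≠ 0 := by
      intro h0
      have h1 := h u huU
      have h2 : ((deg H u : ℕ) : ℤ) ≤ c.ext u := by rw [c.ext_coe]; exact_mod_cast hu
      have h3 : 0 ≤ ∑ w ∈ U, ((network H hfin).weight u w : ℤ) * n w :=
        Finset.sum_nonneg fun _ _ => by positivity
      simp only [Network.lap, h0] at h1
      change _ < ((deg H u : ℕ) : ℤ) at h1
      push_cast at h1
      linarith
    have hk' : ∑ w ∈ U, (n w - if w = u then 1 else 0) = k := by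
      have := sum_sub_single huU (Nat.pos_of_ne_zero hpos)
      omega
    obtain ⟨l, d, hl⟩ := ih (fire c u) (fun w => n w - if w = u then 1 else 0) hk'
      fun w hw => by
        rw [ext_fire hfin hU hu hw, sub_sub, ← Network.lap_add]
        convert h w hw using 4
        rename_i z
        by_cases hz : z = u
        · rw [hz, if_pos rfl, if_pos rfl]; omega
        · simp [hz]
    exact ⟨u :: l, d, .cons c d u l hu hl⟩

lemma firings_pos {l : List ↥(V(H) \ P)} {u : V} :
    0 < firings l u ↔ ∃ h : u ∈ V(H) \ P, (⟨u, h⟩ : ↥(V(H) \ P)) ∈ l := by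
  simp [firings, List.count_pos_iff]

lemma card_firings_pos (hU : (U : Set V) = V(H) \ P) (l : List ↥(V(H) \ P)) :
    (U.filter fun u => 0 < (firings l u : ℤ)).card = {u | u ∈ l}.ncard := by
  rw [← Set.ncard_coe_finset, ← Set.ncard_image_of_injective _ Subtype.val_injective]
  congr 1
  ext u
  simp only [Finset.coe_filter, Nat.cast_pos, firings_pos, Set.mem_ofPred_eq, Set.mem_image,
    Subtype.exists, exists_and_right, exists_eq_right]
  exact ⟨fun h => h.2, fun h => ⟨by rw [← Finset.mem_coe, hU]; exact h.1, h⟩⟩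

/-- The mass of an avalanche is the size of the support of the odometer. -/
lemma hasMass_iff (hU : (U : Set V) = V(H) \ P) {c : Config H P} (v : V) (M : ℕ)
    (hc : (network H hfin).Recurrent U c.ext) :
    HasMass c v M ↔ (network H hfin).MassIs U v c.ext M := by
  have hadd : (network H hfin).NoForbidden U (addChip c v).ext :=
    hc.noForbidden_add.mono fun u hu => (ext_addChip hU c v hu).ge
  have key : ∀ l d, IsAvalanche (addChip c v) l d →
      (network H hfin).IsOdometer U v c.ext fun w => firings l w := by
    intro l d h
    obtain ⟨h1, h2⟩ := h.spec hfin hU hadd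
    refine ⟨fun u hu => ?_, h1.congr fun u hu => ?_⟩
    · rw [← Finset.mem_coe, hU] at hu
      have : ¬ 0 < firings l u := fun h => hu (firings_pos.1 h).1
      simpa using this
    · rw [h2 u hu, ext_addChip hU c v hu]
  constructor
  · rintro ⟨l, d, h, rfl⟩
    exact ⟨_, key l d h, card_firings_pos hU l⟩
  · rintro ⟨n, hn, rfl⟩
    have hn0 := hn.nonneg hc
    obtain ⟨l, d, hl⟩ := exists_isAvalanche hfin hU _ (addChip c v) (fun u => (n u).toNat) rfl
      fun u hu => by
        rw [ext_addChip hU c v hu]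
        have := hn.recurrent.stable u hu
        simpa only [Int.toNat_of_nonneg (hn0 _)] using this
    refine ⟨l, d, hl, ?_⟩
    rw [← card_firings_pos hU, hn.unique (key l d hl)]

/-! ### Recurrent configurations -/

/-- A function on a finite connected graph that vanishes at the sink and is strictly superharmonic
elsewhere: a concave function of the distance to the sink. -/
lemma exists_superharmonic {q : V} (hconn : IsConnected H) (hq : q ∈ V(H))
    (hU : (U : Set V) = V(H) \ {q}) :
    ∃ h : V → ℤ, (∀ u ∈ U, 0 ≤ h u) ∧ ∀ u ∈ U, 1 ≤ (network H hfin).lap U h u := by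
  set N := network H hfin
  set Γ := (underlying H).induce V(H) with hΓ
  have hΓc : Γ.Connected := hconn
  set ρ : V → ℕ := fun u => if h : u ∈ V(H) then Γ.dist ⟨u, h⟩ ⟨q, hq⟩ else 0 with hρ
  set A : ℤ := (U.sup N.deg : ℕ) + 2 with hA
  set R : ℕ := U.sup ρ + 1 with hR
  have hA1 : 1 ≤ A := by simp only [hA]; omega
  have hUmem : ∀ u, u ∈ U ↔ u ∈ V(H) ∧ u ≠ q := fun u => by
    rw [← Finset.mem_coe, hU]; simp
  refine ⟨fun u => A ^ R - A ^ (R - ρ u), fun u _ => ?_, fun u hu => ?_⟩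
  · have := pow_le_pow_right₀ hA1 (Nat.sub_le R (ρ u))
    linarith
  have huV := ((hUmem u).1 hu).1
  have huq := ((hUmem u).1 hu).2
  -- a neighbour closer to the sink
  obtain ⟨w₀, hw₀V, hadj, hdist⟩ : ∃ w, w ∈ V(H) ∧ (underlying H).Adj u w ∧ ρ w + 1 = ρ u := by
    obtain ⟨pth, hp⟩ := hΓc.exists_walk_length_eq_dist ⟨u, huV⟩ ⟨q, hq⟩
    cases pth with
    | nil => exact absurd rfl huq
    | @cons _ w _ hadj pth =>
      refine ⟨w, w.2, hadj, ?_⟩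
      have h1 : ρ u = Γ.dist ⟨u, huV⟩ ⟨q, hq⟩ := by simp [hρ, huV]
      have h2 : ρ w = Γ.dist w ⟨q, hq⟩ := by simp [hρ]
      rw [h1, h2]
      have h3 := SimpleGraph.dist_le pth
      have h4 := hΓc.dist_triangle (u := ⟨u, huV⟩) (v := w) (w := ⟨q, hq⟩)
      rw [SimpleGraph.dist_eq_one_iff_adj.2 hadj] at h4
      rw [SimpleGraph.Walk.length_cons] at hp
      omega
  have hlip : ∀ w ∈ U, N.weight u w ≠ 0 → ρ w ≤ ρ u + 1 := by
    intro w hw hne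
    rcases eq_or_ne u w with rfl | huw
    · omega
    have hadj : (underlying H).Adj u w := by
      refine ⟨huw, ?_⟩
      by_contra hcon
      exact hne (network_weight_eq_zero hfin huw hcon)
    have hwV := ((hUmem w).1 hw).1
    simp only [hρ, huV, hwV, dif_pos]
    have h4 := hΓc.dist_triangle (u := ⟨w, hwV⟩) (v := ⟨u, huV⟩) (w := ⟨q, hq⟩)
    have h5 : Γ.Adj ⟨w, hwV⟩ ⟨u, huV⟩ := hadj.symm
    rw [SimpleGraph.dist_eq_one_iff_adj.2 h5] at h4
    omega
  have hρu : ρ u + 1 ≤ R := Nat.succ_le_succ (Finset.le_sup (f := ρ) hu)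
  set x : ℤ := A ^ (R - ρ u - 1) with hx
  have hx1 : 1 ≤ x := one_le_pow₀ hA1
  have e1 : A ^ (R - ρ u) = A * x := by
    rw [hx, ← pow_succ']; congr 1; omega
  have e2 : A ^ (R - ρ w₀) = A ^ 2 * x := by
    rw [hx, ← pow_add]; congr 1; omega
  have hdegA : (N.deg u : ℤ) + 2 ≤ A := by
    have : N.deg u ≤ U.sup N.deg := Finset.le_sup hu
    simp only [hA]; omega
  have hxR : x ≤ A ^ R := pow_le_pow_right₀ hA1 (by omega)
  have hw₀ : 1 ≤ N.weight u w₀ := one_le_network_weight hfin hadj.1 hadj.2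
  have hsum : ∑ w ∈ U, (N.weight u w : ℤ) * (A ^ R - A ^ (R - ρ w))
      ≤ N.deg u * (A ^ R - x) - (A ^ 2 * x - x) := by
    have hterm : ∀ w ∈ U, (N.weight u w : ℤ) * (A ^ R - A ^ (R - ρ w))
        ≤ N.weight u w * (A ^ R - x) := by
      intro w hw
      by_cases hne : N.weight u w = 0
      · simp [hne]
      · refine mul_le_mul_of_nonneg_left ?_ (by positivity)
        have : x ≤ A ^ (R - ρ w) := pow_le_pow_right₀ hA1 (by have := hlip w hw hne; omega)
        linarith
    have hs := Network.sum_le' (N := N) u (insert w₀ (U.erase w₀))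
    rw [Finset.sum_insert (Finset.notMem_erase _ _)] at hs
    have hrest : ∑ w ∈ U.erase w₀, (N.weight u w : ℤ) * (A ^ R - A ^ (R - ρ w))
        ≤ (∑ w ∈ U.erase w₀, (N.weight u w : ℤ)) * (A ^ R - x) := by
      rw [Finset.sum_mul]
      exact Finset.sum_le_sum fun w hw => hterm w (Finset.mem_of_mem_erase hw)
    have hw₀' : (1 : ℤ) ≤ N.weight u w₀ := by exact_mod_cast hw₀
    have hA2 : x ≤ A ^ 2 * x := by nlinarith [one_le_pow₀ hA1 (n := 2)]
    have hnn : 0 ≤ A ^ R - x := by linarith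
    by_cases hw₀U : w₀ ∈ U
    · rw [← Finset.add_sum_erase U _ hw₀U, e2]
      nlinarith
    · have h7 : (N.weight u w₀ : ℤ) * (A ^ R - A ^ 2 * x) = 0 := by
        have hw₀q : w₀ = q := by
          by_contra hne
          exact hw₀U ((hUmem w₀).2 ⟨hw₀V, hne⟩)
        have : ρ w₀ = 0 := by simp [hρ, hw₀q, hq]
        rw [← e2, this, Nat.sub_zero, sub_self, mul_zero]
      rw [Finset.erase_eq_of_notMem hw₀U] at hrest hs
      nlinarith
  rw [Network.lap, e1]
  have h8 : (A - 1) * x * (A + 1 - N.deg u) ≥ 1 := by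
    have ha : 1 ≤ A - 1 := by linarith [Nat.cast_nonneg (α := ℤ) (N.deg u)]
    have hb : 1 ≤ A + 1 - N.deg u := by linarith
    exact one_le_mul_of_one_le_of_one_le (one_le_mul_of_one_le_of_one_le ha hx1) hb
  nlinarith

section Recurrence

variable {h : V → ℤ}

lemma Transition.recurrent {c d : Config H P} (hU : (U : Set V) = V(H) \ P)
    (hc : (network H hfin).Recurrent U c.ext) (ht : Transition c d) : (network H hfin).Recurrent U d.ext := by
  obtain ⟨u, l, hl⟩ := ht
  exact (hl.spec hfin hU (hc.noForbidden_add.mono fun w hw => (ext_addChip hU c u hw).ge)).1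

lemma exists_bound (hU1 : ∀ u ∈ U, 1 ≤ (network H hfin).lap U h u) (x : V → ℤ) :
    ∃ K : ℕ, ∀ u ∈ U, x u ≤ (network H hfin).lap U (fun w => (K : ℤ) * h w) u := by
  refine ⟨U.sup fun u => (x u).toNat, fun u hu => ?_⟩
  rw [Network.lap_mul]
  have h1 : (x u).toNat ≤ U.sup fun u => (x u).toNat :=
    Finset.le_sup (f := fun u => (x u).toNat) hu
  have h2 := Int.self_le_toNat (x u)
  have h3 := hU1 u hu
  have h4 : ((x u).toNat : ℤ) ≤ (U.sup fun u => (x u).toNat : ℕ) := by exact_mod_cast h1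
  nlinarith

lemma exists_reachable_add (hU : (U : Set V) = V(H) \ P) (h0 : ∀ u ∈ U, 0 ≤ h u) (h1 : ∀ u ∈ U, 1 ≤ (network H hfin).lap U h u)
    {c : Config H P} (hc : (network H hfin).Recurrent U c.ext) (k : ℕ) (e : V → ℕ) (hk : ∑ u ∈ U, e u = k) :
    ∃ d, Relation.ReflTransGen Transition c d ∧ (network H hfin).Recurrent U d.ext ∧
      ∃ n : V → ℤ, ∀ u ∈ U, d.ext u = c.ext u + e u - (network H hfin).lap U n u := by
  induction k generalizing e with
  | zero =>
    refine ⟨c, .refl, hc, fun _ => 0, fun u hu => ?_⟩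
    have h0 : ∀ w ∈ U, e w = 0 := by simpa using hk
    simp [Network.lap, h0 u hu]
  | succ k ih =>
    obtain ⟨u, hu, hpos⟩ : ∃ u ∈ U, 0 < e u := by
      by_contra! hcon
      have : ∑ u ∈ U, e u = 0 := Finset.sum_eq_zero fun u hu => Nat.le_zero.1 (hcon u hu)
      omega
    obtain ⟨d, hd, hdR, n, hn⟩ := ih (fun w => e w - if w = u then 1 else 0) (by
      have := sum_sub_single hu hpos
      omega)
    have huH : u ∈ V(H) \ P := by rw [← hU]; exact hu
    obtain ⟨K, hK⟩ := exists_bound hfin h1 fun w => (addChip d u).ext w + 1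
    obtain ⟨l, d', hl⟩ := exists_isAvalanche hfin hU _ (addChip d u)
      (fun w => ((K : ℤ) * h w).toNat) rfl fun w hw => by
        rw [Network.lap_congr (n' := fun w => (K : ℤ) * h w)
          (fun z hz => Int.toNat_of_nonneg (mul_nonneg (by positivity) (h0 z hz))) hw]
        have := hK w hw
        omega
    have ht : Transition d d' := ⟨⟨u, huH⟩, l, hl⟩
    obtain ⟨-, h6⟩ := hl.spec hfin hU
      (hdR.noForbidden_add.mono fun w hw => (ext_addChip hU d u hw).ge)
    refine ⟨d', hd.tail ht, ht.recurrent hfin hU hdR, fun w => n w + firings l w, fun w hw => ?_⟩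
    rw [h6 w hw, ext_addChip hU d u hw, hn w hw, Network.lap_add]
    by_cases hwu : w = u
    · subst hwu
      simp only [if_true]
      push_cast [Nat.cast_sub (show 1 ≤ e w from hpos)]
      ring
    · simp only [hwu, if_false, Nat.sub_zero]
      ring

/-- Recurrence in the Markov chain is Dhar's criterion. -/
lemma isRecurrent_iff (hU : (U : Set V) = V(H) \ P) (h0 : ∀ u ∈ U, 0 ≤ h u)
    (h1 : ∀ u ∈ U, 1 ≤ (network H hfin).lap U h u) (c : Config H P) :
    IsRecurrent c ↔ (network H hfin).Recurrent U c.ext := by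
  have hmaxR := Network.recurrent_max h0 h1
  obtain ⟨m, hm⟩ : ∃ m : Config H P,
      m.ext = fun u => if u ∈ U then ((network H hfin).deg u : ℤ) - 1 else 0 := by
    refine Config.exists_ext_eq hU (fun u hu => ?_) fun u hu => if_neg hu
    rw [if_pos hu]
    exact hmaxR.noForbidden.nonneg hu
  have hmU : ∀ u ∈ U, m.ext u = (network H hfin).deg u - 1 := fun u hu => by
    rw [hm]; exact if_pos hu
  have hmR : (network H hfin).Recurrent U m.ext := hmaxR.congr fun u hu => (hmU u hu).symm
  -- The maximal stable configuration is reached by adding chips without any firing.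
  have tomax : ∀ k : ℕ, ∀ c : Config H P, IsStable c → ∑ u ∈ U, (m.ext u - c.ext u) = k →
      Relation.ReflTransGen Transition c m := by
    intro k
    induction k with
    | zero =>
      intro c hc hk
      have hle : ∀ u ∈ U, 0 ≤ m.ext u - c.ext u := fun u hu => by
        have := (isStable_iff hfin hU c).1 hc u hu
        rw [hmU u hu]; omega
      have h2 := (Finset.sum_eq_zero_iff_of_nonneg hle).1 hk
      have : c = m := Config.ext_injective <| by
        funext u
        by_cases hu : u ∈ U
        · have := h2 u hu; omega
        · rw [Config.ext_of_notMem _ (by rwa [← hU]), Config.ext_of_notMem _ (by rwa [← hU])]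
      rw [this]
    | succ k ih =>
      intro c hc hk
      obtain ⟨u, hu, hpos⟩ : ∃ u ∈ U, 0 < m.ext u - c.ext u := by
        by_contra! hcon
        have := Finset.sum_nonpos hcon
        omega
      have hst : IsStable (addChip c u) := (isStable_iff hfin hU _).2 fun w hw => by
        rw [ext_addChip hU c u hw]
        have := (isStable_iff hfin hU c).1 hc w hw
        split_ifs with hwu
        · subst hwu
          rw [hmU w hw] at hpos; omega
        · omega
      have ht : Transition c (addChip c u) := ⟨⟨u, by rw [← hU]; exact hu⟩, [], .nil _ hst⟩
      refine .head ht (ih _ hst ?_)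
      rw [Finset.sum_congr rfl fun w hw => by rw [ext_addChip hU c u hw, ← sub_sub],
        Finset.sum_sub_distrib, hk, Finset.sum_ite_eq', if_pos hu]
      push_cast; ring
  have tomax' : ∀ c : Config H P, IsStable c → Relation.ReflTransGen Transition c m := by
    intro c hc
    have hle : 0 ≤ ∑ u ∈ U, (m.ext u - c.ext u) := Finset.sum_nonneg fun u hu => by
      have := (isStable_iff hfin hU c).1 hc u hu
      rw [hmU u hu]; omega
    exact tomax _ c hc (Int.toNat_of_nonneg hle).symm
  have closed : ∀ {c d : Config H P}, Relation.ReflTransGen Transition c d →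
      (network H hfin).Recurrent U c.ext → (network H hfin).Recurrent U d.ext := by
    intro c d hcd hc
    induction hcd with
    | refl => exact hc
    | tail _ ht ih => exact ht.recurrent hfin hU ih
  constructor
  · rintro ⟨hst, hrec⟩
    exact closed (hrec m (tomax' c hst)) hmR
  · intro hc
    refine ⟨(isStable_iff hfin hU c).2 hc.stable, fun d hd => ?_⟩
    refine (tomax' d ((isStable_iff hfin hU d).2 (closed hd hc).stable)).trans ?_
    -- Add chips to `m` so as to land in the class of `c` modulo the Laplacian.
    obtain ⟨K, hK⟩ := exists_bound hfin h1 fun u => m.ext u - c.ext u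
    obtain ⟨d', hd', hdR, n, hn⟩ := exists_reachable_add hfin hU h0 h1 hmR _
      (fun u => (c.ext u + (network H hfin).lap U (fun w => (K : ℤ) * h w) u - m.ext u).toNat) rfl
    suffices d' = c by rwa [← this]
    have h3 : ∀ u ∈ U, d'.ext u
        = c.ext u - (network H hfin).lap U (fun w => n w - K * h w) u := by
      intro u hu
      rw [hn u hu, Int.toNat_of_nonneg (by have := hK u hu; omega), Network.lap_sub]
      ring
    have h4 := hc.eq_zero_of_sub_lap (hdR.congr h3)
    refine Config.ext_injective ?_
    funext u
    by_cases hu : u ∈ U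
    · rw [h3 u hu, Network.lap_congr (n' := fun _ => 0) h4 hu]
      simp [Network.lap]
    · rw [Config.ext_of_notMem _ (by rwa [← hU]), Config.ext_of_notMem _ (by rwa [← hU])]

end Recurrence

/-- The probability of a given mass, in terms of recurrent configurations and odometers. -/
lemma massProb_eq {q : V} (hconn : IsConnected H) (hq : q ∈ V(H)) {U : Finset V}
    (hfin : IsLocallyFinite H) (hU : (U : Set V) = V(H) \ {q}) (v : V) (M : ℕ) :
    massProb H {q} v M
      = ({c ∈ (network H hfin).recurrents U | (network H hfin).MassIs U v c M}.ncard : ℝ)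
        / ((network H hfin).recurrents U).ncard := by
  obtain ⟨h, h0, h1⟩ := exists_superharmonic hfin hconn hq hU
  have key : ∀ Q : (V → ℤ) → Prop,
      {c : Config H {q} | IsRecurrent c ∧ ((network H hfin).Recurrent U c.ext → Q c.ext)}.ncard
        = {c ∈ (network H hfin).recurrents U | Q c}.ncard := by
    intro Q
    rw [← Set.ncard_image_of_injective _ Config.ext_injective]
    congr 1
    ext x
    constructor
    · rintro ⟨c, ⟨hc, hQ⟩, rfl⟩
      have hc' := (isRecurrent_iff hfin hU h0 h1 c).1 hc
      exact ⟨⟨fun u hu => Config.ext_of_notMem _ (by rwa [← hU]), hc'⟩, hQ hc'⟩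
    · rintro ⟨⟨hx0, hx⟩, hQ⟩
      obtain ⟨c, hcx⟩ := Config.exists_ext_eq hU (fun u hu => hx.noForbidden.nonneg hu) hx0
      change c.ext = x at hcx
      subst hcx
      exact ⟨c, ⟨(isRecurrent_iff hfin hU h0 h1 c).2 hx, fun _ => hQ⟩, rfl⟩
  have e1 : {c : Config H {q} | IsRecurrent c ∧ HasMass c v M}
      = {c | IsRecurrent c ∧ ((network H hfin).Recurrent U c.ext →
          (network H hfin).MassIs U v c.ext M)} := by
    ext c
    refine and_congr_right fun hc => ?_
    have hc' := (isRecurrent_iff hfin hU h0 h1 c).1 hc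
    rw [hasMass_iff hfin hU v M hc']
    exact ⟨fun h _ => h, fun h => h hc'⟩
  have e2 := key fun _ => True
  simp only [imp_true_iff, and_true] at e2
  rw [massProb, e1, key fun x => (network H hfin).MassIs U v x M, e2]
  rfl

end Avalanche

end

namespace Network

variable {V : Type*} {N : Network V}

/-! ### Pendant parts -/

lemma IsPendant.lap_eq {A B : Finset V} {q : V} (hA : N.IsPendant A q) (hAB : A ⊆ B) {n : V → ℤ}
    (hn : ∀ u, u ∉ B → n u = 0) {u : V} (hu : u ∈ A) :
    N.lap B n u = ∑ w ∈ insert q A, (N.weight u w : ℤ) * (n u - n w) := by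
  have h1 : ∑ w ∈ B, (N.weight u w : ℤ) * n w = ∑ w ∈ insert q A, (N.weight u w : ℤ) * n w := by
    have h2 : ∑ w ∈ B, (N.weight u w : ℤ) * n w = ∑ w ∈ insert q B, (N.weight u w : ℤ) * n w := by
      refine Finset.sum_subset (Finset.subset_insert _ _) fun w _ hw => ?_
      rw [hn w hw, mul_zero]
    rw [h2]
    refine (Finset.sum_subset (Finset.insert_subset_insert _ hAB) fun w _ hw => ?_).symm
    rw [Finset.mem_insert, not_or] at hw
    rw [hA.weight_eq_zero hu hw.2 hw.1, Nat.cast_zero, zero_mul]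
  rw [lap, h1, hA.deg_eq u hu]
  push_cast
  simp only [mul_sub, Finset.sum_sub_distrib, Finset.mul_sum]
  congr 1
  exact Finset.sum_congr rfl fun w _ => mul_comm _ _

lemma IsPendant.lap_eq_zero {A B : Finset V} {q : V} (hA : N.IsPendant A q) (hAB : A ⊆ B)
    {n : V → ℤ} (hn : ∀ u, u ∉ A → n u = 0) {u : V} (hu : u ∉ A) (huq : u ≠ q) :
    N.lap B n u = 0 := by
  rw [lap_eq_of_support hAB (fun w _ hw => hn w hw), lap, hn u hu, zero_mul, zero_sub, neg_eq_zero]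
  refine Finset.sum_eq_zero fun w hw => ?_
  rw [N.symm, hA.weight_eq_zero hw hu huq, Nat.cast_zero, zero_mul]

/-- An avalanche that does not fire the attaching vertex of a pendant part containing the root
stays in that part. -/
lemma IsOdometer.support_subset {A B : Finset V} {q v : V} (hA : N.IsPendant A q)
    (hv : v ∈ A) {c n : V → ℤ} (hc : N.Recurrent B c) (h : N.IsOdometer B v c n)
    (hq : n q = 0) : ∀ u, u ∉ A → n u = 0 := by
  intro u hu
  by_cases huB : u ∈ B
  swap
  · exact h.support u huB
  by_cases huq : u = q
  · rwa [huq]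
  refine h.eq_zero_of_unfired hc (S := (B \ A).erase q)
    ((Finset.erase_subset _ _).trans Finset.sdiff_subset) (by simp [hv]) ?_ u (by simp [*])
  intro s hs w hw hwS hnw
  simp only [Finset.mem_erase, Finset.mem_sdiff] at hs hwS
  have hwq : w ≠ q := by rintro rfl; exact hnw hq
  have hwA : w ∈ A := by by_contra hwA; exact hwS ⟨hwq, hw, hwA⟩
  rw [N.symm, hA.weight_eq_zero hwA hs.2.2 hs.1]

lemma IsOdometer.restrict {A B : Finset V} {v : V} (hAB : A ⊆ B) {c n : V → ℤ}
    (h : N.IsOdometer B v c n) (hn : ∀ u, u ∉ A → n u = 0) : N.IsOdometer A v c n :=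
  ⟨hn, (h.recurrent.subset hAB).congr fun u _ => by
    rw [lap_eq_of_support hAB fun w _ hw => hn w hw]⟩

lemma IsOdometer.congr {B : Finset V} {v : V} {c c' n : V → ℤ} (h : N.IsOdometer B v c n)
    (hcc : ∀ u ∈ B, c u = c' u) : N.IsOdometer B v c' n :=
  ⟨h.support, h.recurrent.congr fun u hu => by rw [hcc u hu]⟩

lemma MassIs.congr {B : Finset V} {v : V} {c c' : V → ℤ} {M : ℕ} (h : N.MassIs B v c M)
    (hcc : ∀ u ∈ B, c u = c' u) : N.MassIs B v c' M := by
  obtain ⟨n, hn, hM⟩ := h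
  exact ⟨n, hn.congr hcc, hM⟩

/-- Small avalanches are local: an avalanche of mass less than `D.card`, where `D` consists of
`q` and the parts it separates from the sinks, does not fire `q`, and is therefore the same in
`U` and in a pendant part `B` of `U`. -/
lemma massIs_iff_of_lt {A B D U : Finset V} {p q v : V} (hA : N.IsPendant A q)
    (hB : N.IsPendant B p) (hv : v ∈ A) (hAB : A ⊆ B) (hBU : B ⊆ U) (hDB : D ⊆ B) (hq : q ∈ D)
    (hD : ∀ u ∈ D, u ≠ q → N.deg u = ∑ w ∈ D, N.weight u w) {c : V → ℤ} (hc : N.Recurrent U c)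
    {M : ℕ} (hM : M < D.card) : N.MassIs U v c M ↔ N.MassIs B v c M := by
  have key : ∀ {W : Finset V}, B ⊆ W → W ⊆ U → ∀ {n : V → ℤ}, N.IsOdometer W v c n →
      (W.filter fun u => 0 < n u).card = M →
      (∀ u, u ∉ A → n u = 0) ∧ (B.filter fun u => 0 < n u) = W.filter fun u => 0 < n u := by
    intro W hBW hWU n hn hcard
    have hcW := hc.subset hWU
    have hq0 : n q = 0 := by
      refine le_antisymm (not_lt.1 fun hpos => ?_) (hn.nonneg hcW q)
      have h1 := hn.pos_of_pos hcW (hDB.trans hBW) hD hpos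
      have h2 : D ⊆ W.filter fun u => 0 < n u := fun u hu =>
        Finset.mem_filter.2 ⟨hBW (hDB hu), h1 u hu⟩
      have := Finset.card_le_card h2
      omega
    have hs := hn.support_subset hA hv hcW hq0
    refine ⟨hs, Finset.Subset.antisymm (Finset.filter_subset_filter _ hBW) fun u hu => ?_⟩
    rw [Finset.mem_filter] at hu ⊢
    refine ⟨hAB ?_, hu.2⟩
    by_contra hcon
    rw [hs u hcon] at hu
    exact lt_irrefl _ hu.2
  constructor
  · rintro ⟨n, hn, hcard⟩
    obtain ⟨hs, he⟩ := key hBU subset_rfl hn hcard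
    exact ⟨n, hn.restrict hBU fun u hu => hs u fun h => hu (hAB h), by rw [he, hcard]⟩
  · rintro ⟨n, hn, hcard⟩
    obtain ⟨hs, -⟩ := key subset_rfl hBU hn hcard
    have hnB : ∀ u, u ∉ B → n u = 0 := fun u hu => hs u fun h => hu (hAB h)
    refine ⟨n, ⟨fun u hu => hs u fun h => hu (hBU (hAB h)), ?_⟩, ?_⟩
    · refine (hc.glue hB hn.recurrent hBU).congr fun u hu => ?_
      by_cases huB : u ∈ B
      · simp only [huB, if_true]
        rw [lap_eq_of_support hBU fun w _ hw => hnB w hw]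
      · simp only [huB, if_false]
        have huv : u ≠ v := by rintro rfl; exact huB (hAB hv)
        rw [hA.lap_eq_zero (hAB.trans hBU) hs (fun h => huB (hAB h))
          (by rintro rfl; exact huB (hDB hq)), if_neg huv]
        ring
    · rw [← hcard]
      congr 1
      refine Finset.Subset.antisymm (fun u hu => ?_) (Finset.filter_subset_filter _ hBU)
      rw [Finset.mem_filter] at hu ⊢
      refine ⟨?_, hu.2⟩
      by_contra hcon
      rw [hnB u hcon] at hu
      exact lt_irrefl _ hu.2

/-- The values on a pendant part are independent of the others. -/
lemma ncard_restrict {A B : Finset V} {q : V} (hA : N.IsPendant A q) (hAB : A ⊆ B)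
    {Q : (V → ℤ) → Prop} (hQ : ∀ c c', (∀ u ∈ A, c u = c' u) → Q c → Q c') :
    {c ∈ N.recurrents B | Q c}.ncard * (N.recurrents A).ncard
      = {c ∈ N.recurrents A | Q c}.ncard * (N.recurrents B).ncard := by
  have := ncard_mul_ncard_resample (R := N.recurrents B) (R' := N.recurrents A)
    (E := {c ∈ N.recurrents A | Q c}) (fun c u => if u ∈ A then c u else 0)
    (fun c e u => if u ∈ A then e u else c u) (fun c hc => hc.1)
    (fun c hc => ⟨fun u hu => if_neg hu, (hc.2.subset hAB).congr fun u hu => by simp [hu]⟩)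
    (fun c hc e he => ⟨fun u hu => (if_neg fun h => hu (hAB h)).trans (hc.1 u hu),
      hc.2.glue hA he.2 hAB⟩)
    (fun c hc e he => by
      funext u
      by_cases hu : u ∈ A
      · simp [hu]
      · simp [hu, he.1 u hu])
    (fun c hc e he => by
      funext u
      by_cases hu : u ∈ A <;> simp [hu])
  rw [← this]
  congr 2
  ext c
  refine and_congr_right fun hc => ?_
  constructor
  · intro h
    exact ⟨⟨fun u hu => if_neg hu, (hc.2.subset hAB).congr fun u hu => by simp [hu]⟩,
      hQ _ _ (fun u hu => by simp [hu]) h⟩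
  · rintro ⟨-, h⟩
    exact hQ _ _ (fun u hu => by simp [hu]) h

/-! ### Cycle blocks -/

/-- A cycle block in the chain of blocks that separates the root from infinity. `B` is the part
cut off by the exit `p` of the cycle, `A ⊆ B` the part hanging at its entrance `g j`. The cycle
is `p = g 0, g 1, …, g (k - 1), g k = p`, and `ι u` is the index of the vertex of the cycle at
which `u` hangs. -/
structure CycleBlock (N : Network V) (A B : Finset V) (p : V) (k j : ℕ) (g : ℕ → V) (ι : V → ℕ) :
    Prop where
  pos : 0 < j
  lt : j < k
  pendant : N.IsPendant B p
  pendant_inner : N.IsPendant A (g j)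
  subset : A ⊆ B
  ι_pos : ∀ u ∈ B, 0 < ι u
  ι_lt : ∀ u ∈ B, ι u < k
  ι_inner : ∀ u ∈ A, ι u = j
  g_zero : g 0 = p
  g_last : g k = p
  g_mem : ∀ t, 0 < t → t < k → g t ∈ B
  g_notMem : ∀ t, 0 < t → t < k → g t ∉ A
  ι_g : ∀ t, 0 < t → t < k → ι (g t) = t
  weight_eq : ∀ u ∈ B, ∀ w ∈ insert p B, (w = p ∨ ι w ≠ ι u) → N.weight u w =
    if u = g (ι u) then (if w = g (ι u + 1) then 1 else 0) + (if w = g (ι u - 1) then 1 else 0)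
    else 0

/-- The chips received by `p` when every `u ∈ B` is fired `n u` times. -/
noncomputable def outflow (N : Network V) (B : Finset V) (p : V) (n : V → ℤ) : ℤ :=
  ∑ u ∈ B, (N.weight p u : ℤ) * n u

namespace CycleBlock

variable {A B : Finset V} {p : V} {k j : ℕ} {g : ℕ → V} {ι : V → ℕ}

/-- A function of the index, extended by zero outside the block's part. -/
noncomputable def lift (B : Finset V) (ι : V → ℕ) (η : ℕ → ℤ) (u : V) : ℤ :=
  if u ∈ B then η (ι u) else 0

lemma lift_g (h : N.CycleBlock A B p k j g ι) {η : ℕ → ℤ} (h0 : η 0 = 0) (hk : η k = 0) {t : ℕ}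
    (ht : t ≤ k) : lift B ι η (g t) = η t := by
  rcases Nat.eq_zero_or_pos t with rfl | ht0
  · rw [h.g_zero, lift, if_neg h.pendant.notMem, h0]
  rcases ht.eq_or_lt with rfl | htk
  · rw [h.g_last, lift, if_neg h.pendant.notMem, hk]
  · rw [lift, if_pos (h.g_mem t ht0 htk), h.ι_g t ht0 htk]

lemma g_mem_insert (h : N.CycleBlock A B p k j g ι) {t : ℕ} (ht : t ≤ k) : g t ∈ insert p B := by
  rcases Nat.eq_zero_or_pos t with rfl | ht0
  · simp [h.g_zero]
  rcases ht.eq_or_lt with rfl | htk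
  · simp [h.g_last]
  · exact Finset.mem_insert_of_mem (h.g_mem t ht0 htk)

/-- The Laplacian of a function of the index is the Laplacian of a path. -/
lemma lap_lift (h : N.CycleBlock A B p k j g ι) {η : ℕ → ℤ} (h0 : η 0 = 0) (hk : η k = 0) {u : V}
    (hu : u ∈ B) : N.lap B (lift B ι η) u =
      if u = g (ι u) then 2 * η (ι u) - η (ι u + 1) - η (ι u - 1) else 0 := by
  have hpos := h.ι_pos u hu
  have hlt := h.ι_lt u hu
  rw [h.pendant.lap_eq subset_rfl (n := lift B ι η) (fun w hw => if_neg hw) hu]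
  have hterm : ∀ w ∈ insert p B,
      (N.weight u w : ℤ) * (lift B ι η u - lift B ι η w) = if u = g (ι u) then
        (if w = g (ι u + 1) then η (ι u) - lift B ι η w else 0)
          + (if w = g (ι u - 1) then η (ι u) - lift B ι η w else 0) else 0 := by
    intro w hw
    by_cases hc : w = p ∨ ι w ≠ ι u
    · rw [h.weight_eq u hu w hw hc]
      have : lift B ι η u = η (ι u) := if_pos hu
      rw [this]
      split_ifs <;> push_cast <;> ring
    · push Not at hc
      have hwB : w ∈ B := Finset.mem_of_mem_insert_of_ne hw hc.1
      have : lift B ι η w = η (ι u) := by rw [lift, if_pos hwB, hc.2]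
      have h3 : lift B ι η u = η (ι u) := if_pos hu
      rw [this, h3, sub_self]
      simp
  rw [Finset.sum_congr rfl hterm]
  split_ifs with hug
  · rw [Finset.sum_add_distrib, Finset.sum_ite_eq', Finset.sum_ite_eq',
      if_pos (h.g_mem_insert hlt), if_pos (h.g_mem_insert (by omega)), h.lift_g h0 hk hlt,
      h.lift_g h0 hk (by omega)]
    ring
  · simp

/-- The degree into a union of index classes. -/
lemma deg_sub_sum (h : N.CycleBlock A B p k j g ι) (T : ℕ → Prop) (hT0 : ¬ T 0) (hTk : ¬ T k)
    {u : V} (hu : u ∈ B) (hTu : T (ι u)) :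
    (N.deg u : ℤ) - ∑ w ∈ B.filter (fun w => T (ι w)), (N.weight u w : ℤ) =
      if u = g (ι u) then (if T (ι u + 1) then 0 else 1) + (if T (ι u - 1) then 0 else 1)
      else 0 := by
  have h1 := h.lap_lift (η := fun t => if T t then 1 else 0) (if_neg hT0) (if_neg hTk) hu
  rw [lap] at h1
  have h2 : ∑ w ∈ B, (N.weight u w : ℤ) * lift B ι (fun t => if T t then 1 else 0) w
      = ∑ w ∈ B.filter (fun w => T (ι w)), (N.weight u w : ℤ) := by
    rw [Finset.sum_filter]
    refine Finset.sum_congr rfl fun w hw => ?_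
    simp [lift, hw]
  rw [h2] at h1
  have h3 : lift B ι (fun t => if T t then (1 : ℤ) else 0) u = 1 := by simp [lift, hu, hTu]
  rw [h3, one_mul] at h1
  rw [h1]
  simp only [hTu, if_true]
  split_ifs <;> rfl

lemma sum_add_le_deg (h : N.CycleBlock A B p k j g ι) {t : ℕ} (ht : 0 < t) (htk : t < k)
    {F : Finset V} (hF : F ⊆ B) :
    ∑ w ∈ F, (N.weight (g t) w : ℤ) + (if g (t + 1) ∈ F then 0 else 1)
      + (if g (t - 1) ∈ F then 0 else 1) ≤ N.deg (g t) := by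
  have hgt := h.g_mem t ht htk
  have hιt := h.ι_g t ht htk
  have hne : ∀ s ≤ k, s ≠ t → g s = p ∨ ι (g s) ≠ t := by
    intro s hs hst
    rcases Nat.eq_zero_or_pos s with rfl | hs0
    · exact Or.inl h.g_zero
    rcases hs.eq_or_lt with rfl | hsk
    · exact Or.inl h.g_last
    · right; rwa [h.ι_g s hs0 hsk]
  have hterm : ∀ w ∈ insert p B, (if w ∈ F then (N.weight (g t) w : ℤ) else 0)
      + (if w = g (t + 1) then (if g (t + 1) ∈ F then 0 else 1) else 0)
      + (if w = g (t - 1) then (if g (t - 1) ∈ F then 0 else 1) else 0) ≤ N.weight (g t) w := by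
    intro w hw
    have h0 : (0 : ℤ) ≤ N.weight (g t) w := by positivity
    by_cases hc : w = p ∨ ι w ≠ t
    · have h1 := h.weight_eq (g t) hgt w hw (by rwa [hιt])
      rw [hιt, if_pos rfl] at h1
      rw [h1]
      push_cast
      by_cases h2 : w = g (t + 1)
      · rw [if_pos h2]
        by_cases h3 : w = g (t - 1)
        · rw [if_pos h3, ← h2, ← h3]; split_ifs <;> simp
        · rw [if_neg h3, ← h2]; split_ifs <;> simp
      · rw [if_neg h2]
        by_cases h3 : w = g (t - 1)
        · rw [if_pos h3, ← h3]; split_ifs <;> simp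
        · rw [if_neg h3]; split_ifs <;> simp
    · push Not at hc
      have h2 : w ≠ g (t + 1) := by
        rintro rfl
        rcases hne (t + 1) htk (by omega) with h3 | h3
        · exact hc.1 h3
        · exact h3 hc.2
      have h3 : w ≠ g (t - 1) := by
        rintro rfl
        rcases hne (t - 1) (by omega) (by omega) with h3 | h3
        · exact hc.1 h3
        · exact h3 hc.2
      rw [if_neg h2, if_neg h3]
      split_ifs <;> linarith
  have hs := Finset.sum_le_sum hterm
  rw [Finset.sum_add_distrib, Finset.sum_add_distrib, Finset.sum_ite_eq', Finset.sum_ite_eq',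
    if_pos (h.g_mem_insert htk), if_pos (h.g_mem_insert (by omega)), Finset.sum_ite_mem,
    Finset.inter_eq_right.2 (hF.trans (Finset.subset_insert _ _))] at hs
  refine hs.trans ?_
  rw [h.pendant.deg_eq _ hgt]
  push_cast
  exact le_rfl

/-! ### The state of a cycle -/

/-- In a recurrent configuration at most one vertex of the cycle other than its exit misses a
chip; the state is its index, and `0` if there is none. -/
def HasState (N : Network V) (k : ℕ) (g : ℕ → V) (c : V → ℤ) (z : ℕ) : Prop :=
  z < k ∧ ∀ t, 0 < t → t < k → c (g t) = N.deg (g t) - 1 - if t = z then 1 else 0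

lemma HasState.unique {c : V → ℤ} {z z' : ℕ} (h : HasState N k g c z)
    (h' : HasState N k g c z') : z = z' := by
  by_contra hne
  rcases Nat.eq_zero_or_pos z with rfl | hz
  · have hz' : 0 < z' := by omega
    have h1 := h.2 z' hz' h'.1
    have h2 := h'.2 z' hz' h'.1
    rw [if_neg (by omega)] at h1
    rw [if_pos rfl] at h2
    omega
  · have h1 := h.2 z hz h.1
    have h2 := h'.2 z hz h.1
    rw [if_pos rfl] at h1
    rw [if_neg hne] at h2
    omega

lemma exists_hasState (h : N.CycleBlock A B p k j g ι) {c : V → ℤ} (hc : N.Recurrent B c) :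
    ∃ z, HasState N k g c z := by
  have arc : ∀ s t, 0 < s → s ≤ t → t < k → ∃ r, (r = s ∨ r = t) ∧
      (N.deg (g r) : ℤ) ≤ c (g r) + (if r = t then 1 else 0) + if r = s then 1 else 0 := by
    intro s t hs hst htk
    obtain ⟨T, hT⟩ : ∃ T : ℕ → Prop, ∀ r, T r ↔ s ≤ r ∧ r ≤ t := ⟨_, fun _ => Iff.rfl⟩
    obtain ⟨u, hu, h1⟩ := hc.noForbidden (B.filter fun w => T (ι w))
      (Finset.filter_subset _ _) ⟨g s, by
        rw [Finset.mem_filter, h.ι_g s hs (by omega), hT]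
        exact ⟨h.g_mem s hs (by omega), le_rfl, hst⟩⟩
    rw [Finset.mem_filter] at hu
    have h2 := h.deg_sub_sum T (by rw [hT]; omega) (by rw [hT]; omega) hu.1 hu.2
    have huT := (hT _).1 hu.2
    have h3 := hc.stable u hu.1
    have hpos := h.ι_pos u hu.1
    by_cases hug : u = g (ι u)
    · rw [if_pos hug] at h2
      refine ⟨ι u, ?_, ?_⟩
      · by_contra! hne
        rw [if_pos ((hT _).2 (by omega)), if_pos ((hT _).2 (by omega))] at h2
        omega
      · rw [← hug]
        have e1 : (if T (ι u + 1) then (0 : ℤ) else 1) = if ι u = t then 1 else 0 := by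
          simp only [hT]; split_ifs <;> omega
        have e2 : (if T (ι u - 1) then (0 : ℤ) else 1) = if ι u = s then 1 else 0 := by
          simp only [hT]; split_ifs <;> omega
        rw [e1, e2] at h2
        linarith
    · rw [if_neg hug] at h2
      omega
  have hub : ∀ t, 0 < t → t < k → c (g t) < N.deg (g t) := fun t ht htk =>
    hc.stable _ (h.g_mem t ht htk)
  have hlb : ∀ t, 0 < t → t < k → (N.deg (g t) : ℤ) - 2 ≤ c (g t) := by
    intro t ht htk
    obtain ⟨r, hr, h1⟩ := arc t t ht le_rfl htk
    have : r = t := by tauto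
    subst this
    rw [if_pos rfl] at h1
    linarith
  by_cases hz : ∃ z, 0 < z ∧ z < k ∧ c (g z) = N.deg (g z) - 2
  · obtain ⟨z, hz0, hzk, hz⟩ := hz
    have other : ∀ t, 0 < t → t < k → t ≠ z → c (g t) = N.deg (g t) - 1 := by
      intro t ht htk htz
      by_contra hcon
      have h2 : c (g t) = N.deg (g t) - 2 := by
        have := hub t ht htk; have := hlb t ht htk; omega
      rcases lt_or_gt_of_ne htz with hlt | hlt
      · obtain ⟨r, rfl | rfl, h1⟩ := arc t z ht hlt.le hzk
        · rw [if_neg (by omega), if_pos rfl] at h1; omega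
        · rw [if_pos rfl, if_neg (by omega)] at h1; omega
      · obtain ⟨r, rfl | rfl, h1⟩ := arc z t hz0 hlt.le htk
        · rw [if_neg (by omega), if_pos rfl] at h1; omega
        · rw [if_pos rfl, if_neg (by omega)] at h1; omega
    refine ⟨z, hzk, fun t ht htk => ?_⟩
    split_ifs with htz
    · subst htz; rw [hz]; ring
    · rw [other t ht htk htz]; ring
  · push Not at hz
    refine ⟨0, by have := h.pos; have := h.lt; omega, fun t ht htk => ?_⟩
    have := hub t ht htk
    have := hlb t ht htk
    have := hz t ht htk
    rw [if_neg (by omega)]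
    omega

/-- Put the cycle into state `z`. -/
noncomputable def setState (N : Network V) (B : Finset V) (g : ℕ → V) (ι : V → ℕ) (c : V → ℤ)
    (z : ℕ) (u : V) : ℤ :=
  if u ∈ B ∧ u = g (ι u) then N.deg u - 1 - (if ι u = z then 1 else 0) else c u

lemma hasState_setState (h : N.CycleBlock A B p k j g ι) (c : V → ℤ) {z : ℕ} (hz : z < k) :
    HasState N k g (setState N B g ι c z) z := by
  refine ⟨hz, fun t ht htk => ?_⟩
  have hι := h.ι_g t ht htk
  rw [setState, if_pos ⟨h.g_mem t ht htk, by rw [hι]⟩, hι]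

lemma setState_eq_self (h : N.CycleBlock A B p k j g ι) {c : V → ℤ} {z : ℕ}
    (hz : HasState N k g c z) : setState N B g ι c z = c := by
  funext u
  rw [setState]
  split_ifs with hu hz'
  · rw [hu.2, hz.2 _ (h.ι_pos u hu.1) (h.ι_lt u hu.1), if_pos hz']
  · rw [hu.2, hz.2 _ (h.ι_pos u hu.1) (h.ι_lt u hu.1), if_neg hz']
  · rfl

lemma setState_setState (c : V → ℤ) (z z' : ℕ) :
    setState N B g ι (setState N B g ι c z) z' = setState N B g ι c z' := by
  funext u
  simp only [setState]
  split_ifs <;> rfl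

/-- The state of a cycle can be changed freely. -/
lemma recurrent_setState (h : N.CycleBlock A B p k j g ι) {B' : Finset V} (hBB : B ⊆ B')
    {c : V → ℤ} (hc : N.Recurrent B' c) {z : ℕ} (hz : z < k) :
    N.Recurrent B' (setState N B g ι c z) := by
  suffices hB : N.Recurrent B (setState N B g ι c z) from
    (hc.glue h.pendant hB hBB).congr fun u _ => by
      split_ifs with hu
      · rfl
      · rw [setState, if_neg fun h => hu h.1]
  refine ⟨fun u hu => ?_, fun F hF hne => ?_⟩
  · rw [setState]
    split_ifs
    · omega
    · omega
    · exact hc.stable u (hBB hu)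
  by_cases hT : ∃ u ∈ F, u = g (ι u)
  swap
  · push Not at hT
    obtain ⟨u, hu, h1⟩ := hc.noForbidden F (hF.trans hBB) hne
    exact ⟨u, hu, by rwa [setState, if_neg fun h => hT u hu h.2]⟩
  -- The two extreme cycle vertices of `F` have neighbours outside `F`.
  set T := (F.filter fun u => u = g (ι u)).image ι with hTdef
  have hTmem : ∀ t, t ∈ T ↔ 0 < t ∧ t < k ∧ g t ∈ F := by
    intro t
    simp only [hTdef, Finset.mem_image, Finset.mem_filter]
    constructor
    · rintro ⟨u, ⟨hu, hug⟩, rfl⟩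
      exact ⟨h.ι_pos u (hF hu), h.ι_lt u (hF hu), hug ▸ hu⟩
    · rintro ⟨h1, h2, h3⟩
      exact ⟨g t, ⟨h3, by rw [h.ι_g t h1 h2]⟩, h.ι_g t h1 h2⟩
  have hTne : T.Nonempty := by
    obtain ⟨u, hu, hug⟩ := hT
    exact ⟨ι u, Finset.mem_image_of_mem _ (Finset.mem_filter.2 ⟨hu, hug⟩)⟩
  have hval : ∀ t, 0 < t → t < k →
      setState N B g ι c z (g t) = N.deg (g t) - 1 - if t = z then 1 else 0 :=
    (h.hasState_setState c hz).2
  have hpF : p ∉ F := fun hp => h.pendant.notMem (hF hp)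
  obtain ⟨ha0, hak, haF⟩ := (hTmem _).1 (T.min'_mem hTne)
  obtain ⟨hb0, hbk, hbF⟩ := (hTmem _).1 (T.max'_mem hTne)
  set a := T.min' hTne
  set b := T.max' hTne
  have hal : g (a - 1) ∉ F := by
    intro hcon
    rcases Nat.eq_zero_or_pos (a - 1) with h0 | h0
    · rw [h0, h.g_zero] at hcon; exact hpF hcon
    · have := T.min'_le (a - 1) ((hTmem _).2 ⟨h0, by omega, hcon⟩)
      change a ≤ _ at this
      omega
  have hbr : g (b + 1) ∉ F := by
    intro hcon
    rcases (show b + 1 ≤ k from hbk).eq_or_lt with h0 | h0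
    · rw [h0, h.g_last] at hcon; exact hpF hcon
    · have := T.le_max' (b + 1) ((hTmem _).2 ⟨by omega, h0, hcon⟩)
      change _ ≤ b at this
      omega
  have hsa := h.sum_add_le_deg ha0 hak hF
  have hsb := h.sum_add_le_deg hb0 hbk hF
  rw [if_neg hal] at hsa
  rw [if_neg hbr] at hsb
  by_cases hza : a = z
  · by_cases hzb : b = z
    · refine ⟨g a, haF, ?_⟩
      rw [hza.trans hzb.symm] at hsa ⊢
      rw [if_neg hbr] at hsa
      rw [hval b hb0 hbk, if_pos hzb]
      linarith
    · refine ⟨g b, hbF, ?_⟩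
      rw [hval b hb0 hbk, if_neg hzb]
      have : (0 : ℤ) ≤ if g (b - 1) ∈ F then 0 else 1 := by split_ifs <;> simp
      linarith
  · refine ⟨g a, haF, ?_⟩
    rw [hval a ha0 hak, if_neg hza]
    have : (0 : ℤ) ≤ if g (a + 1) ∈ F then 0 else 1 := by split_ifs <;> simp
    linarith

lemma setState_mem_recurrents (h : N.CycleBlock A B p k j g ι) {B' : Finset V} (hBB : B ⊆ B')
    {c : V → ℤ} (hc : c ∈ N.recurrents B') {z : ℕ} (hz : z < k) :
    setState N B g ι c z ∈ N.recurrents B' :=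
  ⟨fun u hu => by rw [setState, if_neg fun h => hu (hBB h.1), hc.1 u hu],
    h.recurrent_setState hBB hc.2 hz⟩

end CycleBlock

end Network

/-! ### Sandpiles on a path -/

/-- `η` are the firing numbers that lead from state `z` to state `z'` on the path
`1, …, k - 1` when `τ` chips are added at `j`; the ends `0` and `k` are sinks. -/
structure PathFiring (k j z z' : ℕ) (τ : ℤ) (η : ℕ → ℤ) : Prop where
  lt : z' < k
  zero : η 0 = 0
  last : η k = 0
  eq : ∀ t, 0 < t → t < k → -(if t = z then 1 else 0) + (if t = j then τ else 0)
    + η (t - 1) + η (t + 1) - 2 * η t = -(if t = z' then 1 else 0)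

/-- The trapezoid on `[a, b]` with one upper corner at `j`: the firing numbers of a chip added at
`j` when `a` and `b` are the vacant sites next to `j`. -/
def trapezoid (a b j : ℕ) (t : ℕ) : ℤ :=
  max 0 (min (min ((t : ℤ) - a) (b - t)) (min (j - a) (b - j)))

lemma trapezoid_eq {a b j : ℕ} (ha : a < j) (hb : j < b) {t : ℕ} (ht : 0 < t) :
    trapezoid a b j (t - 1) + trapezoid a b j (t + 1) - 2 * trapezoid a b j t
      = (if t = a then 1 else 0) + (if t = b then 1 else 0) - (if t = j then 1 else 0)
        - (if t = a + b - j then 1 else 0) := by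
  obtain ⟨s, rfl⟩ : ∃ s, t = s + 1 := ⟨t - 1, by omega⟩
  simp only [trapezoid, Nat.add_sub_cancel]
  push_cast
  split_ifs <;> omega

/-- Adding one chip moves the vacant site `z` to `z - j` modulo `k`. -/
lemma exists_pathFiring_one {k j z : ℕ} (hj : 0 < j) (hjk : j < k) (hz : z < k) :
    ∃ z' η, PathFiring k j z z' 1 η ∧ (∃ q : ℤ, (z' : ℤ) = z - j + q * k) ∧
      η 1 + η (k - 1) + (if z = 0 then 0 else 1) = 1 + if z' = 0 then 0 else 1 := by
  rcases Nat.eq_zero_or_pos z with rfl | hz0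
  · refine ⟨k - j, trapezoid 0 k j, ⟨by omega, ?_, ?_, fun t ht htk => ?_⟩, ⟨1, by omega⟩, ?_⟩
    · simp [trapezoid]
    · simp [trapezoid]
    · have := trapezoid_eq hj hjk ht
      split_ifs at this ⊢ <;> omega
    · simp only [trapezoid]
      split_ifs <;> omega
  rcases lt_trichotomy z j with h | rfl | h
  · refine ⟨k + z - j, trapezoid z k j, ⟨by omega, ?_, ?_, fun t ht htk => ?_⟩, ⟨1, by omega⟩, ?_⟩
    · simp only [trapezoid]; omega
    · simp only [trapezoid]; omega
    · have := trapezoid_eq h hjk ht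
      split_ifs at this ⊢ <;> omega
    · simp only [trapezoid]
      split_ifs <;> omega
  · refine ⟨0, fun _ => 0, ⟨by omega, rfl, rfl, fun t ht htk => ?_⟩, ⟨0, by simp⟩, ?_⟩
    · split_ifs <;> omega
    · rw [if_neg (by omega), if_pos rfl]; simp
  · refine ⟨z - j, trapezoid 0 z j, ⟨by omega, ?_, ?_, fun t ht htk => ?_⟩, ⟨0, by omega⟩, ?_⟩
    · simp only [trapezoid]; omega
    · simp only [trapezoid]; omega
    · have := trapezoid_eq hj h ht
      split_ifs at this ⊢ <;> omega
    · simp only [trapezoid]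
      split_ifs <;> omega

/-- Adding `τ` chips at `j` moves the vacant site `z` to `z - τ j` modulo `k`. The number of chips
that leave the path is `τ`, corrected by the change of the number of vacant sites. -/
lemma exists_pathFiring {k j z : ℕ} (hj : 0 < j) (hjk : j < k) (hz : z < k) (τ : ℕ) :
    ∃ z' η, PathFiring k j z z' τ η ∧ (∃ q : ℤ, (z' : ℤ) = z - τ * j + q * k) ∧
      η 1 + η (k - 1) + (if z = 0 then 0 else 1) = τ + if z' = 0 then 0 else 1 := by
  induction τ with
  | zero =>
    refine ⟨z, fun _ => 0, ⟨hz, rfl, rfl, fun t _ _ => ?_⟩, ⟨0, by simp⟩, by simp⟩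
    simp
  | succ τ ih =>
    obtain ⟨z₁, η₁, h₁, ⟨q₁, hq₁⟩, ho₁⟩ := ih
    obtain ⟨z₂, η₂, h₂, ⟨q₂, hq₂⟩, ho₂⟩ := exists_pathFiring_one hj hjk h₁.lt
    refine ⟨z₂, fun t => η₁ t + η₂ t, ⟨h₂.lt, ?_, ?_, fun t ht htk => ?_⟩,
      ⟨q₁ + q₂, ?_⟩, ?_⟩
    · simp [h₁.zero, h₂.zero]
    · simp [h₁.last, h₂.last]
    · have e₁ := h₁.eq t ht htk
      have e₂ := h₂.eq t ht htk
      by_cases htj : t = j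
      · simp only [htj, if_true] at e₁ e₂ ⊢
        push_cast
        linarith
      · simp only [htj, if_false] at e₁ e₂ ⊢
        linarith
    · rw [hq₂, hq₁]; push_cast; ring
    · push_cast
      linarith

/-- All but two states let exactly as many chips out as are added. -/
lemma exists_pathFiring_outflow {k j : ℕ} (hj : 0 < j) (hjk : j < k) (τ : ℕ) :
    ∃ z₀, ∀ z < k, z ≠ 0 → z ≠ z₀ →
      ∃ z' η, PathFiring k j z z' τ η ∧ η 1 + η (k - 1) = τ := by
  refine ⟨τ * j % k, fun z hz hz0 hne => ?_⟩
  obtain ⟨z', η, h, ⟨q, hq⟩, ho⟩ := exists_pathFiring hj hjk hz τ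
  refine ⟨z', η, h, ?_⟩
  have hz' : z' ≠ 0 := by
    rintro rfl
    refine hne ?_
    have h1 : (z : ℤ) = τ * j + (-q) * k := by push_cast at hq; linarith
    have h2 : ((τ * j % k : ℕ) : ℤ) = (z : ℤ) := by
      push_cast
      rw [← Int.add_mul_emod_self_right (τ * j : ℤ) (-q) k, ← h1]
      exact Int.emod_eq_of_lt (by positivity) (by exact_mod_cast hz)
    exact_mod_cast h2.symm
  rw [if_neg hz0, if_neg hz'] at ho
  linarith

/-- One side of `PathFiring.support_eq`: if the firing region is bounded on the right by a
site before the exit, then that site was vacant and the region reaches the other exit. -/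
lemma PathFiring.support_aux {k j z z' : ℕ} {τ : ℤ} {η : ℕ → ℤ} (h : PathFiring k j z z' τ η)
    (hη : ∀ t, 0 ≤ η t) {b : ℕ} (hjb : j < b) (hbk : b < k)
    (hb0 : η b = 0) (hb : ∀ t, j ≤ t → t < b → 0 < η t)
    (hleft : ∀ t, 0 < t → t ≤ j → 0 < η t) :
    b = z ∧ ∀ t, 0 < t → t < k → (0 < η t ↔ t < z) := by
  have hb1 := h.eq b (by omega) hbk
  have hb2 := hb (b - 1) (by omega) (by omega)
  have hb3 := hη (b + 1)
  rw [if_neg (show b ≠ j by omega), hb0] at hb1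
  have hbz : b = z := by by_contra hne; rw [if_neg hne] at hb1; split_ifs at hb1 <;> omega
  have hright : ∀ t, b ≤ t → t < k → η t = 0 ∧ η (t + 1) = 0 := by
    intro t hbt
    induction t, hbt using Nat.le_induction with
    | base => intro _; rw [if_pos hbz] at hb1; split_ifs at hb1 <;> omega
    | succ t hbt ih =>
      intro htk
      have h1 := h.eq (t + 1) (by omega) htk
      obtain ⟨h2, h3⟩ := ih (by omega)
      rw [if_neg (show t + 1 ≠ j by omega), if_neg (show t + 1 ≠ z by omega), h3,
        Nat.add_sub_cancel, h2] at h1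
      have := hη (t + 1 + 1)
      refine ⟨h3, ?_⟩
      split_ifs at h1 <;> omega
  refine ⟨hbz, fun t ht htk => ⟨fun hpos => ?_, fun htz => ?_⟩⟩
  · by_contra hcon
    have := (hright t (by omega) htk).1
    omega
  · rcases le_or_gt t j with h1 | h1
    · exact hleft t ht h1
    · exact hb t h1.le (by omega)

lemma PathFiring.reflect {k j z z' : ℕ} {τ : ℤ} {η : ℕ → ℤ} (h : PathFiring k j z z' τ η)
    (hj : j < k) (hz : 0 < z) (hzk : z < k) :
    ∃ z'', PathFiring k (k - j) (k - z) z'' τ fun t => η (k - t) := by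
  refine ⟨if z' = 0 then 0 else k - z', ⟨?_, by simp [h.last], by simp [h.zero],
    fun t ht htk => ?_⟩⟩
  · have := h.lt; split_ifs <;> omega
  · have h1 := h.eq (k - t) (by omega) (by omega)
    have h2 := h.lt
    have e1 : k - (t - 1) = k - t + 1 := by omega
    have e2 : k - (t + 1) = k - t - 1 := by omega
    simp only [e1, e2]
    split_ifs at h1 ⊢ <;> omega

/-- If the source fires and at most one chip leaves the path, then the fired sites are those on
the side of the source of the vacant site. -/
lemma PathFiring.support_eq {k j z z' : ℕ} {τ : ℤ} {η : ℕ → ℤ} (h : PathFiring k j z z' τ η)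
    (hj : 0 < j) (hjk : j < k) (hη : ∀ t, 0 ≤ η t) (hjpos : 0 < η j)
    (hout : η 1 + η (k - 1) ≤ 1) :
    (j < z ∧ z < k ∧ ∀ t, 0 < t → t < k → (0 < η t ↔ t < z)) ∨
      (0 < z ∧ z < j ∧ ∀ t, 0 < t → t < k → (0 < η t ↔ z < t)) := by
  -- the first zeros on both sides of `j`
  have hexb : ∃ b, j < b ∧ η b = 0 := ⟨k, hjk, h.last⟩
  have hexa : ∃ a, j < k - a + a ∧ a ≤ j ∧ η (j - a) = 0 := ⟨j, by omega, le_rfl, by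
    rw [Nat.sub_self]; exact h.zero⟩
  obtain ⟨b, hjb, hbk, hb0, hb⟩ : ∃ b, j < b ∧ b ≤ k ∧ η b = 0 ∧
      ∀ t, j ≤ t → t < b → 0 < η t := by
    refine ⟨Nat.find hexb, (Nat.find_spec hexb).1, Nat.find_min' hexb ⟨hjk, h.last⟩,
      (Nat.find_spec hexb).2, fun t ht htb => ?_⟩
    rcases ht.eq_or_lt with rfl | hlt
    · exact hjpos
    · have := Nat.find_min hexb htb
      push Not at this
      exact lt_of_le_of_ne (hη t) (this hlt).symm
  obtain ⟨a, haj, ha0, ha⟩ : ∃ a, a < j ∧ η a = 0 ∧ ∀ t, a < t → t ≤ j → 0 < η t := by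
    refine ⟨j - Nat.find hexa, ?_, (Nat.find_spec hexa).2.2, fun t ht htj => ?_⟩
    · have h1 : Nat.find hexa ≠ 0 := by
        intro h0
        have := (Nat.find_spec hexa).2.2
        rw [h0, Nat.sub_zero] at this
        omega
      omega
    · have h1 : j - t < Nat.find hexa := by have := (Nat.find_spec hexa).2.1; omega
      have := Nat.find_min hexa h1
      push Not at this
      have h2 := this (by omega) (by omega)
      rw [Nat.sub_sub_self htj] at h2
      exact lt_of_le_of_ne (hη t) h2.symm
  rcases hbk.eq_or_lt with rfl | hbk
  · rcases Nat.eq_zero_or_pos a with rfl | hapos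
    · have := ha 1 (by omega) (by omega)
      have := hb (b - 1) (by omega) (by omega)
      omega
    · have h1 := h.eq a hapos (by omega)
      have h2 := ha (a + 1) (by omega) (by omega)
      have h3 := hη (a - 1)
      have haz : a = z := by
        by_contra hne
        rw [if_neg hne, if_neg (by omega), ha0] at h1
        split_ifs at h1 <;> omega
      obtain ⟨z'', hr⟩ := h.reflect hjk (by omega) (by omega)
      obtain ⟨-, h4⟩ := hr.support_aux (fun t => hη _)
        (b := b - a) (by omega) (by omega)
        (by rw [Nat.sub_sub_self (by omega)]; exact ha0)
        (fun t h5 h6 => ha _ (by omega) (by omega)) (fun t h5 h6 => hb _ (by omega) (by omega))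
      refine Or.inr ⟨by omega, by omega, fun t h5 h6 => ?_⟩
      have h7 := h4 (b - t) (by omega) (by omega)
      simp only [Nat.sub_sub_self h6.le] at h7
      rw [h7]
      omega
  · have hbz := h.eq b (by omega) hbk
    have h2 := hb (b - 1) (by omega) (by omega)
    have h3 := hη (b + 1)
    have hbz' : b = z := by
      by_contra hne
      rw [if_neg hne, if_neg (by omega), hb0] at hbz
      split_ifs at hbz <;> omega
    have haz : a = 0 := by
      by_contra hapos
      have h1 := h.eq a (by omega) (by omega)
      have h2 := ha (a + 1) (by omega) (by omega)
      have h3 := hη (a - 1)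
      rw [if_neg (by omega), if_neg (by omega), ha0] at h1
      split_ifs at h1 <;> omega
    obtain ⟨-, h4⟩ := h.support_aux hη hjb hbk hb0 hb
      (fun t h5 h6 => ha t (by omega) h6)
    exact Or.inl ⟨by omega, by omega, h4⟩

namespace Network

variable {V : Type*} {N : Network V}

namespace CycleBlock

variable {A B : Finset V} {p : V} {k j : ℕ} {g : ℕ → V} {ι : V → ℕ} {v : V}

/-! ### Odometers along the chain -/

/-- The Laplacian of firing numbers that are `η` along the cycle, plus `ν` on the inner part. -/
lemma lap_lift_add (h : N.CycleBlock A B p k j g ι) {η : ℕ → ℤ} (h0 : η 0 = 0) (hk : η k = 0)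
    {ν : V → ℤ} (hν : ∀ u, u ∉ A → ν u = 0) {u : V} (hu : u ∈ B) :
    N.lap B (fun w => lift B ι η w + ν w) u =
      if u ∈ A then N.lap A ν u
      else if u = g (ι u) then 2 * η (ι u) - η (ι u + 1) - η (ι u - 1)
        - (if ι u = j then N.outflow A (g j) ν else 0)
      else 0 := by
  rw [lap_add, h.lap_lift h0 hk hu, lap_eq_of_support h.subset fun w _ hw => hν w hw]
  by_cases huA : u ∈ A
  · rw [if_pos huA, if_neg, zero_add]
    intro hug
    rw [hug] at huA
    exact h.g_notMem _ (h.ι_pos u hu) (h.ι_lt u hu) huA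
  · rw [if_neg huA]
    by_cases huj : u = g j
    · have hιj : ι u = j := by rw [huj, h.ι_g j h.pos h.lt]
      rw [hιj, if_pos huj, if_pos huj, if_pos rfl, sub_eq_add_neg _ (N.outflow A (g j) ν)]
      congr 1
      rw [lap, hν u huA, zero_mul, zero_sub, outflow, huj]
    · rw [h.pendant_inner.lap_eq_zero subset_rfl hν huA huj, add_zero]
      by_cases hug : u = g (ι u)
      · rw [if_pos hug, if_pos hug, if_neg, sub_zero]
        rintro hιj
        rw [hιj] at hug
        exact huj hug
      · rw [if_neg hug, if_neg hug]

lemma outflow_lift_add (h : N.CycleBlock A B p k j g ι) {η : ℕ → ℤ} {ν : V → ℤ} (hν : ∀ u, u ∉ A → ν u = 0) :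
    N.outflow B p (fun w => lift B ι η w + ν w) = η 1 + η (k - 1) := by
  have hlt := h.lt
  have hpos := h.pos
  have hpA : p ∉ A := fun hp => h.pendant.notMem (h.subset hp)
  have hpj : p ≠ g j := fun hp => h.pendant.notMem (hp ▸ h.g_mem j hpos hlt)
  have hterm : ∀ u ∈ B, (N.weight p u : ℤ) * (lift B ι η u + ν u)
      = (if u = g 1 then η 1 else 0) + (if u = g (k - 1) then η (k - 1) else 0) := by
    intro u hu
    have h1 : (N.weight p u : ℤ) * ν u = 0 := by
      by_cases huA : u ∈ A
      · rw [N.symm, h.pendant_inner.weight_eq_zero huA hpA hpj]; simp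
      · rw [hν u huA, mul_zero]
    have hιp := h.ι_pos u hu
    have hιk := h.ι_lt u hu
    rw [mul_add, h1, add_zero, N.symm, h.weight_eq u hu p (by simp) (Or.inl rfl),
      show lift B ι η u = η (ι u) from if_pos hu]
    have ginj : ∀ t, 0 < t → t < k → (u = g t ↔ u = g (ι u) ∧ ι u = t) := by
      intro t ht htk
      constructor
      · intro hut
        have : ι u = t := by rw [hut, h.ι_g t ht htk]
        exact ⟨by rw [this, hut], this⟩
      · rintro ⟨h2, h3⟩
        rw [← h3]; exact h2
    have gp : ∀ t ≤ k, (p = g t ↔ t = 0 ∨ t = k) := by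
      intro t ht
      constructor
      · intro hpt
        by_contra! hcon
        exact h.pendant.notMem (hpt ▸ h.g_mem t (by omega) (by omega))
      · rintro (rfl | rfl)
        · exact h.g_zero.symm
        · exact h.g_last.symm
    by_cases hug : u = g (ι u)
    · rw [if_pos hug]
      simp only [ginj 1 (by omega) (by omega), ginj (k - 1) (by omega) (by omega),
        gp (ι u + 1) (by omega), gp (ι u - 1) (by omega)]
      have ea : (ι u + 1 = 0 ∨ ι u + 1 = k) ↔ ι u = k - 1 := by omega
      have eb : (ι u - 1 = 0 ∨ ι u - 1 = k) ↔ ι u = 1 := by omega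
      simp only [ea, eb, hug.symm, true_and]
      push_cast
      by_cases e1 : ι u = 1
      · by_cases e2 : ι u = k - 1
        · simp only [e1, e2.symm.trans e1, if_true]; rw [← e1]; simp; ring
        · simp [e1, show ¬ (1 = k - 1) from fun h => e2 (e1.trans h)]
      · by_cases e2 : ι u = k - 1
        · simp [e2, show ¬ (k - 1 = 1) from fun h => e1 (e2.trans h)]
        · simp [e1, e2]
    · rw [if_neg hug, if_neg fun h2 => hug ((ginj 1 (by omega) (by omega)).1 h2).1,
        if_neg fun h2 => hug ((ginj (k - 1) (by omega) (by omega)).1 h2).1]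
      simp
  rw [outflow, Finset.sum_congr rfl hterm, Finset.sum_add_distrib, Finset.sum_ite_eq',
    Finset.sum_ite_eq', if_pos (h.g_mem 1 (by omega) (by omega)),
    if_pos (h.g_mem (k - 1) (by omega) (by omega))]

/-- An odometer of the inner part extends through the cycle. -/
lemma isOdometer_lift_add (h : N.CycleBlock A B p k j g ι) (hv : v ∈ A) {c ν : V → ℤ}
    (hc : N.Recurrent B c) (hν : N.IsOdometer A v c ν) {z z' : ℕ} (hz : HasState N k g c z)
    {η : ℕ → ℤ} (hη : PathFiring k j z z' (N.outflow A (g j) ν) η) :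
    N.IsOdometer B v c fun w => lift B ι η w + ν w := by
  refine ⟨fun u hu => ?_, ?_⟩
  · rw [lift, if_neg hu, hν.support u fun hA => hu (h.subset hA), add_zero]
  refine ((h.recurrent_setState subset_rfl hc hη.lt).glue h.pendant_inner hν.recurrent
    h.subset).congr fun u hu => ?_
  rw [h.lap_lift_add hη.zero hη.last hν.support hu]
  by_cases huA : u ∈ A
  · simp only [huA, if_true]
  · have huv : u ≠ v := by rintro rfl; exact huA hv
    simp only [huA, if_false, huv, add_zero]
    by_cases hug : u = g (ι u)
    · rw [setState, if_pos ⟨hu, hug⟩, if_pos hug]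
      have h1 := hη.eq (ι u) (h.ι_pos u hu) (h.ι_lt u hu)
      have h2 := hz.2 (ι u) (h.ι_pos u hu) (h.ι_lt u hu)
      rw [← hug] at h2
      rw [h2]
      linarith
    · rw [setState, if_neg fun h => hug h.2, if_neg hug, sub_zero]

/-- Every odometer arises by extension: it is constant on the parts hanging at the vertices of the
cycle, except for the inner part, where an odometer of the inner part is added. -/
lemma exists_decomposition (h : N.CycleBlock A B p k j g ι) (hv : v ∈ A) {c n : V → ℤ}
    (hc : N.Recurrent B c) (hn : N.IsOdometer B v c n) {z : ℕ} (hz : HasState N k g c z) :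
    ∃ ν η z', N.IsOdometer A v c ν ∧ PathFiring k j z z' (N.outflow A (g j) ν) η ∧
      n = (fun w => lift B ι η w + ν w) ∧ ∀ t, η t = n (g t) := by
  set η : ℕ → ℤ := fun t => n (g t) with hη
  have hη0 : η 0 = 0 := by rw [hη]; simp only; rw [h.g_zero, hn.support p h.pendant.notMem]
  have hηk : η k = 0 := by rw [hη]; simp only; rw [h.g_last, hn.support p h.pendant.notMem]
  set ν : V → ℤ := fun u => if u ∈ A then n u - n (g j) else 0 with hν
  have hνs : ∀ u, u ∉ A → ν u = 0 := fun u hu => if_neg hu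
  have hνodo : N.IsOdometer A v c ν := by
    refine ⟨hνs, (hn.recurrent.subset h.subset).congr fun u hu => ?_⟩
    congr 1
    rw [h.pendant_inner.lap_eq h.subset hn.support hu,
      h.pendant_inner.lap_eq subset_rfl hνs hu]
    refine Finset.sum_congr rfl fun w hw => ?_
    congr 1
    have h1 : ν w = n w - n (g j) := by
      rcases Finset.mem_insert.1 hw with rfl | hw
      · rw [hνs _ h.pendant_inner.notMem, sub_self]
      · exact if_pos hw
    rw [h1, show ν u = n u - n (g j) from if_pos hu]
    ring
  -- The difference lives on the parts without root hanging at the cycle, where it vanishes.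
  set W := B.filter fun u => u ∉ A ∧ u ≠ g (ι u) with hW
  set δ : V → ℤ := fun u => n u - (lift B ι η u + ν u) with hδ
  have hδ0 : ∀ u ∈ B, u ∉ W → δ u = 0 := by
    intro u hu huW
    have : u ∈ A ∨ u = g (ι u) := by
      by_contra! hcon
      exact huW (Finset.mem_filter.2 ⟨hu, hcon⟩)
    simp only [hδ]
    rw [show lift B ι η u = η (ι u) from if_pos hu]
    by_cases huA : u ∈ A
    · rw [show ν u = n u - n (g j) from if_pos huA, h.ι_inner u huA]
      simp only [hη]; ring
    · have hug : u = g (ι u) := by tauto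
      rw [hνs u huA]
      simp only [hη]
      rw [← hug]; ring
  have hWB : W ⊆ B := Finset.filter_subset _ _
  have hδW : ∀ u ∈ W, δ u = 0 := by
    refine Recurrent.eq_zero_of_sub_lap (hc.subset hWB) ((hn.recurrent.subset hWB).congr
      fun u hu => ?_)
    have hu' := (Finset.mem_filter.1 hu).2
    have huv : u ≠ v := by rintro rfl; exact hu'.1 hv
    rw [← lap_eq_of_support hWB hδ0, if_neg huv, add_zero, hδ,
      lap_sub n (fun w => lift B ι η w + ν w), h.lap_lift_add hη0 hηk hνs (hWB hu),
      if_neg hu'.1, if_neg hu'.2, sub_zero]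
  have hneq : n = fun w => lift B ι η w + ν w := by
    funext u
    by_cases hu : u ∈ B
    · have : δ u = 0 := by
        by_cases huW : u ∈ W
        · exact hδW u huW
        · exact hδ0 u hu huW
      simp only [hδ] at this
      linarith
    · rw [hn.support u hu, lift, if_neg hu, hνs u fun hA => hu (h.subset hA), add_zero]
  obtain ⟨z', hz'⟩ := h.exists_hasState hn.recurrent
  refine ⟨ν, η, z', hνodo, ⟨hz'.1, hη0, hηk, fun t ht htk => ?_⟩, hneq, fun _ => rfl⟩
  have h1 := hz'.2 t ht htk
  simp only at h1
  have h2 := hz.2 t ht htk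
  have hιt := h.ι_g t ht htk
  have hgv : g t ≠ v := fun hgv => h.g_notMem t ht htk (hgv ▸ hv)
  have h3 := h.lap_lift_add hη0 hηk hνs (h.g_mem t ht htk)
  rw [← hneq, hιt, if_neg (h.g_notMem t ht htk), if_pos rfl] at h3
  rw [h2, if_neg hgv, h3] at h1
  linarith

end CycleBlock

end Network

/-- Chips are conserved: what leaves the path is what was added, corrected by the change of the
number of vacant sites. -/
lemma PathFiring.conservation {k j z z' : ℕ} {τ : ℤ} {η : ℕ → ℤ} (h : PathFiring k j z z' τ η)
    (hj : 0 < j) (hjk : j < k) (hz : z < k) :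
    η 1 + η (k - 1) + (if z = 0 then 0 else 1) = τ + if z' = 0 then 0 else 1 := by
  have key : ∀ m, m < k → -(if 0 < z ∧ z ≤ m then 1 else 0) + (if j ≤ m then τ else 0)
      + (η (m + 1) - η m) - (η 1 - η 0) = -(if 0 < z' ∧ z' ≤ m then 1 else 0) := by
    intro m
    induction m with
    | zero =>
      intro _
      rw [if_neg (by omega), if_neg (by omega), if_neg (by omega)]; ring
    | succ m ih =>
      intro hm
      have h1 := h.eq (m + 1) (by omega) hm
      have h2 := ih (by omega)
      rw [Nat.add_sub_cancel] at h1
      have e1 : (if 0 < z ∧ z ≤ m + 1 then (1 : ℤ) else 0)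
          = (if 0 < z ∧ z ≤ m then 1 else 0) + if m + 1 = z then 1 else 0 := by
        split_ifs <;> omega
      have e2 : (if 0 < z' ∧ z' ≤ m + 1 then (1 : ℤ) else 0)
          = (if 0 < z' ∧ z' ≤ m then 1 else 0) + if m + 1 = z' then 1 else 0 := by
        split_ifs <;> omega
      have e3 : (if j ≤ m + 1 then τ else 0)
          = (if j ≤ m then τ else 0) + if m + 1 = j then τ else 0 := by
        split_ifs <;> omega
      rw [e1, e2, e3]
      linarith
  have h1 := key (k - 1) (by omega)
  have h2 := h.lt
  rw [Nat.sub_add_cancel (by omega), h.last, h.zero, if_pos (show j ≤ k - 1 by omega)] at h1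
  have e1 : (if 0 < z ∧ z ≤ k - 1 then (1 : ℤ) else 0) = if z = 0 then 0 else 1 := by
    split_ifs <;> omega
  have e2 : (if 0 < z' ∧ z' ≤ k - 1 then (1 : ℤ) else 0) = if z' = 0 then 0 else 1 := by
    split_ifs <;> omega
  rw [e1, e2] at h1
  linarith

namespace Network

variable {V : Type*} {N : Network V}

/-- The avalanche triggered in `c` by a chip on `v` sends `τ` chips from `A` to `q`. -/
def Outflows (N : Network V) (A : Finset V) (q v : V) (τ : ℤ) (c : V → ℤ) : Prop :=
  ∃ ν, N.IsOdometer A v c ν ∧ N.outflow A q ν = τ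

lemma Outflows.congr {A : Finset V} {q v : V} {τ : ℤ} {c c' : V → ℤ} (h : N.Outflows A q v τ c)
    (hcc : ∀ u ∈ A, c u = c' u) : N.Outflows A q v τ c' := by
  obtain ⟨ν, h1, h2⟩ := h
  exact ⟨ν, h1.congr hcc, h2⟩

namespace CycleBlock

variable {A B : Finset V} {p : V} {k j : ℕ} {g : ℕ → V} {ι : V → ℕ} {v : V}

/-- The entrance of the cycle together with everything hanging there. -/
noncomputable def entrance (B : Finset V) (ι : V → ℕ) (j : ℕ) : Finset V := B.filter fun u => ι u = j

lemma g_mem_entrance (h : N.CycleBlock A B p k j g ι) : g j ∈ entrance B ι j :=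
  Finset.mem_filter.2 ⟨h.g_mem j h.pos h.lt, h.ι_g j h.pos h.lt⟩

lemma deg_entrance (h : N.CycleBlock A B p k j g ι) {u : V} (hu : u ∈ entrance B ι j)
    (huj : u ≠ g j) : N.deg u = ∑ w ∈ entrance B ι j, N.weight u w := by
  have hpos := h.pos
  have hlt := h.lt
  have hu' := Finset.mem_filter.1 hu
  obtain ⟨T, hT⟩ : ∃ T : ℕ → Prop, ∀ r, T r ↔ r = j := ⟨_, fun _ => Iff.rfl⟩
  have h1 := h.deg_sub_sum T (by rw [hT]; omega) (by rw [hT]; omega) hu'.1 ((hT _).2 hu'.2)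
  rw [if_neg (by rw [hu'.2]; exact huj)] at h1
  have h2 : entrance B ι j = B.filter fun w => T (ι w) := by
    simp only [entrance, hT]
  rw [h2]
  have h3 : (N.deg u : ℤ) = ((∑ w ∈ B.filter (fun w => T (ι w)), N.weight u w : ℕ) : ℤ) := by
    push_cast; linarith
  exact_mod_cast h3

/-- The state of the cycle, as a function of the configuration. -/
noncomputable def state (N : Network V) (k : ℕ) (g : ℕ → V) (c : V → ℤ) : ℕ :=
  if h : ∃ z, HasState N k g c z then h.choose else 0

lemma HasState.state_eq {c : V → ℤ} {z : ℕ} (h : HasState N k g c z) : state N k g c = z := by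
  have hex : ∃ z, HasState N k g c z := ⟨z, h⟩
  rw [state, dif_pos hex]
  exact hex.choose_spec.unique h

lemma hasState_state (h : N.CycleBlock A B p k j g ι) {B' : Finset V} (hBB : B ⊆ B') {c : V → ℤ}
    (hc : c ∈ N.recurrents B') : HasState N k g c (state N k g c) := by
  obtain ⟨z, hz⟩ := h.exists_hasState (hc.2.subset hBB)
  rwa [hz.state_eq]

lemma setState_eq_of_notMem {c : V → ℤ} {z : ℕ} {u : V} (hu : u ∉ B) :
    setState N B g ι c z u = c u := by
  rw [setState, if_neg fun h => hu h.1]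

lemma setState_eq_of_mem (h : N.CycleBlock A B p k j g ι) {c : V → ℤ} {z : ℕ} {u : V}
    (hu : u ∈ A) : setState N B g ι c z u = c u := by
  rw [setState, if_neg]
  rintro ⟨huB, hug⟩
  exact h.g_notMem _ (h.ι_pos u huB) (h.ι_lt u huB) (hug ▸ hu)

/-- Passing a long cycle hardly changes the number of chips that get through. -/
lemma ncard_outflows_mul_le (h : N.CycleBlock A B p k j g ι) (hv : v ∈ A) (τ : ℕ) :
    {c ∈ N.recurrents B | N.Outflows A (g j) v τ c}.ncard * (k - 2)
      ≤ {c ∈ N.recurrents B | N.Outflows B p v τ c}.ncard * k := by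
  obtain ⟨z₀, hz₀⟩ := exists_pathFiring_outflow h.pos h.lt τ
  set R : Set (V → ℤ) := {c ∈ N.recurrents B | N.Outflows A (g j) v τ c}
  set E : Set ℕ := ((((Finset.range k).erase 0).erase z₀ : Finset ℕ) : Set ℕ)
  have hE : k - 2 ≤ E.ncard := by
    rw [Set.ncard_coe_finset]
    have h1 := Finset.pred_card_le_card_erase (s := Finset.range k) (a := 0)
    have h2 := Finset.pred_card_le_card_erase (s := (Finset.range k).erase 0) (a := z₀)
    rw [Finset.card_range] at h1
    omega
  have hmain := ncard_mul_ncard_resample (R := R) (R' := (Finset.range k : Set ℕ)) (E := E)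
    (state N k g) (fun c z => setState N B g ι c z)
    (fun z hz => by
      simp only [E, Finset.coe_erase, Set.mem_sdiff] at hz
      exact hz.1.1)
    (fun c hc => by
      simpa using (h.hasState_state subset_rfl hc.1).1)
    (fun c hc z hz => ⟨h.setState_mem_recurrents subset_rfl hc.1 (by simpa using hz),
      hc.2.congr fun u hu => (h.setState_eq_of_mem hu).symm⟩)
    (fun c hc z hz => (h.hasState_setState c (by simpa using hz)).state_eq)
    (fun c hc z hz => by
      rw [setState_setState, h.setState_eq_self (h.hasState_state subset_rfl hc.1)])
  rw [Set.ncard_coe_finset, Finset.card_range] at hmain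
  have hsub : {c ∈ R | state N k g c ∈ E} ⊆ {c ∈ N.recurrents B | N.Outflows B p v τ c} := by
    rintro c ⟨⟨hc, ν, hν, hτ⟩, hcE⟩
    refine ⟨hc, ?_⟩
    have hz := h.hasState_state subset_rfl hc
    simp only [E, Finset.coe_erase, Set.mem_sdiff, Set.mem_singleton_iff] at hcE
    obtain ⟨z', η, hη, ho⟩ := hz₀ _ hz.1 hcE.1.2 hcE.2
    rw [← hτ] at hη
    exact ⟨_, h.isOdometer_lift_add hv hc.2 hν hz hη,
      by rw [h.outflow_lift_add hν.support, ho]⟩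
  have hle := Set.ncard_le_ncard hsub (finite_recurrents.subset fun c hc => hc.1)
  calc _ ≤ E.ncard * R.ncard := by rw [mul_comm]; exact Nat.mul_le_mul_right _ hE
    _ = _ := hmain.symm
    _ ≤ _ := Nat.mul_le_mul_right _ hle

/-! ### Avalanches of a given mass -/

variable {B₂ : Finset V} {p₂ : V} {k₂ j₂ : ℕ} {g₂ : ℕ → V} {ι₂ : V → ℕ}

lemma filter_pos_eq (h : N.CycleBlock A B p k j g ι) (hBB : B ⊆ B₂) {η : ℕ → ℤ}
    (hjη : 0 < η j) {ν : V → ℤ} (hν : ∀ u, 0 ≤ ν u)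
    (hνs : ∀ u, u ∉ A → ν u = 0) :
    (B₂.filter fun u => 0 < lift B ι η u + ν u) = B.filter fun u => 0 < η (ι u) := by
  ext u
  simp only [Finset.mem_filter]
  by_cases hu : u ∈ B
  · rw [show lift B ι η u = η (ι u) from if_pos hu]
    by_cases huA : u ∈ A
    · rw [h.ι_inner u huA]
      have := hν u
      exact ⟨fun _ => ⟨hu, hjη⟩, fun _ => ⟨hBB hu, by omega⟩⟩
    · rw [hνs u huA, add_zero]
      exact ⟨fun h => ⟨hu, h.2⟩, fun h => ⟨hBB hu, h.2⟩⟩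
  · rw [lift, if_neg hu, hνs u fun hA => hu (h.subset hA)]
    simp [hu]

/-- An avalanche whose mass lies between the sizes of two consecutive entrances passes the
entrance of the first cycle and is stopped by a vacancy at the entrance of the second one. -/
lemma mass_structure (h : N.CycleBlock A B p k j g ι) (h₂ : N.CycleBlock B B₂ p₂ k₂ j₂ g₂ ι₂)
    (hp : g₂ j₂ = p) (hv : v ∈ A) {c n : V → ℤ} (hc : N.Recurrent B₂ c)
    (hn : N.IsOdometer B₂ v c n) (hM₁ : (entrance B ι j).card ≤ (B₂.filter fun u => 0 < n u).card)
    (hM₂ : (B₂.filter fun u => 0 < n u).card < (entrance B₂ ι₂ j₂).card) :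
    ∃ ν η z z', N.IsOdometer A v c ν ∧ PathFiring k j z z' (N.outflow A (g j) ν) η ∧
      (∀ t, 0 ≤ η t) ∧ 0 < η j ∧ η 1 + η (k - 1) = 1 ∧ HasState N k g c z ∧
      HasState N k₂ g₂ c j₂ ∧
      (B₂.filter fun u => 0 < n u) = B.filter fun u => 0 < η (ι u) := by
  have hn0 := hn.nonneg hc
  have hp0 : n p = 0 := by
    refine le_antisymm (not_lt.1 fun hpos => ?_) (hn0 p)
    have h1 := hn.pos_of_pos hc (S := entrance B₂ ι₂ j₂) (Finset.filter_subset _ _)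
      (fun u hu hup => h₂.deg_entrance hu hup) (x := g₂ j₂) (by rw [hp]; exact hpos)
    have h2 : entrance B₂ ι₂ j₂ ⊆ B₂.filter fun u => 0 < n u := fun u hu =>
      Finset.mem_filter.2 ⟨(Finset.mem_filter.1 hu).1, h1 u hu⟩
    have := Finset.card_le_card h2
    omega
  have hnB := hn.support_subset h.pendant (h.subset hv) hc hp0
  have hnodo := hn.restrict h₂.subset hnB
  have hcB := hc.subset h₂.subset
  have hj : 0 < n (g j) := by
    refine lt_of_le_of_ne (hn0 _) fun hq => ?_
    have h1 := hn.support_subset h.pendant_inner hv hc hq.symm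
    have h2 : (B₂.filter fun u => 0 < n u) ⊂ entrance B ι j := by
      refine (Finset.ssubset_iff_of_subset fun u hu => ?_).2 ⟨g j, h.g_mem_entrance, ?_⟩
      · have huA : u ∈ A := by
          by_contra hcon
          have := (Finset.mem_filter.1 hu).2
          rw [h1 u hcon] at this
          exact lt_irrefl _ this
        exact Finset.mem_filter.2 ⟨h.subset huA, h.ι_inner u huA⟩
      · rw [Finset.mem_filter, ← hq]
        exact fun h => lt_irrefl _ h.2
    have := Finset.card_lt_card h2
    omega
  obtain ⟨z, hz⟩ := h.exists_hasState hcB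
  obtain ⟨z₂, hz₂⟩ := h₂.exists_hasState hc
  obtain ⟨ν, η, z', hν, hη, hneq, hηn⟩ := h.exists_decomposition hv hcB hnodo hz
  have hη0 : ∀ t, 0 ≤ η t := fun t => by rw [hηn]; exact hn0 _
  have hηj : 0 < η j := by rw [hηn]; exact hj
  have hout : N.outflow B p n = η 1 + η (k - 1) := by
    rw [hneq, h.outflow_lift_add hν.support]
  -- Stability of the exit `p`, which is not fired, bounds the number of chips it receives.
  have hpB₂ : p ∈ B₂ := hp ▸ h₂.g_mem j₂ h₂.pos h₂.lt
  have hst := hn.recurrent.stable p hpB₂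
  have hpv : p ≠ v := fun hpv => h.pendant.notMem (hpv ▸ h.subset hv)
  rw [if_neg hpv, lap_eq_of_support h₂.subset (fun u _ hu => hnB u hu), lap, hp0, zero_mul,
    zero_sub] at hst
  change c p + 0 - -(N.outflow B p n) < _ at hst
  have hcp := hz₂.2 j₂ h₂.pos h₂.lt
  rw [hp] at hcp
  rw [hcp, hout] at hst
  have hη1 := hη0 1
  have hηk := hη0 (k - 1)
  have hjk := h.lt
  have hpos : 1 ≤ η 1 + η (k - 1) := by
    rcases hη.support_eq h.pos h.lt hη0 hηj (by split_ifs at hst <;> omega) with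
      ⟨h1, h2, h3⟩ | ⟨h1, h2, h3⟩
    · have := (h3 1 one_pos (by omega)).2 (by have := h.pos; omega)
      omega
    · have := (h3 (k - 1) (by omega) (by omega)).2 (by omega)
      omega
  have hz₂j : j₂ = z₂ := by
    by_contra hne
    rw [if_neg hne] at hst
    omega
  refine ⟨ν, η, z, z', hν, hη, hη0, hηj, by split_ifs at hst <;> omega, hz, hz₂j ▸ hz₂, ?_⟩
  have := h.filter_pos_eq h₂.subset hηj (hν.nonneg (hcB.subset h.subset)) hν.support
  rw [← this]
  simp only [hneq]

/-- The pair of states of two consecutive cycles is uniformly distributed. -/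
lemma ncard_states (h : N.CycleBlock A B p k j g ι) (h₂ : N.CycleBlock B B₂ p₂ k₂ j₂ g₂ ι₂)
    {Q : (V → ℤ) → Prop} (hQ : ∀ c c', (∀ u ∈ A, c u = c' u) → Q c → Q c') {Z : Finset (ℕ × ℕ)}
    (hZ : Z ⊆ Finset.range k ×ˢ Finset.range k₂) :
    {c ∈ N.recurrents B₂ | Q c ∧ (state N k g c, state N k₂ g₂ c) ∈ Z}.ncard * (k * k₂)
      = Z.card * {c ∈ N.recurrents B₂ | Q c}.ncard := by
  have hmem : ∀ {z : ℕ × ℕ}, z ∈ ((Finset.range k ×ˢ Finset.range k₂ : Finset (ℕ × ℕ)) :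
      Set (ℕ × ℕ)) → z.1 < k ∧ z.2 < k₂ := fun hz => by simpa using hz
  have hstate₂ : ∀ c z, HasState N k₂ g₂ c z → ∀ z', HasState N k₂ g₂ (setState N B g ι c z') z :=
    fun c z hz z' => ⟨hz.1, fun t ht htk => by
      rw [setState_eq_of_notMem (h₂.g_notMem t ht htk), hz.2 t ht htk]⟩
  have := ncard_mul_ncard_resample (R := {c ∈ N.recurrents B₂ | Q c})
    (R' := ((Finset.range k ×ˢ Finset.range k₂ : Finset (ℕ × ℕ)) : Set (ℕ × ℕ))) (E := Z)
    (fun c => (state N k g c, state N k₂ g₂ c))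
    (fun c z => setState N B g ι (setState N B₂ g₂ ι₂ c z.2) z.1)
    (by exact_mod_cast hZ)
    (fun c hc => by
      have h1 := (h.hasState_state h₂.subset hc.1).1
      have h2 := (h₂.hasState_state subset_rfl hc.1).1
      simpa using ⟨h1, h2⟩)
    (fun c hc z hz => ⟨h.setState_mem_recurrents h₂.subset
        (h₂.setState_mem_recurrents subset_rfl hc.1 (hmem hz).2) (hmem hz).1,
      hQ _ _ (fun u hu => by
        rw [h.setState_eq_of_mem hu, h₂.setState_eq_of_mem (h.subset hu)]) hc.2⟩)
    (fun c hc z hz => by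
      refine Prod.ext (h.hasState_setState _ (hmem hz).1).state_eq ?_
      exact (hstate₂ _ _ (h₂.hasState_setState c (hmem hz).2) _).state_eq)
    (fun c hc z hz => by
      have h1 := h.hasState_state h₂.subset hc.1
      have h2 := h₂.hasState_state subset_rfl hc.1
      funext u
      simp only
      by_cases hu : u ∈ B
      · rw [← congrFun (h.setState_eq_self h1) u]
        simp only [setState, hu, true_and]
        by_cases hug : u = g (ι u)
        · simp only [← hug, if_true]
        · have hu2 : ¬ (u ∈ B₂ ∧ u = g₂ (ι₂ u)) := fun hh =>
            h₂.g_notMem _ (h₂.ι_pos u hh.1) (h₂.ι_lt u hh.1) (hh.2 ▸ hu)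
          simp only [hug, hu2, if_false]
      · rw [setState_eq_of_notMem hu, ← congrFun (h₂.setState_eq_self h2) u]
        simp only [setState]
        split_ifs <;> first | rfl | (exfalso; tauto) )
  rw [Set.ncard_coe_finset, Set.ncard_coe_finset, Finset.card_product, Finset.card_range,
    Finset.card_range] at this
  rw [← this]
  congr 2
  ext c
  simp [and_assoc]

/-- A mass between the sizes of two consecutive entrances allows two states of the first cycle and
one of the second. -/
lemma ncard_massIs_mul_le (h : N.CycleBlock A B p k j g ι)
    (h₂ : N.CycleBlock B B₂ p₂ k₂ j₂ g₂ ι₂) (hp : g₂ j₂ = p) (hv : v ∈ A) {M : ℕ}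
    (hM₁ : (entrance B ι j).card ≤ M) (hM₂ : M < (entrance B₂ ι₂ j₂).card) :
    {c ∈ N.recurrents B₂ | N.MassIs B₂ v c M}.ncard * (k * k₂)
      ≤ 2 * (N.recurrents B₂).ncard := by
  -- The mass determines the vacant site of the first cycle, up to the side of the entrance.
  set Z₁ := (Finset.range k).filter fun z => (B.filter fun u => ι u < z).card = M ∧ 0 < z
  set Z₂ := (Finset.range k).filter fun z => (B.filter fun u => z < ι u).card = M
  have mem₁ : ∀ {z}, z ∈ Z₁ ↔ z < k ∧ (B.filter fun u => ι u < z).card = M ∧ 0 < z := by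
    intro z; simp [Z₁]
  have mem₂ : ∀ {z}, z ∈ Z₂ ↔ z < k ∧ (B.filter fun u => z < ι u).card = M := by
    intro z; simp [Z₂]
  have hc₁ : Z₁.card ≤ 1 := by
    refine Finset.card_le_one.2 fun z hz z' hz' => ?_
    by_contra hne
    wlog hlt : z < z' generalizing z z'
    · exact this z' hz' z hz (Ne.symm hne) (by omega)
    obtain ⟨hzk, hzM, hz0⟩ := mem₁.1 hz
    obtain ⟨hzk', hzM', hz0'⟩ := mem₁.1 hz'
    have : (B.filter fun u => ι u < z) ⊂ B.filter fun u => ι u < z' := by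
      refine (Finset.ssubset_iff_of_subset
        (Finset.monotone_filter_right _ fun u _ hu => lt_trans hu hlt)).2 ⟨g z, ?_, ?_⟩
      · simp [h.g_mem z hz0 hzk, h.ι_g z hz0 hzk, hlt]
      · simp [h.ι_g z hz0 hzk]
    have := Finset.card_lt_card this
    omega
  have hc₂ : Z₂.card ≤ 1 := by
    refine Finset.card_le_one.2 fun z hz z' hz' => ?_
    by_contra hne
    wlog hlt : z < z' generalizing z z'
    · exact this z' hz' z hz (Ne.symm hne) (by omega)
    obtain ⟨hzk, hzM⟩ := mem₂.1 hz
    obtain ⟨hzk', hzM'⟩ := mem₂.1 hz'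
    have : (B.filter fun u => z' < ι u) ⊂ B.filter fun u => z < ι u := by
      refine (Finset.ssubset_iff_of_subset
        (Finset.monotone_filter_right _ fun u _ hu => lt_trans hlt hu)).2 ⟨g z', ?_, ?_⟩
      · simp [h.g_mem z' (by omega) hzk', h.ι_g z' (by omega) hzk', hlt]
      · simp [h.ι_g z' (by omega) hzk']
    have := Finset.card_lt_card this
    omega
  have hsub : {c ∈ N.recurrents B₂ | N.MassIs B₂ v c M} ⊆ {c ∈ N.recurrents B₂ | True ∧
      (state N k g c, state N k₂ g₂ c) ∈ (Z₁ ∪ Z₂) ×ˢ {j₂}} := by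
    rintro c ⟨hc, n, hn, rfl⟩
    obtain ⟨ν, η, z, z', hν, hη, hη0, hηj, hout, hz, hz₂, hsupp⟩ :=
      mass_structure h h₂ hp hv hc.2 hn hM₁ hM₂
    refine ⟨hc, trivial, ?_⟩
    rw [hz.state_eq, hz₂.state_eq, Finset.mem_product, Finset.mem_union, mem₁, mem₂, hsupp]
    refine ⟨?_, by simp⟩
    rcases hη.support_eq h.pos h.lt hη0 hηj hout.le with ⟨h1, h2, h3⟩ | ⟨h1, h2, h3⟩
    · refine Or.inl ⟨h2, ?_, by omega⟩
      congr 1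
      exact Finset.filter_congr fun u hu => (h3 _ (h.ι_pos u hu) (h.ι_lt u hu)).symm
    · refine Or.inr ⟨hz.1, ?_⟩
      congr 1
      exact Finset.filter_congr fun u hu => (h3 _ (h.ι_pos u hu) (h.ι_lt u hu)).symm
  have hle := Set.ncard_le_ncard hsub (finite_recurrents.subset fun c hc => hc.1)
  have hZ : (Z₁ ∪ Z₂) ×ˢ {j₂} ⊆ Finset.range k ×ˢ Finset.range k₂ := by
    refine Finset.product_subset_product (Finset.union_subset (Finset.filter_subset _ _)
      (Finset.filter_subset _ _)) ?_
    simpa using h₂.lt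
  have hcount := ncard_states h h₂ (Q := fun _ => True) (fun _ _ _ _ => trivial) hZ
  have hZc : ((Z₁ ∪ Z₂) ×ˢ {j₂}).card ≤ 2 := by
    rw [Finset.card_product, Finset.card_singleton, mul_one]
    have := Finset.card_union_le Z₁ Z₂
    omega
  have e : {c ∈ N.recurrents B₂ | True} = N.recurrents B₂ := by ext; simp
  rw [e] at hcount
  calc _ ≤ _ := Nat.mul_le_mul_right _ hle
    _ = _ := hcount
    _ ≤ _ := Nat.mul_le_mul_right _ hZc

/-- If a mass between the sizes of two consecutive entrances occurs, then for some `τ ≤ 2` it occurs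
for one pair of states of the two cycles whatever the configuration that sends `τ` chips to the first
entrance. -/
lemma exists_ncard_outflows_le (h : N.CycleBlock A B p k j g ι)
    (h₂ : N.CycleBlock B B₂ p₂ k₂ j₂ g₂ ι₂) (hp : g₂ j₂ = p) (hv : v ∈ A) {M : ℕ}
    (hM₁ : (entrance B ι j).card ≤ M) (hM₂ : M < (entrance B₂ ι₂ j₂).card) {c : V → ℤ}
    (hc : c ∈ N.recurrents B₂) (hcM : N.MassIs B₂ v c M) :
    ∃ τ : ℕ, τ ≤ 2 ∧ N.Outflows A (g j) v τ c ∧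
      {c ∈ N.recurrents B₂ | N.Outflows A (g j) v τ c}.ncard
        ≤ {c ∈ N.recurrents B₂ | N.MassIs B₂ v c M}.ncard * (k * k₂) := by
  obtain ⟨n, hn, rfl⟩ := hcM
  obtain ⟨ν, η, z, z', hν, hη, hη0, hηj, hout, hz, hz₂, hsupp⟩ :=
    mass_structure h h₂ hp hv hc.2 hn hM₁ hM₂
  have hcons := hη.conservation h.pos h.lt hz.1
  have hν0 := hν.nonneg (hc.2.subset (h.subset.trans h₂.subset))
  have hτ0 : 0 ≤ N.outflow A (g j) ν :=
    Finset.sum_nonneg fun u _ => mul_nonneg (by positivity) (hν0 u)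
  obtain ⟨τ, hτ⟩ := Int.eq_ofNat_of_zero_le hτ0
  refine ⟨τ, ?_, ⟨ν, hν, hτ⟩, ?_⟩
  · rw [hτ, hout] at hcons
    split_ifs at hcons <;> omega
  have hZ : ({(z, j₂)} : Finset (ℕ × ℕ)) ⊆ Finset.range k ×ˢ Finset.range k₂ := by
    simpa using ⟨hz.1, h₂.lt⟩
  have hcount := ncard_states h h₂ (Q := N.Outflows A (g j) v τ)
    (fun _ _ hcc hQ => hQ.congr hcc) hZ
  rw [Finset.card_singleton, one_mul] at hcount
  rw [← hcount]
  refine Nat.mul_le_mul_right _ (Set.ncard_le_ncard ?_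
    (finite_recurrents.subset fun c hc => hc.1))
  rintro d ⟨hd, ⟨ν', hν', hτ'⟩, hds⟩
  refine ⟨hd, ?_⟩
  simp only [Finset.mem_singleton, Prod.mk.injEq] at hds
  have hdz := h.hasState_state h₂.subset hd
  have hdz₂ := h₂.hasState_state subset_rfl hd
  rw [hds.1] at hdz
  rw [hds.2] at hdz₂
  rw [hτ, ← hτ'] at hη
  have hodo := h.isOdometer_lift_add hv (hd.2.subset h₂.subset) hν' hdz hη
  have hodo₂ := h₂.isOdometer_lift_add (h.subset hv) hd.2 hodo hdz₂ (z' := 0) (η := fun _ => 0)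
    ⟨by have := h₂.lt; omega, rfl, rfl, fun t ht htk => by
      rw [hp, h.outflow_lift_add hν'.support, hout]
      split_ifs <;> omega⟩
  have hzero : ∀ u, lift B₂ ι₂ (fun _ => (0 : ℤ)) u = 0 := fun u => by simp [lift]
  simp only [hzero, zero_add] at hodo₂
  refine ⟨_, hodo₂, ?_⟩
  rw [hsupp, h.filter_pos_eq h₂.subset hηj
    (hν'.nonneg (hd.2.subset (h.subset.trans h₂.subset))) hν'.support]

end CycleBlock

end Network

section

variable {V E : Type*}

/-! ### Blocks and gates -/

/-- The edges of `Γ` inside `S`, as a graph on all of `V`. -/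
def within (Γ : SimpleGraph V) (S : Set V) : SimpleGraph V where
  Adj u w := Γ.Adj u w ∧ u ∈ S ∧ w ∈ S
  symm := ⟨fun _ _ h => ⟨h.1.symm, h.2.2, h.2.1⟩⟩
  loopless := ⟨fun _ h => h.1.ne rfl⟩

/-- The edges of `Γ` that are not inside `S`. -/
def off (Γ : SimpleGraph V) (S : Set V) : SimpleGraph V where
  Adj u w := Γ.Adj u w ∧ ¬ (u ∈ S ∧ w ∈ S)
  symm := ⟨fun _ _ h => ⟨h.1.symm, fun h' => h.2 h'.symm⟩⟩
  loopless := ⟨fun _ h => h.1.ne rfl⟩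

variable {Γ : SimpleGraph V}

lemma within_mono {S T : Set V} (h : S ⊆ T) : within Γ S ≤ within Γ T :=
  fun _ _ h' => ⟨h'.1, h h'.2.1, h h'.2.2⟩

lemma mem_of_reachable {Δ : SimpleGraph V} {S : Set V} (hS : ∀ a b, Δ.Adj a b → a ∈ S → b ∈ S)
    {u w : V} (h : Δ.Reachable u w) (hu : u ∈ S) : w ∈ S := by
  rw [SimpleGraph.reachable_iff_reflTransGen] at h
  induction h with
  | refl => exact hu
  | tail _ h2 ih => exact hS _ _ h2 ih

lemma eq_of_reachable {Δ : SimpleGraph V} {α : Type*} {f : V → α}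
    (hf : ∀ a b, Δ.Adj a b → f a = f b) {u w : V} (h : Δ.Reachable u w) : f u = f w :=
  (mem_of_reachable (S := {z | f u = f z}) (fun a b hab ha => Eq.trans ha (hf a b hab)) h rfl)

lemma reachable_within {Δ : SimpleGraph V} {S : Set V} (hΔ : Δ ≤ Γ)
    (hS : ∀ a b, Δ.Adj a b → a ∈ S → b ∈ S) {u w : V} (h : Δ.Reachable u w) (hu : u ∈ S) :
    (within Γ S).Reachable u w := by
  refine (mem_of_reachable (S := {z | z ∈ S ∧ (within Γ S).Reachable u z}) ?_ h
    ⟨hu, .rfl⟩).2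
  rintro a b hab ⟨ha, hr⟩
  exact ⟨hS a b hab ha, hr.trans (SimpleGraph.Adj.reachable ⟨hΔ hab, ha, hS a b hab ha⟩)⟩

lemma reachable_induce_iff {S : Set V} {u w : V} (hu : u ∈ S) (hw : w ∈ S) :
    (Γ.induce S).Reachable ⟨u, hu⟩ ⟨w, hw⟩ ↔ (within Γ S).Reachable u w := by
  constructor
  · intro h
    exact h.map (G' := within Γ S) ⟨Subtype.val, fun {a b} hab => ⟨hab, a.2, b.2⟩⟩
  · intro h
    obtain ⟨hw', h'⟩ := mem_of_reachable (Δ := within Γ S)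
      (S := {z | ∃ hz : z ∈ S, (Γ.induce S).Reachable ⟨u, hu⟩ ⟨z, hz⟩}) (by
        rintro a b hab ⟨ha, hr⟩
        exact ⟨hab.2.2, hr.trans (SimpleGraph.Adj.reachable hab.1)⟩) h ⟨hu, .rfl⟩
    exact h'

lemma preconnected_induce_iff {S : Set V} :
    (Γ.induce S).Preconnected ↔ ∀ u ∈ S, ∀ w ∈ S, (within Γ S).Reachable u w :=
  ⟨fun h u hu w hw => (reachable_induce_iff hu hw).1 (h ⟨u, hu⟩ ⟨w, hw⟩),
    fun h u w => (reachable_induce_iff u.2 w.2).2 (h u u.2 w w.2)⟩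

lemma reachable_within_support {u w : V} (P : Γ.Walk u w) :
    (within Γ {z | z ∈ P.support}).Reachable u w := by
  induction P with
  | nil => exact .rfl
  | cons h P ih =>
    refine .trans (SimpleGraph.Adj.reachable ⟨h, by simp, by simp⟩)
      (ih.mono (within_mono fun z hz => ?_))
    exact List.mem_cons_of_mem _ hz

section Block

variable {G : Graph V E} {B B' : Set V}

lemma IsNonseparable.reachable (hB : IsNonseparable G B) (q : V) {u w : V} (hu : u ∈ B)
    (hw : w ∈ B) (huq : u ≠ q) (hwq : w ≠ q) :
    (within (underlying G) (B \ {q})).Reachable u w := by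
  by_cases hq : q ∈ B
  · exact preconnected_induce_iff.1 (hB.2.2 q hq) u ⟨hu, huq⟩ w ⟨hw, hwq⟩
  · rw [Set.sdiff_singleton_eq_self hq]
    exact preconnected_induce_iff.1 hB.2.1.preconnected u hu w hw

lemma isNonseparable_of_reachable (hsub : B ⊆ V(G)) {x : V} (hx : x ∈ B)
    (hconn : ∀ u ∈ B, (within (underlying G) B).Reachable u x)
    (h : ∀ q, ∀ u ∈ B \ {q}, ∀ w ∈ B \ {q},
      (within (underlying G) (B \ {q})).Reachable u w) : IsNonseparable G B := by
  refine ⟨hsub, ?_, fun q _ => preconnected_induce_iff.2 (h q)⟩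
  have : Nonempty B := ⟨⟨x, hx⟩⟩
  exact ⟨preconnected_induce_iff.2 fun u hu w hw => (hconn u hu).trans (hconn w hw).symm⟩

/-- Two distinct blocks share at most one vertex. -/
lemma IsBlock.eq_of_mem (hB : IsBlock G B) (hB' : IsBlock G B') {x y : V} (hxy : x ≠ y)
    (hx : x ∈ B) (hy : y ∈ B) (hx' : x ∈ B') (hy' : y ∈ B') : B = B' := by
  have key : IsNonseparable G (B ∪ B') := by
    refine isNonseparable_of_reachable (Set.union_subset hB.1.1 hB'.1.1) (Or.inl hx) ?_ ?_
    · rintro u (hu | hu)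
      · exact (preconnected_induce_iff.1 hB.1.2.1.preconnected u hu x hx).mono
          (within_mono Set.subset_union_left)
      · exact (preconnected_induce_iff.1 hB'.1.2.1.preconnected u hu x hx').mono
          (within_mono Set.subset_union_right)
    · intro q
      obtain ⟨s, hs, hs', hsq⟩ : ∃ s ∈ B, s ∈ B' ∧ s ≠ q := by
        by_cases h : x = q
        · exact ⟨y, hy, hy', fun h' => hxy (h.trans h'.symm)⟩
        · exact ⟨x, hx, hx', h⟩
      have : ∀ u ∈ (B ∪ B') \ {q},
          (within (underlying G) ((B ∪ B') \ {q})).Reachable u s := by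
        rintro u ⟨hu | hu, huq⟩
        · exact (hB.1.reachable q hu hs huq hsq).mono
            (within_mono (Set.sdiff_subset_sdiff_left Set.subset_union_left))
        · exact (hB'.1.reachable q hu hs' huq hsq).mono
            (within_mono (Set.sdiff_subset_sdiff_left Set.subset_union_right))
      exact fun u hu w hw => (this u hu).trans (this w hw).symm
  exact Set.Subset.antisymm
    (Set.subset_union_left.trans (hB'.2 key Set.subset_union_right))
    (Set.subset_union_right.trans (hB.2 key Set.subset_union_left))

/-- A block contains every path between two of its vertices: adding an ear to a nonseparable
subgraph leaves it nonseparable. -/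
lemma IsBlock.mem_of_isPath (hV : V(G) = Set.univ) (hB : IsBlock G B) {x y : V} (hx : x ∈ B)
    (hy : y ∈ B) {P : (underlying G).Walk x y} (hP : P.IsPath) {z : V} (hz : z ∈ P.support) :
    z ∈ B := by
  set S : Set V := {z | z ∈ P.support}
  refine hB.2 (y := B ∪ S) ?_ Set.subset_union_left (Or.inr hz)
  have htake : ∀ s (hs : s ∈ P.support), (within (underlying G)
      {z | z ∈ (P.takeUntil s hs).support}).Reachable x s := fun s hs => reachable_within_support _
  have hdrop : ∀ s (hs : s ∈ P.support), (within (underlying G)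
      {z | z ∈ (P.dropUntil s hs).support}).Reachable s y := fun s hs => reachable_within_support _
  refine isNonseparable_of_reachable (hV ▸ Set.subset_univ _) (Or.inl hx) ?_ ?_
  · rintro u (hu | hu)
    · exact (preconnected_induce_iff.1 hB.1.2.1.preconnected u hu x hx).mono
        (within_mono Set.subset_union_left)
    · exact (htake u hu).symm.mono (within_mono fun t ht =>
        Or.inr (P.support_takeUntil_subset_support hu ht))
  · intro q
    have : ∀ u ∈ (B ∪ S) \ {q}, ∃ s ∈ B, s ≠ q ∧
        (within (underlying G) ((B ∪ S) \ {q})).Reachable u s := by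
      rintro u ⟨hu | hu, huq⟩
      · exact ⟨u, hu, huq, .rfl⟩
      · by_cases hq : q ∈ (P.takeUntil u hu).support
        · have hq' : q ∉ (P.dropUntil u hu).support := by
            intro hq'
            have hnd := hP.support_nodup
            rw [← P.take_spec hu, SimpleGraph.Walk.support_append] at hnd
            rw [← SimpleGraph.Walk.cons_tail_support, List.mem_cons] at hq'
            rcases hq' with rfl | hq'
            · exact huq rfl
            · exact (List.nodup_append'.1 hnd).2.2 hq hq'
          refine ⟨y, hy, fun h => hq' (h ▸ SimpleGraph.Walk.end_mem_support _),
            (hdrop u hu).mono (within_mono fun t ht => ⟨Or.inr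
              (P.support_dropUntil_subset_support hu ht), fun h => hq' ?_⟩)⟩
          rw [Set.mem_singleton_iff] at h
          exact h ▸ ht
        · refine ⟨x, hx, fun h => hq (h ▸ SimpleGraph.Walk.start_mem_support _),
            (htake u hu).symm.mono (within_mono fun t ht => ⟨Or.inr
              (P.support_takeUntil_subset_support hu ht), fun h => hq ?_⟩)⟩
          rw [Set.mem_singleton_iff] at h
          exact h ▸ ht
    intro u hu w hw
    obtain ⟨s, hs, hsq, h1⟩ := this u hu
    obtain ⟨t, ht, htq, h2⟩ := this w hw
    exact (h1.trans ((hB.1.reachable q hs ht hsq htq).mono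
      (within_mono (Set.sdiff_subset_sdiff_left Set.subset_union_left)))).trans h2.symm

lemma IsBlock.eq_of_reachable_off (hV : V(G) = Set.univ) (hB : IsBlock G B) {x y : V}
    (hx : x ∈ B) (hy : y ∈ B) (h : (off (underlying G) B).Reachable x y) : x = y := by
  obtain ⟨P, hP⟩ := h.exists_isPath
  have hle : off (underlying G) B ≤ underlying G := fun _ _ h => h.1
  have hmem : ∀ z ∈ P.support, z ∈ B := by
    intro z hz
    refine hB.mem_of_isPath hV hx hy (hP.mapLe hle) (z := z) ?_
    rwa [SimpleGraph.Walk.support_mapLe_eq_support]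
  cases P with
  | nil => rfl
  | cons h P => exact absurd ⟨hx, hmem _ (by simp)⟩ h.2

/-- Every vertex is joined to a block by edges outside the block. -/
lemma exists_gate (hV : V(G) = Set.univ) (hG : IsConnected G) (hB : IsBlock G B) (u : V) :
    ∃ x ∈ B, (off (underlying G) B).Reachable u x := by
  obtain ⟨⟨b, hb⟩⟩ := hB.1.2.1.nonempty
  have h : (within (underlying G) Set.univ).Reachable b u :=
    preconnected_induce_iff.1 (hV ▸ hG.preconnected) b (Set.mem_univ b) u (Set.mem_univ u)
  refine mem_of_reachable
    (S := {u | ∃ x ∈ B, (off (underlying G) B).Reachable u x}) ?_ h ⟨b, hb, .rfl⟩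
  rintro a c hac ⟨x, hx, hr⟩
  by_cases hc : c ∈ B
  · exact ⟨c, hc, .rfl⟩
  · exact ⟨x, hx, .trans (SimpleGraph.Adj.reachable ⟨hac.1.symm, fun h => hc h.1⟩) hr⟩

/-- The gate of `u` in the block `B`: the vertex of `B` at which the part of the graph that
contains `u` is attached, i.e. the one joined to `u` by edges outside `B`. -/
noncomputable def gate (G : Graph V E) (B : Set V) (u : V) : V :=
  if h : ∃ x ∈ B, (off (underlying G) B).Reachable u x then h.choose else u

/-- The standing assumptions under which gates are used. -/
structure HasGates (G : Graph V E) (B : Set V) : Prop where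
  vertexSet : V(G) = Set.univ
  connected : IsConnected G
  block : IsBlock G B

namespace HasGates

lemma gate_mem (h : HasGates G B) (u : V) : gate G B u ∈ B := by
  have := exists_gate h.vertexSet h.connected h.block u
  rw [gate, dif_pos this]
  exact this.choose_spec.1

lemma reachable_gate (h : HasGates G B) (u : V) : (off (underlying G) B).Reachable u (gate G B u) := by
  have := exists_gate h.vertexSet h.connected h.block u
  rw [gate, dif_pos this]
  exact this.choose_spec.2

lemma gate_eq (h : HasGates G B) {u x : V} (hx : x ∈ B) (hu : (off (underlying G) B).Reachable u x) :
    gate G B u = x :=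
  h.block.eq_of_reachable_off h.vertexSet (h.gate_mem u) hx ((h.reachable_gate u).symm.trans hu)

lemma gate_of_mem (h : HasGates G B) {u : V} (hu : u ∈ B) : gate G B u = u := h.gate_eq hu .rfl

lemma gate_eq_of_off (h : HasGates G B) {u w : V} (huw : (off (underlying G) B).Adj u w) :
    gate G B u = gate G B w :=
  h.gate_eq (h.gate_mem w) (huw.reachable.trans (h.reachable_gate w))

lemma mem_of_gate_ne (h : HasGates G B) {u w : V} (huw : (underlying G).Adj u w) (hne : gate G B u ≠ gate G B w) :
    u ∈ B ∧ w ∈ B := by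
  by_contra hcon
  exact hne (h.gate_eq_of_off ⟨huw, hcon⟩)

/-- A vertex is joined to its gate through vertices with the same gate. -/
lemma reachable_gate_within (h : HasGates G B) (u : V) :
    (within (underlying G) {w | gate G B w = gate G B u}).Reachable u (gate G B u) :=
  reachable_within (Δ := off (underlying G) B) (fun _ _ h => h.1)
    (fun _ _ hab ha => (h.gate_eq_of_off hab).symm.trans ha) (h.reachable_gate u) rfl

/-- A block shares at most one vertex with `B`, so that it hangs at a single vertex of `B`. -/
lemma gate_eq_of_block (h : HasGates G B) (hB' : IsBlock G B') (hne : B' ≠ B) {u w : V} (hu : u ∈ B')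
    (hw : w ∈ B') : gate G B u = gate G B w := by
  refine eq_of_reachable (Δ := within (underlying G) B') (fun a b hab => ?_)
    (preconnected_induce_iff.1 hB'.1.2.1.preconnected u hu w hw)
  refine h.gate_eq_of_off ⟨hab.1, fun hmem => hne ?_⟩
  exact hB'.eq_of_mem h.block hab.1.ne hab.2.1 hab.2.2 hmem.1 hmem.2

end HasGates

end Block

end

section

variable {V E : Type*}

/-! ### The infinite block-path -/

/-- A connected graph on all of `V` with an infinite block-path. -/
structure BlockChain (G : Graph V E) (v : V) (C : ℕ → Set V) (p : ℕ → V) : Prop where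
  vertexSet : V(G) = Set.univ
  connected : IsConnected G
  path : IsInfiniteBlockPath G v C p

/-- The vertices that `p i` separates from the rest of the block-path and that do not hang at
`p i` itself: their gate in `C i` is not `p i`. -/
def innerPart (G : Graph V E) (C : ℕ → Set V) (p : ℕ → V) (i : ℕ) : Set V :=
  {u | gate G (C i) u ≠ p i}

/-- The vertices whose gate in `C (i + 1)` is `p i`. This is the vertex set of `D(p i)`, see
`BlockChain.finitePart_eq`. -/
def outerPart (G : Graph V E) (C : ℕ → Set V) (p : ℕ → V) (i : ℕ) : Set V :=
  {u | gate G (C (i + 1)) u = p i}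

namespace BlockChain

variable {G : Graph V E} {v : V} {C : ℕ → Set V} {p : ℕ → V}

lemma gates (h : BlockChain G v C p) (i : ℕ) : HasGates G (C i) :=
  ⟨h.vertexSet, h.connected, h.path.block i⟩

lemma cut_mem (h : BlockChain G v C p) (i : ℕ) : p i ∈ C i ∧ p i ∈ C (i + 1) := by
  have : p i ∈ C i ∩ C (i + 1) := by rw [h.path.inter]; rfl
  exact this

lemma gate_cut (h : BlockChain G v C p) (i : ℕ) : gate G (C i) (p i) = p i :=
  (h.gates i).gate_of_mem (h.cut_mem i).1

lemma gate_cut_succ (h : BlockChain G v C p) (i : ℕ) : gate G (C (i + 1)) (p i) = p i :=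
  (h.gates _).gate_of_mem (h.cut_mem i).2

lemma gate_block (h : BlockChain G v C p) {i j : ℕ} (hij : j ≠ i) {u w : V} (hu : u ∈ C j)
    (hw : w ∈ C j) : gate G (C i) u = gate G (C i) w :=
  (h.gates i).gate_eq_of_block (h.path.block j) (fun hc => hij (h.path.injective_block hc)) hu hw

lemma gate_of_lt (h : BlockChain G v C p) {i j : ℕ} (hij : i < j) {u : V} (hu : u ∈ C j) :
    gate G (C i) u = p i := by
  induction j, hij using Nat.le_induction generalizing u with
  | base => rw [h.gate_block (Nat.succ_ne_self i) hu (h.cut_mem i).2, h.gate_cut]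
  | succ j hj ih =>
    rw [h.gate_block (by omega) hu (h.cut_mem j).2, ih (h.cut_mem j).1]

lemma gate_succ_of_le (h : BlockChain G v C p) {i j : ℕ} (hij : j ≤ i) {u : V} (hu : u ∈ C j) :
    gate G (C (i + 1)) u = p i := by
  induction hij using Nat.decreasingInduction generalizing u with
  | self => rw [h.gate_block (by omega) hu (h.cut_mem i).1, h.gate_cut_succ]
  | of_succ j hj ih => rw [h.gate_block (by omega) hu (h.cut_mem j).1, ih (h.cut_mem j).2]

lemma root_mem_innerPart (h : BlockChain G v C p) (i : ℕ) : v ∈ innerPart G C p i := by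
  cases i with
  | zero =>
    change gate G (C 0) v ≠ p 0
    rw [(h.gates 0).gate_of_mem h.path.root_mem]
    rintro rfl
    exact h.path.root_notMem (h.cut_mem 0).2
  | succ i =>
    change gate G (C (i + 1)) v ≠ p (i + 1)
    rw [h.gate_succ_of_le (Nat.zero_le i) h.path.root_mem]
    exact fun hc => absurd (h.path.injective_cut hc) (by omega)

lemma cut_mem_outerPart (h : BlockChain G v C p) (i : ℕ) : p i ∈ outerPart G C p i :=
  h.gate_cut_succ i

lemma cut_notMem_innerPart (h : BlockChain G v C p) (i : ℕ) : p i ∉ innerPart G C p i :=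
  fun hc => hc (h.gate_cut i)

lemma block_subset_outerPart (h : BlockChain G v C p) {i j : ℕ} (hij : j ≤ i) :
    C j ⊆ outerPart G C p i := fun _ hu => h.gate_succ_of_le hij hu

lemma notMem_innerPart_of_mem_block (h : BlockChain G v C p) {i : ℕ} {u : V}
    (hu : u ∈ C (i + 1)) : u ∉ innerPart G C p i :=
  fun hc => hc (h.gate_of_lt (Nat.lt_succ_self i) hu)

lemma innerPart_subset (h : BlockChain G v C p) (i : ℕ) :
    innerPart G C p i ⊆ outerPart G C p i := by
  intro u hu
  have key := mem_of_reachable (Δ := within (underlying G) {w | gate G (C i) w = gate G (C i) u})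
    (S := {w | gate G (C (i + 1)) w = gate G (C (i + 1)) u}) ?_
    ((h.gates i).reachable_gate_within u) rfl
  · exact Eq.trans (Eq.symm key) (h.gate_succ_of_le le_rfl ((h.gates i).gate_mem u))
  · intro a b hab ha
    by_contra hb
    have hne : gate G (C (i + 1)) a ≠ gate G (C (i + 1)) b := fun hc => hb (hc.symm.trans ha)
    have := h.gate_of_lt (Nat.lt_succ_self i) ((h.gates (i + 1)).mem_of_gate_ne hab.1 hne).1
    exact hu (hab.2.1.symm.trans this)

lemma outerPart_subset (h : BlockChain G v C p) (i : ℕ) :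
    outerPart G C p i ⊆ innerPart G C p (i + 1) := by
  intro u hu hc
  exact absurd (h.path.injective_cut (hu.symm.trans hc)) (by omega)

lemma innerPart_mono (h : BlockChain G v C p) : Monotone (innerPart G C p) :=
  monotone_nat_of_le_succ fun i => (h.innerPart_subset i).trans (h.outerPart_subset i)

/-- An edge that leaves `innerPart i` ends at `p i`. -/
lemma eq_cut_of_adj (h : BlockChain G v C p) {i : ℕ} {u w : V} (huw : (underlying G).Adj u w)
    (hu : u ∈ innerPart G C p i) (hw : w ∉ innerPart G C p i) : w = p i := by
  have hw' : gate G (C i) w = p i := not_not.1 hw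
  have := (h.gates i).mem_of_gate_ne huw fun hc => hu (hc.trans hw')
  rw [← hw', (h.gates i).gate_of_mem this.2]

/-- An edge that leaves `outerPart i` starts at `p i`. -/
lemma eq_cut_of_adj_outerPart (h : BlockChain G v C p) {i : ℕ} {u w : V}
    (huw : (underlying G).Adj u w) (hu : u ∈ outerPart G C p i) (hw : w ∉ outerPart G C p i) :
    u = p i := by
  have := (h.gates (i + 1)).mem_of_gate_ne huw fun hc => hw (hc.symm.trans hu)
  rw [← (h.gates (i + 1)).gate_of_mem this.1]
  exact hu

lemma reachable_outerPart (h : BlockChain G v C p) {i : ℕ} {u : V} (hu : u ∈ outerPart G C p i) :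
    (within (underlying G) (outerPart G C p i)).Reachable u (p i) := by
  have := (h.gates (i + 1)).reachable_gate_within u
  have hu' : gate G (C (i + 1)) u = p i := hu
  rw [hu'] at this
  exact this

lemma connected_outerPart (h : BlockChain G v C p) (i : ℕ) :
    ((underlying G).induce (outerPart G C p i)).Connected := by
  have : Nonempty (outerPart G C p i) := ⟨⟨p i, h.cut_mem_outerPart i⟩⟩
  exact ⟨preconnected_induce_iff.2 fun u hu w hw =>
    (h.reachable_outerPart hu).trans (h.reachable_outerPart hw).symm⟩

lemma reachable_innerPart (h : BlockChain G v C p) {i : ℕ} {u w : V}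
    (hu : u ∈ innerPart G C p i) (hw : w ∈ innerPart G C p i) :
    (within (underlying G) (innerPart G C p i)).Reachable u w := by
  have key : ∀ u ∈ innerPart G C p i,
      (within (underlying G) (innerPart G C p i)).Reachable u (gate G (C i) u) := fun u hu =>
    ((h.gates i).reachable_gate_within u).mono (within_mono fun z hz hc => hu (Eq.trans (Eq.symm hz) hc))
  refine .trans (key u hu) (.trans ?_ (key w hw).symm)
  refine ((h.path.block i).1.reachable (p i) ((h.gates i).gate_mem u) ((h.gates i).gate_mem w)
    hu hw).mono (within_mono fun z hz hc => hz.2 ?_)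
  rwa [(h.gates i).gate_of_mem hz.1] at hc

/-- A finite set that is closed under adjacency, except possibly at one vertex `q`, and that
contains some `p i`, cannot contain the whole tail of the block-path, so that `q` lies on it. -/
lemma exists_eq_cut (h : BlockChain G v C p) {S : Set V} (hS : S.Finite) {q : V}
    (hclosed : ∀ u ∈ S, u ≠ q → ∀ w, w ≠ q → (underlying G).Adj u w → w ∈ S) {i : ℕ}
    (hi : p i ∈ S) : ∃ m, i ≤ m ∧ q = p m := by
  by_contra! hcon
  have key : ∀ m, i ≤ m → p m ∈ S := by
    intro m hm
    induction m, hm using Nat.le_induction with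
    | base => exact hi
    | succ m hm ih =>
      refine mem_of_reachable (fun a b hab ha => ?_)
        ((h.path.block (m + 1)).1.reachable q (h.cut_mem m).2 (h.cut_mem (m + 1)).1
          (hcon m hm).symm (hcon (m + 1) (by omega)).symm) ih
      exact hclosed a ha hab.2.1.2 b hab.2.2.2 hab.1
  refine Set.infinite_of_injective_forall_mem (f := fun m => p (i + m)) ?_
    (fun m => key (i + m) (by omega)) hS
  intro a b hab
  have := h.path.injective_cut hab
  omega

/-! ### Finiteness -/

/-- A finite subgraph with a single boundary vertex `q` which contains `p i` ends at a later cut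
vertex `q = p m` of the block-path, and contains everything that `p m` cuts off. -/
lemma exists_boundary (h : BlockChain G v C p) {S : Set V} (hS : S.Finite) {q : V}
    (hq : ∀ u ∈ S, ∀ w, w ∉ S → (underlying G).Adj u w → u = q) (hv : v ∈ S) {i : ℕ}
    (hi : p i ∈ S) : ∃ m, i ≤ m ∧ q = p m ∧ innerPart G C p m ⊆ S := by
  obtain ⟨m, him, rfl⟩ := h.exists_eq_cut hS (q := q)
    (fun u hu huq w _ huw => by_contra fun hw => huq (hq u hu w hw huw)) hi
  refine ⟨m, him, rfl, fun u hu => ?_⟩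
  refine mem_of_reachable (fun a b hab ha => ?_)
    (h.reachable_innerPart (h.root_mem_innerPart m) hu) hv
  by_contra hb
  have := hq a ha b hb hab.1
  exact h.cut_notMem_innerPart m (this ▸ hab.2.1)

/-- A block-path along which every `p i` cuts off a finite part. -/
structure IsFinitary (G : Graph V E) (v : V) (C : ℕ → Set V) (p : ℕ → V) : Prop
    extends BlockChain G v C p where
  finite_innerPart : ∀ i, (innerPart G C p i).Finite

lemma IsFinitary.finite_outerPart (h : IsFinitary G v C p) (i : ℕ) :
    (outerPart G C p i).Finite :=
  (h.finite_innerPart (i + 1)).subset (h.outerPart_subset i)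

lemma IsFinitary.finitePart_eq (h : IsFinitary G v C p) (i : ℕ) :
    finitePart G (p i) = outerPart G C p i := by
  ext w
  constructor
  · rintro (rfl | ⟨K, hK, hwK⟩)
    · exact h.cut_mem_outerPart i
    by_contra hw
    have hclosed : ∀ u ∈ (K : Set V), u ≠ p i → ∀ w, w ≠ p i → (underlying G).Adj u w →
        w ∈ (K : Set V) := fun u hu _ w hw huw =>
      SimpleGraph.ComponentCompl.mem_of_adj u w hu (by simpa using hw) huw
    have hadj : ∀ {S : Set V}, p i ∉ S → ∀ a b, (within (underlying G) S).Adj a b →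
        a ∈ (K : Set V) → b ∈ (K : Set V) := fun hS a b hab ha =>
      hclosed a ha (fun hc => hS (hc ▸ hab.2.1)) b (fun hc => hS (hc ▸ hab.2.2)) hab.1
    have h1 : gate G (C (i + 1)) w ∈ (K : Set V) :=
      mem_of_reachable (hadj fun hc => hw (Eq.trans (Eq.symm hc) (h.gate_cut_succ i)))
        ((h.gates (i + 1)).reachable_gate_within w) hwK
    have h2 : p (i + 1) ∈ (K : Set V) :=
      mem_of_reachable (hadj fun hc => hc.2 rfl)
        ((h.path.block (i + 1)).1.reachable (p i) ((h.gates (i + 1)).gate_mem w)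
          (h.cut_mem (i + 1)).1 hw
          (fun hc => absurd (h.path.injective_cut hc) (by omega))) h1
    obtain ⟨m, hm, hpm⟩ := h.exists_eq_cut hK hclosed h2
    exact absurd (h.path.injective_cut hpm) (by omega)
  · intro hw
    by_cases hwp : w = p i
    · exact Or.inl hwp
    refine Or.inr ⟨(underlying G).componentComplMk (K := {p i}) (v := w) (by simpa using hwp),
      (h.finite_outerPart i).subset fun z hz => ?_,
      SimpleGraph.componentComplMk_mem _ _⟩
    obtain ⟨hz', hzK⟩ := SimpleGraph.ComponentCompl.mem_supp_iff.1 hz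
    have hr := (SimpleGraph.ConnectedComponent.exact hzK).symm
    rw [reachable_induce_iff] at hr
    refine mem_of_reachable (fun a b hab ha => ?_) hr hw
    by_contra hb
    exact hab.2.1 (h.eq_cut_of_adj_outerPart hab.1 ha hb)

end BlockChain

end

section

variable {V E : Type*}

/-! ### Cycles and diameters -/

section Diameter

variable {G : Graph V E} {B : Set V}

/-- The values of a function that increases by at most one along each edge differ by at most the
diameter. -/
lemma le_add_spanDiam (hB : B.Finite) (hconn : ((underlying G).induce B).Connected) {f : V → ℕ}
    (hf : ∀ a ∈ B, ∀ b ∈ B, (underlying G).Adj a b → f b ≤ f a + 1) {a b : V} (ha : a ∈ B)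
    (hb : b ∈ B) : f b ≤ f a + spanDiam G B := by
  have : Finite B := hB
  have : Nonempty B := ⟨⟨a, ha⟩⟩
  have key : ∀ {x y : B} (P : ((underlying G).induce B).Walk x y), f y ≤ f x + P.length := by
    intro x y P
    induction P with
    | nil => simp
    | @cons x z y h P ih =>
      have := hf x x.2 z z.2 h
      rw [SimpleGraph.Walk.length_cons]
      omega
  obtain ⟨P, hP⟩ := hconn.exists_walk_length_eq_dist ⟨a, ha⟩ ⟨b, hb⟩
  have h1 := key P
  have h2 : ((underlying G).induce B).dist ⟨a, ha⟩ ⟨b, hb⟩ ≤ spanDiam G B :=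
    SimpleGraph.dist_le_diam (SimpleGraph.connected_iff_ediam_ne_top.1 hconn)
  simp only at h1
  omega

end Diameter

/-- A parametrization `g 0 = b, g 1, …, g (k - 1), g k = b` of a cycle with vertex set `B`, and the
inverse `κ`. -/
structure CycleCoord (G : Graph V E) (B : Set V) (b : V) (k : ℕ) (g : ℕ → V) (κ : V → ℕ) :
    Prop where
  g_zero : g 0 = b
  g_last : g k = b
  g_mem : ∀ t, g t ∈ B
  κ_lt : ∀ u ∈ B, κ u < k
  g_κ : ∀ u ∈ B, g (κ u) = u
  κ_g : ∀ t, t < k → κ (g t) = t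
  mult_eq : ∀ s t, 0 < s → g s ≠ g t →
    mult G (g s) (g t) = (if g t = g (s + 1) then 1 else 0) + (if g t = g (s - 1) then 1 else 0)

lemma IsCycle.exists_coord {G : Graph V E} {B : Set V} (hB : IsCycle G B) {b : V} (hb : b ∈ B) :
    ∃ g κ, CycleCoord G B b B.ncard g κ := by
  obtain ⟨k, hk, f, hf, rfl, hmult⟩ := hB
  obtain ⟨a, rfl⟩ := hb
  have : NeZero k := ⟨by omega⟩
  have hcard : (Set.range f).ncard = k := by
    rw [Set.ncard_range_of_injective hf, Nat.card_zmod]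
  rw [hcard]
  have hinv : ∀ i, Function.invFun f (f i) = i := Function.leftInverse_invFun hf
  refine ⟨fun t => f (a + t), fun u => (Function.invFun f u - a).val, ?_, ?_, ?_, ?_, ?_, ?_, ?_⟩
  · simp
  · simp
  · exact fun t => ⟨_, rfl⟩
  · exact fun u _ => ZMod.val_lt _
  · rintro _ ⟨i, rfl⟩
    simp [hinv]
  · intro t ht
    simp only [hinv, add_sub_cancel_left]
    exact ZMod.val_cast_of_lt ht
  · intro s t hs hst
    rw [hmult _ _ fun h => hst (by simp only [h])]
    obtain ⟨s, rfl⟩ := Nat.exists_eq_succ_of_ne_zero hs.ne'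
    simp only [hf.eq_iff, Nat.succ_eq_add_one, Nat.add_sub_cancel]
    congr 2
    · push_cast
      simp only [add_assoc]
    · push_cast
      rw [← add_assoc, add_left_inj]
      exact propext eq_comm

namespace CycleCoord

variable {G : Graph V E} {B : Set V} {b : V} {k : ℕ} {g : ℕ → V} {κ : V → ℕ}

lemma κ_base (h : CycleCoord G B b k g κ) : κ b = 0 := by
  have := h.κ_lt b (h.g_zero ▸ h.g_mem 0)
  rw [← h.g_zero]
  exact h.κ_g 0 (by omega)

lemma κ_pos (h : CycleCoord G B b k g κ) {u : V} (hu : u ∈ B) (hub : u ≠ b) : 0 < κ u := by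
  refine Nat.pos_of_ne_zero fun h0 => hub ?_
  rw [← h.g_κ u hu, h0, h.g_zero]

lemma κ_adj (h : CycleCoord G B b k g κ) (hfin : IsLocallyFinite G) {u w : V} (hu : u ∈ B)
    (hw : w ∈ B) (huw : (underlying G).Adj u w) :
    κ w = κ u + 1 ∨ κ u = κ w + 1 ∨ (κ u = 0 ∧ κ w + 1 = k) ∨ (κ w = 0 ∧ κ u + 1 = k) := by
  have key : ∀ u ∈ B, ∀ w ∈ B, (underlying G).Adj u w → 0 < κ u →
      κ w = κ u + 1 ∨ κ u = κ w + 1 ∨ (κ w = 0 ∧ κ u + 1 = k) := by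
    intro u hu w hw huw h0
    have h1 : 1 ≤ mult G u w := by
      have := one_le_network_weight hfin huw.1 huw.2
      simpa only [network, huw.1, if_false] using this
    have h2 := h.mult_eq (κ u) (κ w) h0 (by rw [h.g_κ u hu, h.g_κ w hw]; exact huw.1)
    rw [h.g_κ u hu, h.g_κ w hw] at h2
    have hlt := h.κ_lt u hu
    by_cases e1 : w = g (κ u + 1)
    · by_cases e : κ u + 1 < k
      · left
        rw [e1, h.κ_g _ e]
      · right; right
        have e' : κ u + 1 = k := by omega
        rw [e1, e', h.g_last, h.κ_base]
        exact ⟨rfl, rfl⟩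
    · by_cases e2 : w = g (κ u - 1)
      · right; left
        rw [e2, h.κ_g _ (by omega)]
        omega
      · rw [if_neg e1, if_neg e2] at h2
        omega
  by_cases h0 : 0 < κ u
  · have := key u hu w hw huw h0
    omega
  · have hw0 : 0 < κ w := by
      refine Nat.pos_of_ne_zero fun hw0 => huw.1 ?_
      rw [← h.g_κ u hu, ← h.g_κ w hw, hw0, Nat.eq_zero_of_not_pos h0]
    have := key w hw u hu huw.symm hw0
    omega

end CycleCoord

namespace BlockChain

variable {G : Graph V E} {v : V} {C : ℕ → Set V} {p : ℕ → V}

lemma lt_spanDiam_outerPart (h : IsFinitary G v C p) (i : ℕ) :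
    i < spanDiam G (outerPart G C p i) := by
  -- The number of parts `innerPart j`, `j ≤ i`, that do not contain `u` varies by at most one
  -- along each edge: an edge leaves `innerPart j` only towards `p j`.
  have := le_add_spanDiam (h.finite_outerPart i) (h.connected_outerPart i)
    (f := fun u => ((Finset.range (i + 1)).filter fun j => u ∉ innerPart G C p j).card) ?_
    (h.innerPart_subset i (h.root_mem_innerPart i)) (h.cut_mem_outerPart i)
  · have e1 : ((Finset.range (i + 1)).filter fun j => v ∉ innerPart G C p j) = ∅ :=
      Finset.filter_eq_empty_iff.2 fun j _ => not_not.2 (h.root_mem_innerPart j)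
    have e2 : ((Finset.range (i + 1)).filter fun j => p i ∉ innerPart G C p j)
        = Finset.range (i + 1) := by
      refine Finset.filter_eq_self.2 fun j hj hc => ?_
      exact h.cut_notMem_innerPart i (h.innerPart_mono (Nat.lt_succ_iff.1 (Finset.mem_range.1 hj)) hc)
    simp only [e1, e2, Finset.card_empty, Finset.card_range] at this
    omega
  · intro a _ b _ hab
    have hsub : ((Finset.range (i + 1)).filter fun j => b ∉ innerPart G C p j) ⊆
        ((Finset.range (i + 1)).filter fun j => a ∉ innerPart G C p j) ∪
          (Finset.range (i + 1)).filter fun j => b = p j := by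
      intro j hj
      rw [Finset.mem_filter] at hj
      rw [Finset.mem_union, Finset.mem_filter, Finset.mem_filter]
      by_cases ha : a ∈ innerPart G C p j
      · exact Or.inr ⟨hj.1, h.eq_cut_of_adj hab ha hj.2⟩
      · exact Or.inl ⟨hj.1, ha⟩
    have hone : ((Finset.range (i + 1)).filter fun j => b = p j).card ≤ 1 := by
      refine Finset.card_le_one.2 fun j hj l hl => h.path.injective_cut ?_
      exact (Finset.mem_filter.1 hj).2.symm.trans (Finset.mem_filter.1 hl).2
    exact (Finset.card_le_card hsub).trans ((Finset.card_union_le _ _).trans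
      (Nat.add_le_add_left hone _))

lemma ncard_block_le (h : IsFinitary G v C p) (hfin : IsLocallyFinite G) {i : ℕ}
    (hcyc : IsCycle G (C i)) : (C i).ncard ≤ 2 * spanDiam G (outerPart G C p i) + 1 := by
  obtain ⟨g, κ, hc⟩ := hcyc.exists_coord (h.cut_mem i).1
  set k := (C i).ncard
  have hk : 0 < k := (Nat.zero_le _).trans_lt (hc.κ_lt _ (h.cut_mem i).1)
  -- The distance to `p i` in the cycle of the gate.
  have := le_add_spanDiam (h.finite_outerPart i) (h.connected_outerPart i)
    (f := fun u => min (κ (gate G (C i) u)) (k - κ (gate G (C i) u))) ?_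
    (h.cut_mem_outerPart i) (h.block_subset_outerPart le_rfl (hc.g_mem (k / 2)))
  · simp only [h.gate_cut, hc.κ_base, (h.gates i).gate_of_mem (hc.g_mem _),
      hc.κ_g (k / 2) (by omega)] at this
    omega
  · intro a _ b _ hab
    by_cases hne : gate G (C i) a = gate G (C i) b
    · rw [hne]; omega
    · obtain ⟨ha, hb⟩ := (h.gates i).mem_of_gate_ne hab hne
      rw [(h.gates i).gate_of_mem ha, (h.gates i).gate_of_mem hb]
      have := hc.κ_adj hfin ha hb hab
      have h1 := hc.κ_lt a ha
      have h2 := hc.κ_lt b hb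
      omega

/-! ### The blocks of the path as cycle blocks -/

/-- `innerPart` as a finite set. -/
noncomputable def IsFinitary.inner (h : IsFinitary G v C p) (i : ℕ) : Finset V :=
  (h.finite_innerPart i).toFinset

/-- `outerPart` as a finite set. -/
noncomputable def IsFinitary.outer (h : IsFinitary G v C p) (i : ℕ) : Finset V :=
  (h.finite_outerPart i).toFinset

lemma IsFinitary.mem_inner (h : IsFinitary G v C p) {i : ℕ} {u : V} :
    u ∈ h.inner i ↔ gate G (C i) u ≠ p i := by
  rw [IsFinitary.inner, Set.Finite.mem_toFinset]
  rfl

lemma IsFinitary.mem_outer (h : IsFinitary G v C p) {i : ℕ} {u : V} :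
    u ∈ h.outer i ↔ gate G (C (i + 1)) u = p i := by
  rw [IsFinitary.outer, Set.Finite.mem_toFinset]
  rfl

lemma IsFinitary.isPendant (h : IsFinitary G v C p) (hfin : IsLocallyFinite G) (i : ℕ) :
    (network G hfin).IsPendant (h.inner i) (p i) := by
  refine ⟨fun hc => h.mem_inner.1 hc (h.gate_cut i), fun u hu => network_deg_eq hfin
    (Finset.mem_insert_of_mem hu) fun w hw => ?_⟩
  rw [Finset.mem_insert]
  by_cases hwi : w ∈ h.inner i
  · exact Or.inr hwi
  · refine Or.inl (h.eq_cut_of_adj (u := u) ⟨?_, hw⟩ (h.mem_inner.1 hu)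
      fun hc => hwi (h.mem_inner.2 hc))
    rintro rfl
    exact hwi hu

lemma IsFinitary.deg_outer (h : IsFinitary G v C p) (hfin : IsLocallyFinite G) {i : ℕ} {u : V}
    (hu : u ∈ h.outer i) (hup : u ≠ p i) :
    (network G hfin).deg u = ∑ w ∈ h.outer i, (network G hfin).weight u w := by
  refine network_deg_eq hfin hu fun w hw => ?_
  by_contra hwi
  refine hup (h.eq_cut_of_adj_outerPart (w := w) ⟨?_, hw⟩ (h.mem_outer.1 hu)
    fun hc => hwi (h.mem_outer.2 hc))
  rintro rfl
  exact hwi hu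

lemma IsFinitary.exists_cycleBlock (h : IsFinitary G v C p) (hfin : IsLocallyFinite G) {i : ℕ}
    (hcyc : IsCycle G (C (i + 1))) :
    ∃ j g ι, (network G hfin).CycleBlock (h.inner i) (h.inner (i + 1)) (p (i + 1))
        (C (i + 1)).ncard j g ι ∧ g j = p i ∧
      Network.CycleBlock.entrance (h.inner (i + 1)) ι j = h.outer i := by
  obtain ⟨g, κ, hc⟩ := hcyc.exists_coord (h.cut_mem (i + 1)).1
  have hg := h.gates (i + 1)
  set k := (C (i + 1)).ncard
  have hp : g (κ (p i)) = p i := hc.g_κ _ (h.cut_mem i).2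
  have hne : p i ≠ p (i + 1) := fun hc => absurd (h.path.injective_cut hc) (by omega)
  have hgκ : ∀ u, g (κ (gate G (C (i + 1)) u)) = gate G (C (i + 1)) u :=
    fun u => hc.g_κ _ (hg.gate_mem u)
  have hout : Network.CycleBlock.entrance (h.inner (i + 1)) (fun u => κ (gate G (C (i + 1)) u))
      (κ (p i)) = h.outer i := by
    ext u
    rw [Network.CycleBlock.entrance, Finset.mem_filter, h.mem_outer, h.mem_inner]
    constructor
    · rintro ⟨_, hu⟩
      rw [← hgκ u, hu, hp]
    · intro hu
      rw [hu]
      exact ⟨hne, rfl⟩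
  refine ⟨κ (p i), g, fun u => κ (gate G (C (i + 1)) u), ?_, hp, hout⟩
  refine ⟨hc.κ_pos (h.cut_mem i).2 hne, hc.κ_lt _ (h.cut_mem i).2, h.isPendant hfin (i + 1),
    by rw [hp]; exact h.isPendant hfin i, fun u hu => ?_, fun u hu => ?_, fun u _ => ?_,
    fun u hu => ?_, hc.g_zero, hc.g_last, fun t ht htk => ?_, fun t _ _ hc' => ?_,
    fun t _ htk => ?_, ?_⟩
  · exact h.mem_inner.2 (h.innerPart_mono (Nat.le_succ i) (h.mem_inner.1 hu))
  · exact hc.κ_pos (hg.gate_mem u) (h.mem_inner.1 hu)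
  · exact hc.κ_lt _ (hg.gate_mem u)
  · have : gate G (C (i + 1)) u = p i := h.innerPart_subset i (h.mem_inner.1 hu)
    simp only [this]
  · rw [h.mem_inner, hg.gate_of_mem (hc.g_mem t)]
    intro he
    have := hc.κ_g t htk
    rw [he, hc.κ_base] at this
    omega
  · exact h.notMem_innerPart_of_mem_block (hc.g_mem t) (h.mem_inner.1 hc')
  · rw [hg.gate_of_mem (hc.g_mem t), hc.κ_g t htk]
  · intro u hu w _ hw
    have hgu := h.mem_inner.1 hu
    have hgw : gate G (C (i + 1)) u ≠ gate G (C (i + 1)) w := by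
      rcases hw with rfl | hw
      · rwa [h.gate_cut]
      · exact fun he => hw (by simp only [he])
    have huw : u ≠ w := fun he => hgw (by rw [he])
    have hmem : G.Adj u w → u ∈ C (i + 1) ∧ w ∈ C (i + 1) := fun ha =>
      hg.mem_of_gate_ne ⟨huw, ha⟩ hgw
    simp only [hgκ]
    by_cases hu' : u = gate G (C (i + 1)) u
    · rw [if_pos hu']
      have huC : u ∈ C (i + 1) := hu' ▸ hg.gate_mem u
      rw [hg.gate_of_mem huC] at hgu ⊢
      by_cases hwC : w ∈ C (i + 1)
      · have := hc.mult_eq (κ u) (κ w) (hc.κ_pos huC hgu)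
          (by rwa [hc.g_κ u huC, hc.g_κ w hwC])
        rw [hc.g_κ u huC, hc.g_κ w hwC] at this
        simpa only [network, huw, if_false] using this
      · rw [network_weight_eq_zero hfin huw fun ha => hwC (hmem ha).2, if_neg, if_neg]
        · exact fun he => hwC (he ▸ hc.g_mem _)
        · exact fun he => hwC (he ▸ hc.g_mem _)
    · rw [if_neg hu']
      refine network_weight_eq_zero hfin huw fun ha => hu' ?_
      rw [hg.gate_of_mem (hmem ha).1]

end BlockChain

end

section

variable {V E : Type*}

/-! ### Avalanches in an exhaustion -/

namespace Network

variable {N N' : Network V} {B : Finset V}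

/-- `N` and `N'` have the same degrees and weights at the vertices of `B`. -/
structure AgreeOn (N N' : Network V) (B : Finset V) : Prop where
  deg : ∀ u ∈ B, N.deg u = N'.deg u
  weight : ∀ u ∈ B, ∀ w, N.weight u w = N'.weight u w

namespace AgreeOn

lemma symm (h : N.AgreeOn N' B) : N'.AgreeOn N B :=
  ⟨fun u hu => (h.deg u hu).symm, fun u hu w => (h.weight u hu w).symm⟩

lemma mono {A : Finset V} (h : N.AgreeOn N' B) (hAB : A ⊆ B) : N.AgreeOn N' A :=
  ⟨fun u hu => h.deg u (hAB hu), fun u hu => h.weight u (hAB hu)⟩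

lemma recurrent (h : N.AgreeOn N' B) {c : V → ℤ} (hc : N.Recurrent B c) : N'.Recurrent B c := by
  refine ⟨fun u hu => h.deg u hu ▸ hc.stable u hu, fun F hF hne => ?_⟩
  obtain ⟨u, hu, h1⟩ := hc.noForbidden F hF hne
  refine ⟨u, hu, le_of_eq_of_le (Finset.sum_congr rfl fun w _ => ?_) h1⟩
  rw [h.weight u (hF hu)]

lemma recurrent_iff (h : N.AgreeOn N' B) {c : V → ℤ} : N.Recurrent B c ↔ N'.Recurrent B c :=
  ⟨h.recurrent, h.symm.recurrent⟩

lemma recurrents_eq (h : N.AgreeOn N' B) : N.recurrents B = N'.recurrents B := by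
  ext c
  simp only [recurrents, Set.mem_ofPred_eq, h.recurrent_iff]

lemma massIs (h : N.AgreeOn N' B) {v : V} {c : V → ℤ} {M : ℕ} (hc : N.MassIs B v c M) :
    N'.MassIs B v c M := by
  obtain ⟨n, hn, hM⟩ := hc
  refine ⟨n, ⟨hn.support, h.recurrent (hn.recurrent.congr fun u hu => ?_)⟩, hM⟩
  simp only [lap, h.deg u hu, h.weight u hu]

lemma massIs_iff (h : N.AgreeOn N' B) {v : V} {c : V → ℤ} {M : ℕ} :
    N.MassIs B v c M ↔ N'.MassIs B v c M := ⟨h.massIs, h.symm.massIs⟩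

lemma isPendant (h : N.AgreeOn N' B) {p : V} (hp : N.IsPendant B p) : N'.IsPendant B p := by
  refine ⟨hp.notMem, fun u hu => ?_⟩
  rw [← h.deg u hu, hp.deg_eq u hu]
  exact Finset.sum_congr rfl fun w _ => h.weight u hu w

end AgreeOn

lemma recurrents_nonempty {h : V → ℤ} (h0 : ∀ u ∈ B, 0 ≤ h u) (h1 : ∀ u ∈ B, 1 ≤ N.lap B h u) :
    (N.recurrents B).Nonempty :=
  ⟨fun u => if u ∈ B then (N.deg u : ℤ) - 1 else 0, fun _ hu => if_neg hu,
    (recurrent_max h0 h1).congr fun _ hu => (if_pos hu).symm⟩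

lemma recurrents_nonempty_of_subset {A : Finset V} (h : (N.recurrents B).Nonempty) (hAB : A ⊆ B) :
    (N.recurrents A).Nonempty := by
  obtain ⟨c, hc⟩ := h
  exact ⟨fun u => if u ∈ A then c u else 0, fun u hu => if_neg hu,
    (hc.2.subset hAB).congr fun u hu => (if_pos hu).symm⟩

lemma ncard_recurrents_pos (h : (N.recurrents B).Nonempty) : 0 < (N.recurrents B).ncard :=
  (Set.ncard_pos finite_recurrents).2 h

/-- The probability that the avalanche triggered by a chip on `v` has mass `M`, when `B` is the
set of non-dissipative vertices. -/
noncomputable def massRatio (N : Network V) (B : Finset V) (v : V) (M : ℕ) : ℝ :=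
  ({c ∈ N.recurrents B | N.MassIs B v c M}.ncard : ℝ) / (N.recurrents B).ncard

end Network

lemma network_agreeOn {G H : Graph V E} (hH : H ≤ G) (hfin : IsLocallyFinite G)
    (hfin' : IsLocallyFinite H) {B : Finset V} (hB : ∀ u ∈ B, ∀ e, G.Inc e u → e ∈ E(H)) :
    (network H hfin').AgreeOn (network G hfin) B := by
  have hlink : ∀ u ∈ B, ∀ e w, H.IsLink e u w ↔ G.IsLink e u w := fun u hu e w =>
    ⟨fun h => h.mono hH, fun h => (Graph.IsSubgraph.isLink_iff hH (hB u hu e h.inc_left)).2 h⟩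
  have hmult : ∀ u ∈ B, ∀ w, mult H u w = mult G u w := fun u hu w => by
    simp only [mult, hlink u hu]
  refine ⟨fun u hu => ?_, fun u hu w => ?_⟩
  · change deg H u = deg G u
    have h1 : ∀ e, H.Inc e u ↔ G.Inc e u := fun e => exists_congr fun w => hlink u hu e w
    have h2 : ∀ e, H.IsLoopAt e u ↔ G.IsLoopAt e u := fun e => hlink u hu e u
    simp only [deg, h1, h2]
  · simp only [network, hmult u hu]

namespace BlockChain

variable {G : Graph V E} {v : V} {C : ℕ → Set V} {p : ℕ → V} {H : ℕ → Graph V E}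

lemma eventually_boundary (h : BlockChain G v C p) (hH : IsExhaustion G v H) (i : ℕ) :
    ∀ᶠ n in atTop, ∃ m, i ≤ m ∧ innerBoundary G (H n) = {p m} ∧ p m ∈ V(H n) ∧
      innerPart G C p m ⊆ V(H n) := by
  obtain ⟨n₀, hn₀⟩ := hH.exhausts_vertices (p i) (h.vertexSet ▸ Set.mem_univ _)
  filter_upwards [eventually_ge_atTop n₀] with n hn
  obtain ⟨q, hq⟩ := hH.boundary n
  have hqV : q ∈ V(H n) := by
    have : q ∈ innerBoundary G (H n) := hq ▸ rfl
    exact this.1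
  obtain ⟨m, him, rfl, hm⟩ := h.exists_boundary (hH.finite n) (q := q)
    (fun u hu w hw huw => by
      have : u ∈ innerBoundary G (H n) := ⟨hu, w, hw, huw.2⟩
      rwa [hq] at this) (hH.root_mem n) (Graph.IsSubgraph.vertexSet_mono (hH.mono hn) hn₀)
  exact ⟨m, him, hq, hqV, hm⟩

lemma isFinitary (h : BlockChain G v C p) (hH : IsExhaustion G v H) : IsFinitary G v C p := by
  refine { h with finite_innerPart := fun i => ?_ }
  obtain ⟨n, m, him, _, _, hm⟩ := (h.eventually_boundary hH i).exists
  exact (hH.finite n).subset ((h.innerPart_mono him).trans hm)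

lemma eventually_edges (hfin : IsLocallyFinite G) (hH : IsExhaustion G v H) (B : Finset V) :
    ∀ᶠ n in atTop, ∀ u ∈ B, ∀ e, G.Inc e u → e ∈ E(H n) := by
  refine B.eventually_all.2 fun u _ => ?_
  have : ∀ᶠ n in atTop, ∀ e ∈ {e | G.Inc e u}, e ∈ E(H n) := by
    refine (hfin u).eventually_all.2 fun e he => ?_
    obtain ⟨n₀, hn₀⟩ := hH.exhausts_edges e (Graph.Inc.edge_mem he)
    filter_upwards [eventually_ge_atTop n₀] with n hn
    exact Graph.IsSubgraph.edgeSet_mono (hH.mono hn) hn₀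
  exact this

/-- An avalanche of mass less than `d_i` does not leave `inner (i + 1)`, so that its law in `H n`
is, for large `n`, the one in which `p (i + 1)` is the sink. -/
lemma IsFinitary.eventually_avalancheLaw (h : IsFinitary G v C p) (hfin : IsLocallyFinite G)
    (hH : IsExhaustion G v H) (i : ℕ) :
    ((network G hfin).recurrents (h.inner (i + 1))).Nonempty ∧
    ∀ M < (h.outer i).card, ∀ᶠ n in atTop,
      avalancheLaw G v H n M = (network G hfin).massRatio (h.inner (i + 1)) v M ∧
      ((∃ c : Config (H n) (innerBoundary G (H n)), IsRecurrent c ∧ HasMass c v M) →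
        ∃ c ∈ (network G hfin).recurrents (h.inner (i + 1)),
          (network G hfin).MassIs (h.inner (i + 1)) v c M) := by
  set N := network G hfin
  set B := h.inner (i + 1)
  have key : ∀ᶠ n in atTop, (N.recurrents B).Nonempty ∧ ∀ M < (h.outer i).card,
      avalancheLaw G v H n M = N.massRatio B v M ∧
      ((∃ c : Config (H n) (innerBoundary G (H n)), IsRecurrent c ∧ HasMass c v M) →
        ∃ c ∈ N.recurrents B, N.MassIs B v c M) := by
    filter_upwards [h.eventually_boundary hH (i + 1), eventually_edges hfin hH B] with n hn hE
    obtain ⟨m, him, hq, hqV, hm⟩ := hn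
    have hfin' : IsLocallyFinite (H n) := fun u =>
      (hfin u).subset fun e he => Graph.Inc.mono (hH.le n) he
    have hagree : (network (H n) hfin').AgreeOn N B := network_agreeOn (hH.le n) hfin hfin' hE
    set N' := network (H n) hfin'
    set U : Finset V := ((hH.finite n).subset (Set.sdiff_subset (t := {p m}))).toFinset with hUdef
    have hU : (U : Set V) = V(H n) \ {p m} := Set.Finite.coe_toFinset _
    have hBU : B ⊆ U := fun u hu => by
      have hu' := h.innerPart_mono him (h.mem_inner.1 hu)
      rw [← Finset.mem_coe, hU]
      exact ⟨hm hu', fun hc => h.cut_notMem_innerPart m (hc ▸ hu')⟩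
    have hDB : h.outer i ⊆ B := fun u hu => h.mem_inner.2 (h.outerPart_subset i (h.mem_outer.1 hu))
    have hAB : h.inner i ⊆ B := fun u hu =>
      h.mem_inner.2 (h.innerPart_mono (Nat.le_succ i) (h.mem_inner.1 hu))
    obtain ⟨ψ, h0, h1⟩ := exists_superharmonic hfin' (hH.connected n) hqV hU
    have hne := Network.recurrents_nonempty h0 h1
    have hpos := Network.ncard_recurrents_pos hne
    have hneB := Network.recurrents_nonempty_of_subset hne hBU
    have hposB := Network.ncard_recurrents_pos hneB
    have hB : N'.IsPendant B (p (i + 1)) := hagree.symm.isPendant (h.isPendant hfin (i + 1))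
    refine ⟨hagree.recurrents_eq ▸ hneB, fun M hM => ?_⟩
    have hloc : ∀ c, N'.Recurrent U c → (N'.MassIs U v c M ↔ N'.MassIs B v c M) := fun c hc =>
      Network.massIs_iff_of_lt ((hagree.symm.mono hAB).isPendant (h.isPendant hfin i)) hB
        (h.mem_inner.2 (h.root_mem_innerPart i)) hAB hBU hDB
        (h.mem_outer.2 (h.cut_mem_outerPart i))
        (fun u hu hup => by
          rw [hagree.deg u (hDB hu), h.deg_outer hfin hu hup]
          exact Finset.sum_congr rfl fun w _ => (hagree.weight u (hDB hu) w).symm) hc hM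
    constructor
    · rw [avalancheLaw, hq, massProb_eq (hH.connected n) hqV hfin' hU]
      have e1 : {c ∈ N'.recurrents U | N'.MassIs U v c M}
          = {c ∈ N'.recurrents U | N'.MassIs B v c M} := by
        ext c
        exact and_congr_right fun hc => hloc c hc.2
      have e2 := Network.ncard_restrict hB hBU (Q := fun c => N'.MassIs B v c M)
        fun c c' hcc hc => hc.congr hcc
      have e3 : {c ∈ N'.recurrents B | N'.MassIs B v c M}
          = {c ∈ N.recurrents B | N.MassIs B v c M} := by
        simp only [hagree.recurrents_eq, hagree.massIs_iff]
      rw [Network.massRatio, ← e3, ← hagree.recurrents_eq]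
      change (({c ∈ N'.recurrents U | N'.MassIs U v c M}.ncard : ℝ)) / (N'.recurrents U).ncard = _
      rw [e1, div_eq_div_iff (by positivity) (by positivity)]
      exact_mod_cast e2
    · rw [hq]
      rintro ⟨c, hc, hcM⟩
      have hcR := (isRecurrent_iff hfin' hU h0 h1 c).1 hc
      have hM' := (hloc _ hcR).1 ((hasMass_iff hfin' hU v M hcR).1 hcM)
      refine ⟨fun u => if u ∈ B then c.ext u else 0, ⟨fun u hu => if_neg hu, ?_⟩, ?_⟩
      · exact hagree.recurrent ((hcR.subset hBU).congr fun u hu => (if_pos hu).symm)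
      · exact hagree.massIs (hM'.congr fun u hu => (if_pos hu).symm)
  exact ⟨key.exists.choose_spec.1, fun M hM => key.mono fun n hn => hn.2 M hM⟩

end BlockChain

end

section

variable {V E : Type*}

/-! ### The limit law -/

/-- If `θ` loses at most the proportion `s (i + 1)` of its value at each step, with `s` summable,
then it cannot tend to zero unless it vanishes. -/
lemma exists_pos_le_of_summable {θ s : ℕ → ℝ} (hθ : ∀ i, 0 ≤ θ i) (hs : ∀ i, 0 ≤ s i)
    (hsum : Summable s) {i₀ : ℕ} (h : ∀ i, i₀ ≤ i → θ i * (1 - s (i + 1)) ≤ θ (i + 1)) :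
    ∃ a > 0, ∀ᶠ i in atTop, θ i = 0 ∨ a ≤ θ i := by
  obtain ⟨i₁, hi₁, hi₁₀⟩ : ∃ i₁, ∑' l, s (l + i₁) < 1 / 2 ∧ i₀ ≤ i₁ :=
    (((tendsto_sum_nat_add s).eventually_lt_const (by norm_num)).and
      (eventually_ge_atTop i₀)).exists
  by_cases hex : ∃ i, i₁ ≤ i ∧ θ i ≠ 0
  · obtain ⟨i, hi, hne⟩ := hex
    have hpos : 0 < θ i := lt_of_le_of_ne (hθ i) hne.symm
    have hpart : ∀ n, ∑ l ∈ Finset.range n, s (l + (i + 1)) ≤ 1 / 2 := by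
      intro n
      have h1 : Summable fun l => s (l + i₁) := (summable_nat_add_iff i₁).2 hsum
      refine le_trans ?_ ((h1.sum_le_tsum (Finset.range (i + 1 - i₁ + n))
        fun l _ => hs _).trans hi₁.le)
      rw [Finset.sum_range_add]
      refine le_trans (le_of_eq ?_) (le_add_of_nonneg_left (Finset.sum_nonneg fun l _ => hs _))
      refine Finset.sum_congr rfl fun l _ => ?_
      congr 1
      omega
    have key : ∀ n, θ i * (1 - ∑ l ∈ Finset.range n, s (l + (i + 1))) ≤ θ (i + n) := by
      intro n
      induction n with
      | zero => simp
      | succ n ih =>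
        have h1 := h (i + n) (by omega)
        have h2 := hpart n
        have h3 := hpart (n + 1)
        rw [Finset.sum_range_succ] at h3 ⊢
        have e : n + (i + 1) = i + n + 1 := by omega
        rw [e] at h3 ⊢
        have h4 := hs (i + n + 1)
        have h5 : 0 ≤ ∑ l ∈ Finset.range n, s (l + (i + 1)) := Finset.sum_nonneg fun l _ => hs _
        have h6 : 0 ≤ 1 - s (i + n + 1) := by linarith
        have h7 := mul_le_mul_of_nonneg_right ih h6
        have h8 : 0 ≤ θ i * ((∑ l ∈ Finset.range n, s (l + (i + 1))) * s (i + n + 1)) := by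
          positivity
        rw [← add_assoc i n 1]
        nlinarith
    refine ⟨θ i / 2, by positivity, eventually_atTop.2 ⟨i, fun m hm => Or.inr ?_⟩⟩
    obtain ⟨n, rfl⟩ := Nat.exists_eq_add_of_le hm
    have h1 := key n
    have h2 := hpart n
    nlinarith
  · push Not at hex
    exact ⟨1, one_pos, eventually_atTop.2 ⟨i₁, fun i hi => Or.inl (hex i hi)⟩⟩

namespace BlockChain

variable {G : Graph V E} {v : V} {C : ℕ → Set V} {p : ℕ → V} {H : ℕ → Graph V E}

namespace IsFinitary

lemma inner_subset_outer (h : IsFinitary G v C p) (i : ℕ) : h.inner i ⊆ h.outer i :=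
  fun _ hu => h.mem_outer.2 (h.innerPart_subset i (h.mem_inner.1 hu))

lemma outer_subset_inner (h : IsFinitary G v C p) (i : ℕ) : h.outer i ⊆ h.inner (i + 1) :=
  fun _ hu => h.mem_inner.2 (h.outerPart_subset i (h.mem_outer.1 hu))

lemma strictMono_card_outer (h : IsFinitary G v C p) : StrictMono fun i => (h.outer i).card := by
  refine strictMono_nat_of_lt_succ fun i => Finset.card_lt_card ?_
  refine Finset.ssubset_iff.2 ⟨p (i + 1), fun hc => ?_, Finset.insert_subset
    (h.mem_outer.2 (h.cut_mem_outerPart (i + 1)))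
    ((h.outer_subset_inner i).trans (h.inner_subset_outer (i + 1)))⟩
  exact h.mem_inner.1 (h.outer_subset_inner i hc) (h.gate_cut (i + 1))

lemma lt_card_outer (h : IsFinitary G v C p) (i : ℕ) : i < (h.outer i).card := by
  have h0 : 0 < (h.outer 0).card := Finset.card_pos.2 ⟨p 0, h.mem_outer.2 (h.cut_mem_outerPart 0)⟩
  induction i with
  | zero => exact h0
  | succ i ih => exact lt_of_le_of_lt ih (h.strictMono_card_outer (Nat.lt_succ_self i))

lemma ncard_block_le_card_outer (h : IsFinitary G v C p) (i : ℕ) :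
    (C i).ncard ≤ (h.outer i).card := by
  rw [← Set.ncard_coe_finset]
  refine Set.ncard_le_ncard (fun u hu => ?_) (Finset.finite_toSet _)
  exact h.mem_outer.2 (h.block_subset_outerPart le_rfl hu)

/-- The probability that the avalanche triggered by a chip on `v` sends `τ` chips to `p i`, when
`p i` is the sink. -/
noncomputable def outflowRatio (h : IsFinitary G v C p) (hfin : IsLocallyFinite G) (τ i : ℕ) : ℝ :=
  ({c ∈ (network G hfin).recurrents (h.inner i) |
    (network G hfin).Outflows (h.inner i) (p i) v τ c}.ncard : ℝ)
    / ((network G hfin).recurrents (h.inner i)).ncard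

variable (h : IsFinitary G v C p) (hfin : IsLocallyFinite G)

lemma outflowRatio_nonneg (τ i : ℕ) : 0 ≤ h.outflowRatio hfin τ i := by
  rw [outflowRatio]; positivity

/-- `outflowRatio` may be computed on any larger set of non-dissipative vertices. -/
lemma outflowRatio_eq (τ : ℕ) {i : ℕ} {B : Finset V} (hB : h.inner i ⊆ B)
    (hne : ((network G hfin).recurrents B).Nonempty) :
    h.outflowRatio hfin τ i = ({c ∈ (network G hfin).recurrents B |
      (network G hfin).Outflows (h.inner i) (p i) v τ c}.ncard : ℝ)
      / ((network G hfin).recurrents B).ncard := by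
  have h1 := Network.ncard_recurrents_pos hne
  have h2 := Network.ncard_recurrents_pos (Network.recurrents_nonempty_of_subset hne hB)
  rw [outflowRatio, div_eq_div_iff (by positivity) (by positivity)]
  exact_mod_cast (Network.ncard_restrict (h.isPendant hfin i) hB
    (Q := (network G hfin).Outflows (h.inner i) (p i) v τ) fun c c' hcc hc => hc.congr hcc).symm

lemma outflowRatio_mul_le (hne : ∀ i, ((network G hfin).recurrents (h.inner i)).Nonempty) (τ : ℕ)
    {i : ℕ} (hcyc : IsCycle G (C (i + 1))) (hk : 2 < (C (i + 1)).ncard) :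
    h.outflowRatio hfin τ i * (1 - 2 * (1 / ((C (i + 1)).ncard : ℝ)))
      ≤ h.outflowRatio hfin τ (i + 1) := by
  obtain ⟨j, g, ι, hb, hg, _⟩ := h.exists_cycleBlock hfin hcyc
  have h1 := hb.ncard_outflows_mul_le (v := v) (h.mem_inner.2 (h.root_mem_innerPart i)) τ
  rw [hg] at h1
  have hpos := Network.ncard_recurrents_pos (hne (i + 1))
  rw [h.outflowRatio_eq hfin τ ((h.inner_subset_outer i).trans (h.outer_subset_inner i))
    (hne (i + 1)), outflowRatio, div_mul_eq_mul_div, div_le_div_iff_of_pos_right (by positivity)]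
  set k := (C (i + 1)).ncard
  have h2 : (({c ∈ (network G hfin).recurrents (h.inner (i + 1)) |
      (network G hfin).Outflows (h.inner i) (p i) v τ c}.ncard * (k - 2 : ℕ) : ℕ) : ℝ)
      ≤ (({c ∈ (network G hfin).recurrents (h.inner (i + 1)) |
      (network G hfin).Outflows (h.inner (i + 1)) (p (i + 1)) v τ c}.ncard * k : ℕ) : ℝ) := by
    exact_mod_cast h1
  rw [Nat.cast_mul, Nat.cast_mul, Nat.cast_sub hk.le] at h2
  have hk0 : (0 : ℝ) < k := by positivity
  have e : (1 - 2 * (1 / (k : ℝ))) = (k - (2 : ℕ)) / k := by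
    field_simp
    norm_num
  rw [e, mul_div_assoc', div_le_iff₀ hk0]
  exact h2

lemma massRatio_mul_le (hne : ∀ i, ((network G hfin).recurrents (h.inner i)).Nonempty) {i M : ℕ}
    (hcyc : IsCycle G (C (i + 1))) (hcyc' : IsCycle G (C (i + 2))) (hM : (h.outer i).card ≤ M)
    (hM' : M < (h.outer (i + 1)).card) :
    (network G hfin).massRatio (h.inner (i + 2)) v M
      * ((C (i + 1)).ncard * (C (i + 2)).ncard) ≤ 2 := by
  obtain ⟨j, g, ι, hb, hg, hent⟩ := h.exists_cycleBlock hfin hcyc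
  obtain ⟨j', g', ι', hb', hg', hent'⟩ := h.exists_cycleBlock hfin hcyc'
  have h1 := hb.ncard_massIs_mul_le hb' hg' (h.mem_inner.2 (h.root_mem_innerPart i))
    (hent ▸ hM) (hent' ▸ hM')
  have hpos := Network.ncard_recurrents_pos (hne (i + 2))
  rw [Network.massRatio, div_mul_eq_mul_div, div_le_iff₀ (by positivity)]
  exact_mod_cast h1

lemma exists_outflowRatio_le (hne : ∀ i, ((network G hfin).recurrents (h.inner i)).Nonempty)
    {i M : ℕ} (hcyc : IsCycle G (C (i + 1))) (hcyc' : IsCycle G (C (i + 2)))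
    (hM : (h.outer i).card ≤ M) (hM' : M < (h.outer (i + 1)).card)
    (hex : ∃ c ∈ (network G hfin).recurrents (h.inner (i + 2)),
      (network G hfin).MassIs (h.inner (i + 2)) v c M) :
    ∃ τ ≤ 2, h.outflowRatio hfin τ i ≠ 0 ∧ h.outflowRatio hfin τ i
      ≤ (network G hfin).massRatio (h.inner (i + 2)) v M
        * ((C (i + 1)).ncard * (C (i + 2)).ncard) := by
  obtain ⟨j, g, ι, hb, hg, hent⟩ := h.exists_cycleBlock hfin hcyc
  obtain ⟨j', g', ι', hb', hg', hent'⟩ := h.exists_cycleBlock hfin hcyc'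
  obtain ⟨c, hc, hcM⟩ := hex
  obtain ⟨τ, hτ, hout, h1⟩ := hb.exists_ncard_outflows_le hb' hg'
    (h.mem_inner.2 (h.root_mem_innerPart i)) (hent ▸ hM) (hent' ▸ hM') hc hcM
  rw [hg] at hout h1
  have hpos := Network.ncard_recurrents_pos (hne (i + 2))
  have hsub : h.inner i ⊆ h.inner (i + 2) := fun u hu =>
    h.mem_inner.2 (h.innerPart_mono (by omega : i ≤ i + 2) (h.mem_inner.1 hu))
  refine ⟨τ, hτ, ?_, ?_⟩
  · rw [h.outflowRatio_eq hfin τ hsub (hne (i + 2))]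
    have : 0 < {c ∈ (network G hfin).recurrents (h.inner (i + 2)) |
        (network G hfin).Outflows (h.inner i) (p i) v τ c}.ncard :=
      (Set.ncard_pos (Network.finite_recurrents.subset fun _ hx => hx.1)).2 ⟨c, hc, hout⟩
    positivity
  · rw [h.outflowRatio_eq hfin τ hsub (hne (i + 2)), Network.massRatio, div_mul_eq_mul_div,
      div_le_div_iff_of_pos_right (by positivity)]
    exact_mod_cast h1

/-- The limit law exists, and a mass `M` with `d_i ≤ M < d_(i+1)` that occurs has probability of
order `1 / (|C_(i+1)| |C_(i+2)|)`. -/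
lemma exists_limit (h : IsFinitary G v C p) (hfin : IsLocallyFinite G) (hH : IsExhaustion G v H)
    (hcyc : ∀ᶠ i in atTop, IsCycle G (C i) ∧ 2 < (C i).ncard)
    (hsum : Summable (fun j => if 2 < (C j).ncard then 1 / ((C j).ncard : ℝ) else 0)) :
    ∃ L : ℕ → ℝ, (∀ M, Tendsto (fun n => avalancheLaw G v H n M) atTop (𝓝 (L M))) ∧
      ∃ a > 0, ∀ᶠ i in atTop, ∀ M, (h.outer i).card ≤ M → M < (h.outer (i + 1)).card →
        OccursAsMass G v H M →
          a ≤ L M * ((C (i + 1)).ncard * (C (i + 2)).ncard) ∧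
          L M * ((C (i + 1)).ncard * (C (i + 2)).ncard) ≤ 2 := by
  have hlaw := h.eventually_avalancheLaw hfin hH
  have htend : ∀ i M, M < (h.outer i).card → Tendsto (fun n => avalancheLaw G v H n M) atTop
      (𝓝 ((network G hfin).massRatio (h.inner (i + 1)) v M)) := fun i M hM =>
    tendsto_const_nhds.congr' (((hlaw i).2 M hM).mono fun n hn => hn.1.symm)
  have hne : ∀ i, ((network G hfin).recurrents (h.inner i)).Nonempty := fun i =>
    Network.recurrents_nonempty_of_subset (hlaw i).1
      ((h.inner_subset_outer i).trans (h.outer_subset_inner i))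
  -- Since `M < d_M`, the index `M` may serve as the scale for the mass `M`.
  refine ⟨fun M => (network G hfin).massRatio (h.inner (M + 1)) v M,
    fun M => htend M M (h.lt_card_outer M), ?_⟩
  obtain ⟨i₀, hi₀⟩ := eventually_atTop.1 hcyc
  have hθ : ∀ τ, ∃ a > 0, ∀ᶠ i in atTop,
      h.outflowRatio hfin τ i = 0 ∨ a ≤ h.outflowRatio hfin τ i := fun τ => by
    refine exists_pos_le_of_summable (h.outflowRatio_nonneg hfin τ) (fun i => ?_)
      (hsum.mul_left 2) (i₀ := i₀) fun i hi => ?_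
    · split_ifs <;> positivity
    · obtain ⟨h1, h2⟩ := hi₀ (i + 1) (by omega)
      rw [if_pos h2]
      exact h.outflowRatio_mul_le hfin hne τ h1 h2
  choose a ha hθa using hθ
  refine ⟨min (a 0) (min (a 1) (a 2)), lt_min (ha 0) (lt_min (ha 1) (ha 2)), ?_⟩
  filter_upwards [hθa 0, hθa 1, hθa 2, eventually_ge_atTop i₀] with i h0 h1 h2 hi M hM hM' hocc
  have heq : (network G hfin).massRatio (h.inner (M + 1)) v M
      = (network G hfin).massRatio (h.inner (i + 2)) v M :=
    tendsto_nhds_unique (htend M M (h.lt_card_outer M)) (htend (i + 1) M hM')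
  rw [heq]
  have hc1 := (hi₀ (i + 1) (by omega)).1
  have hc2 := (hi₀ (i + 2) (by omega)).1
  refine ⟨?_, h.massRatio_mul_le hfin hne hc1 hc2 hM hM'⟩
  obtain ⟨n, hn1, hn2⟩ := (hocc.and_eventually ((hlaw (i + 1)).2 M hM')).exists
  obtain ⟨τ, hτ, hpos, hle⟩ := h.exists_outflowRatio_le hfin hne hc1 hc2 hM hM' (hn2.2 hn1)
  refine le_trans ?_ hle
  interval_cases τ
  · exact (min_le_left _ _).trans (h0.resolve_left hpos)
  · exact ((min_le_right _ _).trans (min_le_left _ _)).trans (h1.resolve_left hpos)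
  · exact ((min_le_right _ _).trans (min_le_right _ _)).trans (h2.resolve_left hpos)

end IsFinitary

end BlockChain

end

/-! ### Exponents -/

lemma exists_forall_of_eventually {d : ℕ → ℕ} (hd : StrictMono d) {Q : ℕ → Prop}
    (h : ∀ᶠ i in atTop, ∀ M, d i ≤ M → M < d (i + 1) → Q M) : ∃ M₀, ∀ M, M₀ < M → Q M := by
  obtain ⟨I, hI⟩ := eventually_atTop.1 h
  refine ⟨d I, fun M hM => ?_⟩
  have hex : ∃ i, M < d i := ⟨M + 1, hd.le_apply⟩
  have hspec := Nat.find_spec hex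
  have hlt : I < Nat.find hex := by
    refine lt_of_not_ge fun hle => ?_
    have := hd.monotone hle
    omega
  obtain ⟨i, hi⟩ := Nat.exists_eq_succ_of_ne_zero (by omega : Nat.find hex ≠ 0)
  have hmin := Nat.find_min hex (m := i) (by omega)
  rw [hi] at hspec
  exact hI i (by omega) M (by omega) hspec

/-- The sizes `d i` and diameters `D i` of the finite parts and the lengths `k i` of the cycles of
the block-path, with the relations between them on which the exponents depend. -/
structure Scales (d k D : ℕ → ℕ) : Prop where
  strictMono : StrictMono d
  le_card : ∀ i, k i ≤ d i
  lt_diam : ∀ i, i < D i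
  le_diam : ∀ᶠ i in atTop, k i ≤ 2 * D i + 1
  diam_le : ∃ c : ℝ, 0 < c ∧ ∀ᶠ i in atTop, (D i : ℝ) ≤ c * k i
  log_ratio : Tendsto (fun i => Real.log (d i) / Real.log (d (i + 1))) atTop (𝓝 1)

namespace Scales

variable {d k D : ℕ → ℕ}

lemma log_diam_pos (h : Scales d k D) {i : ℕ} (hi : 1 ≤ i) : 0 < Real.log (D i) := by
  have := h.lt_diam i
  exact Real.log_pos (by exact_mod_cast (by omega : 1 < D i))

lemma le_self (h : Scales d k D) (i : ℕ) : i ≤ d i := h.strictMono.le_apply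

/-- If `k i ≲ d i ^ (1 / β)` with `β` slightly less than the lower exponent `b`, and `d i`, `d (i + 2)`
agree on the logarithmic scale, then `1 / (k (i + 1) * k (i + 2))` is at least of order
`d i ^ (-2 / (b - ε))`. -/
lemma lower_bound (h : Scales d k D) {L : ℕ → ℝ} {P : ℕ → Prop} {a : ℝ} (ha : 0 < a)
    (hL : ∀ᶠ i in atTop, ∀ M, d i ≤ M → M < d (i + 1) → P M → a ≤ L M * (k (i + 1) * k (i + 2)))
    {b : ℝ} (hb : liminf (fun i => ((Real.log (d i) / Real.log (D i) : ℝ) : EReal)) atTop = b)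
    {ε : ℝ} (hε : 0 < ε) (hεb : ε < b) :
    ∃ M₀ : ℕ, ∀ M, M₀ < M → P M → a / 9 * (M : ℝ) ^ (-(2 / (b - ε))) ≤ L M := by
  -- Half of `ε` is given up for the diameters and half for passing from `d (i + 2)` to `d i`.
  set β := b - ε / 2 with hβ
  have hβ0 : 0 < β := by linarith
  have hbε : 0 < b - ε := by linarith
  have hr : ∀ᶠ i in atTop, β < Real.log (d i) / Real.log (D i) := by
    have := eventually_lt_of_lt_liminf (b := (β : EReal))
      (hb.symm ▸ EReal.coe_lt_coe_iff.2 (by linarith) : (β : EReal) <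
        liminf (fun i => ((Real.log (d i) / Real.log (D i) : ℝ) : EReal)) atTop)
    exact this.mono fun i hi => EReal.coe_lt_coe_iff.1 hi
  have hD : ∀ᶠ i in atTop, Real.log (D i) * β ≤ Real.log (d i) := by
    filter_upwards [hr, eventually_ge_atTop 1] with i hi h1
    rw [lt_div_iff₀ (h.log_diam_pos h1)] at hi
    linarith
  have hlog : ∀ᶠ i in atTop, Real.log (d (i + 2)) * (b - ε) ≤ Real.log (d i) * β := by
    have h2 := h.log_ratio.mul (h.log_ratio.comp (tendsto_add_atTop_nat 1))
    have hlt : (b - ε) / β < 1 * 1 := by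
      rw [one_mul, div_lt_one hβ0]
      linarith
    filter_upwards [h2.eventually_const_lt hlt, eventually_ge_atTop 2] with i hi h1
    have hpos : ∀ l, i ≤ l → 0 < Real.log (d l) := fun l hl => by
      have := h.le_self l
      exact Real.log_pos (by exact_mod_cast (by omega : 1 < d l))
    have e : Real.log (d i) / Real.log (d (i + 1)) *
        ((fun i => Real.log (d i) / Real.log (d (i + 1))) ∘ fun i => i + 1) i
        = Real.log (d i) / Real.log (d (i + 2)) := by
      have := (hpos (i + 1) (by omega)).ne'
      simp only [Function.comp]
      field_simp
    rw [e, div_lt_div_iff₀ hβ0 (hpos (i + 2) (by omega))] at hi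
    linarith
  refine exists_forall_of_eventually h.strictMono ?_
  filter_upwards [hL, hlog, (tendsto_add_atTop_nat 1).eventually hD,
    (tendsto_add_atTop_nat 2).eventually hD, (tendsto_add_atTop_nat 1).eventually h.le_diam,
    (tendsto_add_atTop_nat 2).eventually h.le_diam, eventually_ge_atTop 1]
    with i hLi hlogi hD1 hD2 hk1 hk2 hi M hM hM' hPM
  have hd0 : (0 : ℝ) < d i := by
    have := h.le_self i
    exact_mod_cast (by omega : 0 < d i)
  have hM0 : (0 : ℝ) < M := hd0.trans_le (by exact_mod_cast hM)
  have hmono : Real.log (d (i + 1)) ≤ Real.log (d (i + 2)) := by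
    have h1 := h.le_self (i + 1)
    have h2 : d (i + 1) ≤ d (i + 2) := h.strictMono.monotone (by omega)
    exact Real.log_le_log (by exact_mod_cast (by omega : 0 < d (i + 1))) (by exact_mod_cast h2)
  have hkey : ∀ l, i < l → k l ≤ 2 * D l + 1 → Real.log (D l) * β ≤ Real.log (d (i + 2)) →
      (k l : ℝ) ≤ 3 * (M : ℝ) ^ (1 / (b - ε)) := by
    intro l hl hkl hDl
    have hDl0 := h.lt_diam l
    have h1 : (k l : ℝ) ≤ 3 * D l := by exact_mod_cast (by omega : k l ≤ 3 * D l)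
    have h2 : (D l : ℝ) ≤ (M : ℝ) ^ (1 / (b - ε)) := by
      rw [Real.le_rpow_iff_log_le (by exact_mod_cast (by omega : 0 < D l)) hM0,
        one_div_mul_eq_div, le_div_iff₀ hbε]
      have h3 : Real.log (d i) ≤ Real.log M := Real.log_le_log hd0 (by exact_mod_cast hM)
      have h4 : Real.log (D l) * (b - ε) * β ≤ Real.log M * β := by nlinarith
      exact le_of_mul_le_mul_right h4 hβ0
    linarith
  have h1 := hkey (i + 1) (by omega) hk1 (hD1.trans hmono)
  have h2 := hkey (i + 2) (by omega) hk2 hD2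
  have h3 := hLi M hM hM' hPM
  have hL0 : 0 ≤ L M := by
    by_contra! hneg
    have : L M * (k (i + 1) * k (i + 2) : ℝ) ≤ 0 :=
      mul_nonpos_of_nonpos_of_nonneg hneg.le (by positivity)
    linarith
  have h4 : (k (i + 1) * k (i + 2) : ℝ) ≤ 9 * (M : ℝ) ^ (2 / (b - ε)) := by
    have e : 2 / (b - ε) = 1 / (b - ε) + 1 / (b - ε) := by ring
    rw [e, Real.rpow_add hM0]
    refine (mul_le_mul h1 h2 (by positivity) (by positivity)).trans (le_of_eq (by ring))
  have h5 := h3.trans (mul_le_mul_of_nonneg_left h4 hL0)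
  rw [Real.rpow_neg hM0.le, ← div_eq_mul_inv, div_le_iff₀ (by positivity)]
  linarith

/-- If `k i ≳ d i ^ (1 / (b + ε))`, then `1 / (k (i + 1) * k (i + 2))` is at most of order
`d (i + 1) ^ (-2 / (b + ε))`. -/
lemma upper_bound (h : Scales d k D) {L : ℕ → ℝ} {P : ℕ → Prop} {c : ℝ} (hc : 0 < c)
    (hDk : ∀ᶠ i in atTop, (D i : ℝ) ≤ c * k i)
    (hL : ∀ᶠ i in atTop, ∀ M, d i ≤ M → M < d (i + 1) → P M → L M * (k (i + 1) * k (i + 2)) ≤ 2)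
    {b : ℝ} (hb : limsup (fun i => ((Real.log (d i) / Real.log (D i) : ℝ) : EReal)) atTop = b)
    {ε : ℝ} (hε : 0 < ε) :
    ∃ M₀ : ℕ, ∀ M, M₀ < M → P M → L M ≤ 2 * c ^ 2 * (M : ℝ) ^ (-(2 / (b + ε))) := by
  -- All the ratios are nonnegative, so that `b + ε` is positive.
  have hb0 : 0 ≤ b := by
    have : (0 : EReal) ≤ b := by
      rw [← hb]
      refine le_limsup_of_frequently_le (Eventually.frequently (Eventually.of_forall fun i => ?_))
      exact_mod_cast div_nonneg (Real.log_natCast_nonneg _) (Real.log_natCast_nonneg _)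
    exact_mod_cast this
  have hbε : 0 < b + ε := by linarith
  have hr : ∀ᶠ i in atTop, Real.log (d i) / Real.log (D i) < b + ε := by
    have := eventually_lt_of_limsup_lt (b := ((b + ε : ℝ) : EReal))
      (hb.symm ▸ EReal.coe_lt_coe_iff.2 (by linarith) :
        limsup (fun i => ((Real.log (d i) / Real.log (D i) : ℝ) : EReal)) atTop
          < ((b + ε : ℝ) : EReal))
    exact this.mono fun i hi => EReal.coe_lt_coe_iff.1 hi
  have hk : ∀ᶠ i in atTop, (d i : ℝ) ^ (1 / (b + ε)) ≤ c * k i := by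
    filter_upwards [hr, hDk, eventually_ge_atTop 1] with i hi hki h1
    refine le_trans ?_ hki
    have hd0 := h.le_self i
    have hD0 := h.lt_diam i
    rw [Real.rpow_le_iff_le_log (by exact_mod_cast (by omega : 0 < d i))
      (by exact_mod_cast (by omega : 0 < D i)), one_div_mul_eq_div, div_le_iff₀ hbε]
    rw [div_lt_iff₀ (h.log_diam_pos h1)] at hi
    linarith
  refine exists_forall_of_eventually h.strictMono ?_
  filter_upwards [hL, (tendsto_add_atTop_nat 1).eventually hk,
    (tendsto_add_atTop_nat 2).eventually hk, eventually_ge_atTop 1]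
    with i hLi hk1 hk2 hi M hM hM' hPM
  have hM0 : (0 : ℝ) < M := by
    have := h.le_self i
    exact_mod_cast (by omega : 0 < M)
  have hkey : ∀ l, i < l → (d l : ℝ) ^ (1 / (b + ε)) ≤ c * k l →
      (M : ℝ) ^ (1 / (b + ε)) ≤ c * k l := fun l hl hkl => by
    refine le_trans (Real.rpow_le_rpow hM0.le ?_ (by positivity)) hkl
    have := h.strictMono.monotone (show i + 1 ≤ l from hl)
    exact_mod_cast (by omega : M ≤ d l)
  have h1 := hkey (i + 1) (by omega) hk1
  have h2 := hkey (i + 2) (by omega) hk2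
  have h3 := hLi M hM hM' hPM
  have h4 : (M : ℝ) ^ (2 / (b + ε)) ≤ c ^ 2 * (k (i + 1) * k (i + 2)) := by
    have e : 2 / (b + ε) = 1 / (b + ε) + 1 / (b + ε) := by ring
    rw [e, Real.rpow_add hM0]
    refine (mul_le_mul h1 h2 (by positivity) (by positivity)).trans (le_of_eq (by ring))
  rw [Real.rpow_neg hM0.le, ← div_eq_mul_inv, le_div_iff₀ (by positivity)]
  by_cases hL0 : 0 ≤ L M
  · have h5 := mul_le_mul_of_nonneg_left h4 hL0
    have h6 := mul_le_mul_of_nonneg_left h3 (sq_nonneg c)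
    linarith
  · have h5 : L M * (M : ℝ) ^ (2 / (b + ε)) ≤ 0 :=
      mul_nonpos_of_nonpos_of_nonneg (not_le.1 hL0).le (by positivity)
    have h6 : 0 ≤ 2 * c ^ 2 := by positivity
    linarith

/-- The exponents are at least `1 / 2`, since `D i ≤ c * d i ≤ d i ^ 2` for large `i`. -/
lemma liminf_pos (h : Scales d k D) {b : ℝ}
    (hb : liminf (fun i => ((Real.log (d i) / Real.log (D i) : ℝ) : EReal)) atTop = b) :
    0 < b := by
  obtain ⟨c, hc, hDk⟩ := h.diam_le
  have : ((1 / 2 : ℝ) : EReal) ≤ b := by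
    rw [← hb]
    refine le_liminf_of_le (by isBoundedDefault) ?_
    filter_upwards [hDk, eventually_ge_atTop 1, eventually_ge_atTop ⌈c⌉₊] with i hDi h1 hci
    have hd : (i : ℝ) ≤ d i := by exact_mod_cast h.le_self i
    have hi0 : (1 : ℝ) ≤ i := by exact_mod_cast h1
    have hcd : c ≤ d i := (Nat.le_ceil c).trans ((Nat.cast_le.2 hci).trans hd)
    have hD : (D i : ℝ) ≤ (d i : ℝ) ^ 2 := by
      have hk : (k i : ℝ) ≤ d i := by exact_mod_cast h.le_card i
      have : c * k i ≤ d i * d i := mul_le_mul hcd hk (by positivity) (by positivity)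
      nlinarith
    have hDi0 := h.lt_diam i
    have hlog := Real.log_le_log (by exact_mod_cast (by omega : 0 < D i)) hD
    rw [Real.log_pow] at hlog
    rw [EReal.coe_le_coe_iff, le_div_iff₀ (h.log_diam_pos h1)]
    push_cast at hlog
    linarith
  have h2 : (1 / 2 : ℝ) ≤ b := by exact_mod_cast this
  linarith

end Scales

lemma exists_exponent_lower {b ε : ℝ} (hb : 0 < b) (hε : 0 < ε) :
    ∃ η > 0, η < b ∧ 2 / (b - η) ≤ 2 / b + ε := by
  have hcont : Tendsto (fun η : ℝ => 2 / (b - η)) (𝓝[>] 0) (𝓝 (2 / b)) := by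
    have : ContinuousAt (fun η : ℝ => 2 / (b - η)) 0 :=
      ContinuousAt.div (by fun_prop) (by fun_prop) (by simpa using hb.ne')
    have h := this.tendsto.mono_left (nhdsWithin_le_nhds (s := Set.Ioi 0))
    simpa using h
  obtain ⟨η, h1, h2, h3⟩ := ((hcont.eventually_le_const (by linarith : 2 / b < 2 / b + ε)).and
    ((Ioo_mem_nhdsGT hb : ∀ᶠ η in 𝓝[>] (0 : ℝ), η ∈ Set.Ioo 0 b))).exists
  exact ⟨η, h2, h3, h1⟩

lemma exists_exponent_upper {b ε : ℝ} (hb : 0 < b) (hε : 0 < ε) :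
    ∃ η > 0, 2 / b - ε ≤ 2 / (b + η) := by
  have hcont : Tendsto (fun η : ℝ => 2 / (b + η)) (𝓝[>] 0) (𝓝 (2 / b)) := by
    have : ContinuousAt (fun η : ℝ => 2 / (b + η)) 0 :=
      ContinuousAt.div (by fun_prop) (by fun_prop) (by simpa using hb.ne')
    have h := this.tendsto.mono_left (nhdsWithin_le_nhds (s := Set.Ioi 0))
    simpa using h
  obtain ⟨η, h1, h2⟩ := ((hcont.eventually_const_le (by linarith : 2 / b - ε < 2 / b)).and
    self_mem_nhdsWithin).exists
  exact ⟨η, h2, h1⟩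

/-! ### The scales of a cactus -/

namespace BlockChain

variable {V E : Type*} {G : Graph V E} {v : V} {C : ℕ → Set V} {p : ℕ → V}

lemma IsFinitary.ncard_finitePart (h : IsFinitary G v C p) (i : ℕ) :
    (finitePart G (p i)).ncard = (h.outer i).card := by
  rw [h.finitePart_eq, ← Set.ncard_coe_finset]
  congr 1
  ext u
  rw [Finset.mem_coe, h.mem_outer]
  rfl

/-- Since `|C i| ≥ diam D(p i) / c` tends to infinity, the block-path ends in long cycles. -/
lemma IsFinitary.eventually_isCycle (h : IsFinitary G v C p) (hcactus : IsCactus G)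
    (hdiam : ∃ c : ℝ, 0 < c ∧
      ∀ᶠ i in atTop, (spanDiam G (outerPart G C p i) : ℝ) ≤ c * (C i).ncard) :
    ∀ᶠ i in atTop, IsCycle G (C i) ∧ 2 < (C i).ncard := by
  obtain ⟨c, hc, hle⟩ := hdiam
  filter_upwards [hle, eventually_ge_atTop ⌈2 * c⌉₊] with i hi hci
  have hcard : 2 < (C i).ncard := by
    have h1 : (i : ℝ) < spanDiam G (outerPart G C p i) := by
      exact_mod_cast lt_spanDiam_outerPart h i
    have h2 : 2 * c ≤ i := (Nat.le_ceil _).trans (by exact_mod_cast hci)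
    have h3 : c * 2 < c * (C i).ncard := by linarith
    exact_mod_cast lt_of_mul_lt_mul_left h3 hc.le
  refine ⟨(hcactus.blocks _ (h.path.block i)).resolve_right ?_, hcard⟩
  rintro ⟨u, w, huw, hCi, _⟩
  rw [hCi, Set.ncard_pair huw] at hcard
  omega

end BlockChain

end CactusSandpile

theorem theorem8p1p1 {V E : Type*} [Infinite V] (G : Graph V E) (v : V)
    (hV : V(G) = Set.univ) (hfin : IsLocallyFinite G)
    (hcactus : IsCactus G) (hend : IsOneEnded G)
    (H : ℕ → Graph V E) (hH : IsExhaustion G v H)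
    (C : ℕ → Set V) (p : ℕ → V) (hC : IsInfiniteBlockPath G v C p)
    (hsum : Summable (fun j => if 2 < (C j).ncard then 1 / ((C j).ncard : ℝ) else 0))
    (hdiam : ∃ c : ℝ, 0 < c ∧
      ∀ᶠ i in atTop, (spanDiam G (finitePart G (p i)) : ℝ) ≤ c * (C i).ncard)
    (hlog : Tendsto (fun i => Real.log (finitePart G (p i)).ncard /
      Real.log (finitePart G (p (i + 1))).ncard) atTop (𝓝 1)) :
    (∃ L : ℕ → ℝ,
      (∀ M, Tendsto (fun n => avalancheLaw G v H n M) atTop (𝓝 (L M))) ∧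
      (∀ b' : ℝ, liminf (fun i => (logRatio G p i : EReal)) atTop = (b' : EReal) →
        ∃ C₁ > (0 : ℝ), ∀ ε > (0 : ℝ), ε < b' → ∃ M₀ : ℕ, ∀ M : ℕ, M₀ < M →
          OccursAsMass G v H M → C₁ * (M : ℝ) ^ (-(2 / (b' - ε))) ≤ L M) ∧
      (∀ b : ℝ, limsup (fun i => (logRatio G p i : EReal)) atTop = (b : EReal) →
        ∃ C₂ > (0 : ℝ), ∀ ε > (0 : ℝ), ∃ M₀ : ℕ, ∀ M : ℕ, M₀ < M →
          OccursAsMass G v H M → L M ≤ C₂ * (M : ℝ) ^ (-(2 / (b + ε))))) ∧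
    (∀ b : ℝ, limsup (fun i => (logRatio G p i : EReal)) atTop = (b : EReal) →
      liminf (fun i => (logRatio G p i : EReal)) atTop = (b : EReal) →
        IsCritical G v H (2 / b)) ∧
    (∀ a : ℝ, HasPolynomialGrowth G v a → Tendsto (logRatio G p) atTop (𝓝 a) →
      IsCritical G v H (2 / a)) := by
  have hch : BlockChain G v C p := ⟨hV, hcactus.connected, hC⟩
  have h := hch.isFinitary hH
  simp only [h.finitePart_eq] at hdiam
  simp only [h.ncard_finitePart] at hlog
  have hcyc := h.eventually_isCycle hcactus hdiam
  have hS : Scales (fun i => (h.outer i).card) (fun i => (C i).ncard)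
      (fun i => spanDiam G (outerPart G C p i)) :=
    ⟨h.strictMono_card_outer, h.ncard_block_le_card_outer, BlockChain.lt_spanDiam_outerPart h,
      hcyc.mono fun i hi => BlockChain.ncard_block_le h hfin hi.1, hdiam, hlog⟩
  have hratio : logRatio G p = fun i => Real.log (h.outer i).card /
      Real.log (spanDiam G (outerPart G C p i)) := by
    funext i
    rw [logRatio, h.ncard_finitePart, h.finitePart_eq]
  obtain ⟨L, hL, a, ha, hbound⟩ := h.exists_limit hfin hH hcyc hsum
  obtain ⟨c, hc, hDk⟩ := hdiam
  simp only [hratio]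
  have hlower : ∀ b' : ℝ, liminf (fun i => ((Real.log (h.outer i).card /
      Real.log (spanDiam G (outerPart G C p i)) : ℝ) : EReal)) atTop = (b' : EReal) →
      ∀ ε > (0 : ℝ), ε < b' → ∃ M₀ : ℕ, ∀ M : ℕ, M₀ < M →
          OccursAsMass G v H M → a / 9 * (M : ℝ) ^ (-(2 / (b' - ε))) ≤ L M :=
    fun b' hb' ε hε hεb => hS.lower_bound ha
      (hbound.mono fun i hi M h1 h2 h3 => (hi M h1 h2 h3).1) hb' hε hεb
  have hupper : ∀ b : ℝ, limsup (fun i => ((Real.log (h.outer i).card /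
      Real.log (spanDiam G (outerPart G C p i)) : ℝ) : EReal)) atTop = (b : EReal) →
      ∀ ε > (0 : ℝ), ∃ M₀ : ℕ, ∀ M : ℕ, M₀ < M →
          OccursAsMass G v H M → L M ≤ 2 * c ^ 2 * (M : ℝ) ^ (-(2 / (b + ε))) :=
    fun b hb ε hε => hS.upper_bound hc hDk
      (hbound.mono fun i hi M h1 h2 h3 => (hi M h1 h2 h3).2) hb hε
  have hcrit : ∀ b : ℝ, limsup (fun i => ((Real.log (h.outer i).card /
      Real.log (spanDiam G (outerPart G C p i)) : ℝ) : EReal)) atTop = (b : EReal) →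
      liminf (fun i => ((Real.log (h.outer i).card /
        Real.log (spanDiam G (outerPart G C p i)) : ℝ) : EReal)) atTop = (b : EReal) →
      IsCritical G v H (2 / b) := by
    intro b hb hb'
    have hb0 := hS.liminf_pos hb'
    refine ⟨by positivity, L, hL, a / 9, by positivity, 2 * c ^ 2, by positivity, fun ε hε => ?_⟩
    obtain ⟨η, hη, hηb, hle⟩ := exists_exponent_lower hb0 hε
    obtain ⟨η', hη', hle'⟩ := exists_exponent_upper hb0 hε
    obtain ⟨M₁, h1⟩ := hlower b hb' η hη hηb
    obtain ⟨M₂, h2⟩ := hupper b hb η' hη'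
    refine ⟨max 1 (max M₁ M₂), le_max_left _ _, fun M hM hocc => ?_⟩
    simp only [max_lt_iff] at hM
    have hM1 : (1 : ℝ) ≤ M := by exact_mod_cast hM.1.le
    constructor
    · refine le_trans (mul_le_mul_of_nonneg_left ?_ (by positivity)) (h1 M hM.2.1 hocc)
      exact Real.rpow_le_rpow_of_exponent_le hM1 (by linarith)
    · refine (h2 M hM.2.2 hocc).trans (mul_le_mul_of_nonneg_left ?_ (by positivity))
      exact Real.rpow_le_rpow_of_exponent_le hM1 (by linarith)
  refine ⟨⟨L, hL, fun b' hb' => ⟨a / 9, by positivity, hlower b' hb'⟩,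
    fun b hb => ⟨2 * c ^ 2, by positivity, hupper b hb⟩⟩, hcrit, fun b _ hb => ?_⟩
  have hE := (continuous_coe_real_ereal.tendsto b).comp hb
  exact hcrit b hE.limsup_eq hE.liminf_eq
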